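/- Let $\mathcal G$ be a second-countable locally compact Hausdorff groupoid with a (right) Haar system $\lambda=\{\lambda_x\}_{x\in\mathcal G^{(0)}}$: each $\lambda_x$ is a Radon measure with support $\mathcal G_x=\{\gamma: s(\gamma)=x\}$, the function $x\mapsto\int f\,d\lambda_x$ is continuous on the unit space $\mathcal G^{(0)}$ for every $f\in C_c(\mathcal G)$, and $\int f(\gamma\eta)\,d\lambda_{r(\eta)}(\gamma)=\int f\,d\lambda_{s(\eta)}$ for all $\eta\in\mathcal G$ and $f\in C_c(\mathcal G)$. Let $\sigma$ be a normalized continuous $\mathbb T$-valued $2$-cocycle on $\mathcal G$, that is, a continuous map on the composable pairs with $\sigma(r(\gamma),\gamma)=1=\sigma(\gamma,s(\gamma))$ and $\sigma(\alpha,\beta)\sigma(\alpha\beta,\gamma)=\sigma(\beta,\gamma)\sigma(\alpha,\beta\gamma)$. Let $C_c(\mathcal G,\sigma)$ be $C_c(\mathcal G)$ with the product $(f\star g)(\gamma)=\int f(\gamma\mu^{-1})g(\mu)\sigma(\gamma\mu^{-1},\mu)\,d\lambda_{s(\gamma)}(\mu)$ and the involution $f^*(\gamma)=\overline{\sigma(\gamma^{-1},\gamma)}\,\overline{f(\gamma^{-1})}$.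 For $1\le p\le\infty$ and $x\in\mathcal G^{(0)}$ let $L^{p}_x(f)$ be the bounded operator $(L^{p}_x(f)\xi)(\gamma)=\int\sigma(\gamma\mu^{-1},\mu)f(\gamma\mu^{-1})\xi(\mu)\,d\lambda_x(\mu)$ on $L^p(\mathcal G_x,\lambda_x)$, and put $\|f\|_{r,p}=\sup_x\|L^p_x(f)\|$. Let - $L^1(\mathcal G,\sigma)$ be the completion of $C_c(\mathcal G,\sigma)$ in $\|f\|_I=\sup_x\max\{\int|f(\gamma)|\,d\lambda_x(\gamma),\int|f(\gamma^{-1})|\,d\lambda_x(\gamma)\}$, - $F^p_\sharp(\mathcal G,\sigma)$, for $1<p<\infty$, be the completion of $L^1(\mathcal G,\sigma)$ (equivalently, of its dense subalgebra $C_c(\mathcal G,\sigma)$) in $\|f\|_{\sharp,p}=\max\{\|f\|_{r,p},\|f\|_{r,q}\}$, where $\frac1p+\frac1q=1$, - $C^*_r(\mathcal G,\sigma)$ be the completion of $C_c(\mathcal G,\sigma)$ in $\|f\|_{r,2}$. A Banach $*$-algebra is *reduced* if its $*$-representations on Hilbert spaces separate its points. A *nested triple* $A\subseteq B\subseteq C$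 of reduced Banach $*$-algebras consists of reduced Banach $*$-algebras such that $A$ embeds continuously (and injectively) into $B$, and $B$ into $C$, as a dense $*$-subalgebra. It is a *spectral interpolation triple* relative to a dense $*$-subalgebra $S\subseteq A$ if for some $\theta\in(0,1)$ one has $r_B(a)\le r_A(a)^{1-\theta}r_C(a)^{\theta}$ for all $a=a^*\in S$, where $r$ is the spectral radius (taken in the unitization if there is no unit). **Proposition.** Let $1<p<2$. The identity map of $C_c(\mathcal G,\sigma)$ extends to $*$-homomorphisms $L^1(\mathcal G,\sigma)\to F^p_\sharp(\mathcal G,\sigma)\to C^*_r(\mathcal G,\sigma)$ that make $(L^1(\mathcal G,\sigma),F^p_\sharp(\mathcal G,\sigma),C^*_r(\mathcal G,\sigma))$ a nested triple of reduced Banach $*$-algebras and a spectral interpolation triple relative to $L^1(\mathcal G,\sigma)$. More precisely, with $\theta=\frac{2p-2}{p}\in(0,1)$, for every $f\in L^1(\mathcal G,\sigma)$, $$r_{F^p_\sharp(\mathcal G,\sigma)}(f)\le r_{L^1(\mathcal G,\sigma)}(f)^{1-\theta}\,r_{C^*_r(\mathcal G,\sigma)}(f)^{\theta}.$$ -/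

import Mathlib

open MeasureTheory Set Filter Topology
open scoped NNReal ENNReal CompactlySupported

universe u

set_option linter.unusedSectionVars false

noncomputable section

/-! ### Banach `*`-algebras obtained by completing a `*`-algebra in a seminorm -/

/-- A submultiplicative seminorm on a complex `*`-algebra for which the involution is isometric. -/
structure StarAlgSeminorm (A : Type u) [NonUnitalRing A] [Module ℂ A] [StarRing A]
    extends Seminorm ℂ A where
  mul_le' : ∀ a b : A, toFun (a * b) ≤ toFun a * toFun b
  star_eq' : ∀ a : A, toFun (star a) = toFun a

namespace StarAlgSeminorm

variable {A : Type u} [NonUnitalRing A] [Module ℂ A] [StarRing A]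
  [IsScalarTower ℂ A A] [SMulCommClass ℂ A A] [StarModule ℂ A]

/-- The `*`-algebra `A`, topologized by the seminorm `N`. -/
def Carrier (_N : StarAlgSeminorm A) : Type u := A

instance (N : StarAlgSeminorm A) : NonUnitalRing N.Carrier := inferInstanceAs (NonUnitalRing A)
instance (N : StarAlgSeminorm A) : Module ℂ N.Carrier := inferInstanceAs (Module ℂ A)
instance (N : StarAlgSeminorm A) : StarRing N.Carrier := inferInstanceAs (StarRing A)
instance (N : StarAlgSeminorm A) : StarModule ℂ N.Carrier := inferInstanceAs (StarModule ℂ A)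
instance (N : StarAlgSeminorm A) : IsScalarTower ℂ N.Carrier N.Carrier :=
  inferInstanceAs (IsScalarTower ℂ A A)
instance (N : StarAlgSeminorm A) : SMulCommClass ℂ N.Carrier N.Carrier :=
  inferInstanceAs (SMulCommClass ℂ A A)

instance (N : StarAlgSeminorm A) : NonUnitalSeminormedRing N.Carrier :=
  { (inferInstance : NonUnitalRing N.Carrier),
    N.toSeminorm.toAddGroupSeminorm.toSeminormedAddCommGroup with
    norm_mul_le := fun a b => N.mul_le' a b }

instance (N : StarAlgSeminorm A) : NormedSpace ℂ N.Carrier where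
  __ := (inferInstance : Module ℂ N.Carrier)
  norm_smul_le c a := (map_smul_eq_mul N.toSeminorm c (show A from a)).le

instance (N : StarAlgSeminorm A) : NormedStarGroup N.Carrier where
  norm_star_le a := (N.star_eq' a).le

/-- The completion of the `*`-algebra `A` in the seminorm `N`. -/
def Completion (N : StarAlgSeminorm A) : Type u := UniformSpace.Completion N.Carrier

namespace Completion

variable (N : StarAlgSeminorm A)

instance : NormedAddCommGroup N.Completion :=
  inferInstanceAs (NormedAddCommGroup (UniformSpace.Completion N.Carrier))
instance : NormedSpace ℂ N.Completion :=
  inferInstanceAs (NormedSpace ℂ (UniformSpace.Completion N.Carrier))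
instance : CompleteSpace N.Completion :=
  inferInstanceAs (CompleteSpace (UniformSpace.Completion N.Carrier))

/-- The canonical map from `A` to its completion. -/
def ofAlg (a : A) : N.Completion := ((show N.Carrier from a : N.Carrier) : UniformSpace.Completion N.Carrier)

lemma denseRange_ofAlg : DenseRange (ofAlg N) :=
  UniformSpace.Completion.denseRange_coe (α := N.Carrier)

lemma isDenseInducing_coe :
    IsDenseInducing (fun a : N.Carrier => (ofAlg N a : N.Completion)) :=
  UniformSpace.Completion.isDenseInducing_coe

lemma norm_ofAlg (a : A) : ‖ofAlg N a‖ = N.toSeminorm a :=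
  UniformSpace.Completion.norm_coe (E := N.Carrier) a

lemma ofAlg_add (a b : A) : ofAlg N (a + b) = ofAlg N a + ofAlg N b :=
  UniformSpace.Completion.coe_add (α := N.Carrier) a b

lemma ofAlg_zero : ofAlg N (0 : A) = 0 :=
  UniformSpace.Completion.coe_zero (α := N.Carrier)

lemma ofAlg_smul (c : ℂ) (a : A) : ofAlg N (c • a) = c • ofAlg N a :=
  UniformSpace.Completion.coe_smul (M := ℂ) (X := N.Carrier) c a

@[elab_as_elim]
lemma ind {N : StarAlgSeminorm A} {P : N.Completion → Prop} (x : N.Completion) (hc : IsClosed {x | P x})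
    (h : ∀ a : A, P (ofAlg N a)) : P x :=
  UniformSpace.Completion.induction_on (α := N.Carrier) x hc h

/-- The multiplication of the completion, extended by continuity. -/
@[irreducible]
def mulExt : N.Completion → N.Completion → N.Completion :=
  Function.curry <| ((isDenseInducing_coe N).prodMap (isDenseInducing_coe N)).extend
    (fun ab => ofAlg N (ab.1 * ab.2 : N.Carrier))

instance : Mul N.Completion := ⟨mulExt N⟩

lemma continuous_ofAlg : Continuous (fun a : N.Carrier => ofAlg N a) :=
  (isDenseInducing_coe N).continuous

lemma ofAlg_mul (a b : A) : ofAlg N (a * b) = ofAlg N a * ofAlg N b := by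
  change ofAlg N (a * b) = mulExt N (ofAlg N a) (ofAlg N b)
  unfold mulExt
  exact (((isDenseInducing_coe N).prodMap (isDenseInducing_coe N)).extend_eq
    ((continuous_ofAlg N).comp (continuous_mul (M := N.Carrier)))
    ((a, b) : N.Carrier × N.Carrier)).symm

instance : ContinuousMul N.Completion where
  continuous_mul := by
    let c : N.Carrier →+ N.Completion :=
      { toFun := fun a => ofAlg N a, map_zero' := ofAlg_zero N, map_add' := ofAlg_add N }
    let m := (AddMonoidHom.mul : N.Carrier →+ N.Carrier →+ N.Carrier).compr₂ c
    have h : Continuous fun p : N.Carrier × N.Carrier => m p.1 p.2 :=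
      (continuous_ofAlg N).comp continuous_mul
    have di : IsDenseInducing c := isDenseInducing_coe N
    change Continuous fun p : N.Completion × N.Completion => mulExt N p.1 p.2
    unfold mulExt
    exact di.extend_Z_bilin di h

instance : NonUnitalNormedRing N.Completion :=
  { (inferInstance : NormedAddCommGroup N.Completion),
    (inferInstance : Mul N.Completion) with
    zero_mul := fun x => by
      refine ind x ?_ fun a => ?_
      · exact isClosed_eq (by fun_prop) (by fun_prop)
      rw [← ofAlg_zero N, ← ofAlg_mul, zero_mul]
    mul_zero := fun x => by
      refine ind x ?_ fun a => ?_
      · exact isClosed_eq (by fun_prop) (by fun_prop)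
      rw [← ofAlg_zero N, ← ofAlg_mul, mul_zero]
    mul_assoc := fun x y z => by
      refine ind x ?_ fun a => ?_
      · exact isClosed_eq (by fun_prop) (by fun_prop)
      refine ind y ?_ fun b => ?_
      · exact isClosed_eq (by fun_prop) (by fun_prop)
      refine ind z ?_ fun c => ?_
      · exact isClosed_eq (by fun_prop) (by fun_prop)
      simp only [← ofAlg_mul, mul_assoc]
    left_distrib := fun x y z => by
      refine ind x ?_ fun a => ?_
      · exact isClosed_eq (by fun_prop) (by fun_prop)
      refine ind y ?_ fun b => ?_
      · exact isClosed_eq (by fun_prop) (by fun_prop)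
      refine ind z ?_ fun c => ?_
      · exact isClosed_eq (by fun_prop) (by fun_prop)
      simp only [← ofAlg_mul, ← ofAlg_add, mul_add]
    right_distrib := fun x y z => by
      refine ind x ?_ fun a => ?_
      · exact isClosed_eq (by fun_prop) (by fun_prop)
      refine ind y ?_ fun b => ?_
      · exact isClosed_eq (by fun_prop) (by fun_prop)
      refine ind z ?_ fun c => ?_
      · exact isClosed_eq (by fun_prop) (by fun_prop)
      simp only [← ofAlg_mul, ← ofAlg_add, add_mul]
    norm_mul_le := fun x y => by
      refine ind x ?_ fun a => ?_
      · exact isClosed_le (by fun_prop) (by fun_prop)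
      refine ind y ?_ fun b => ?_
      · exact isClosed_le (by fun_prop) (by fun_prop)
      rw [← ofAlg_mul, norm_ofAlg, norm_ofAlg, norm_ofAlg]
      exact N.mul_le' a b }

lemma continuous_const_smul' (c : ℂ) : Continuous fun x : N.Completion => c • x :=
  continuous_const_smul c

instance : IsScalarTower ℂ N.Completion N.Completion where
  smul_assoc c x y := by
    simp only [smul_eq_mul]
    refine ind x ?_ fun a => ?_
    · exact isClosed_eq ((continuous_const_smul' N c).mul continuous_const)
        ((continuous_const_smul' N c).comp (continuous_id.mul continuous_const))
    refine ind y ?_ fun b => ?_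
    · exact isClosed_eq (continuous_const.mul continuous_id)
        ((continuous_const_smul' N c).comp (continuous_const.mul continuous_id))
    rw [← ofAlg_smul, ← ofAlg_mul, ← ofAlg_mul, ← ofAlg_smul, smul_mul_assoc]

instance : SMulCommClass ℂ N.Completion N.Completion where
  smul_comm c x y := by
    simp only [smul_eq_mul]
    refine ind x ?_ fun a => ?_
    · exact isClosed_eq ((continuous_const_smul' N c).comp (continuous_id.mul continuous_const))
        (continuous_id.mul continuous_const)
    refine ind y ?_ fun b => ?_
    · exact isClosed_eq ((continuous_const_smul' N c).comp (continuous_const.mul continuous_id))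
        (continuous_const.mul (continuous_const_smul' N c))
    rw [← ofAlg_smul, ← ofAlg_mul, ← ofAlg_mul, ← ofAlg_smul, mul_smul_comm]

/-- The involution of the completion, extended by continuity. -/
@[irreducible]
def starExt : N.Completion → N.Completion :=
  UniformSpace.Completion.map (star : N.Carrier → N.Carrier)

instance : Star N.Completion := ⟨starExt N⟩

lemma continuous_star' : Continuous (star : N.Completion → N.Completion) := by
  change Continuous (starExt N)
  unfold starExt
  exact UniformSpace.Completion.continuous_map

lemma ofAlg_star (a : A) : ofAlg N (star a) = star (ofAlg N a) := by
  change ofAlg N (star a) = starExt N (ofAlg N a)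
  unfold starExt
  exact
  (UniformSpace.Completion.map_coe (α := N.Carrier) (β := N.Carrier)
    (star_isometry (E := N.Carrier)).uniformContinuous a).symm

instance : StarRing N.Completion where
  star_involutive x := by
    refine ind x ?_ fun a => ?_
    · exact isClosed_eq ((continuous_star' N).comp (continuous_star' N)) continuous_id
    rw [← ofAlg_star, ← ofAlg_star, star_star]
  star_mul x y := by
    have := continuous_star' N
    refine ind x ?_ fun a => ?_
    · exact isClosed_eq (by fun_prop) (by fun_prop)
    refine ind y ?_ fun b => ?_
    · exact isClosed_eq (by fun_prop) (by fun_prop)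
    rw [← ofAlg_mul, ← ofAlg_star, ← ofAlg_star, ← ofAlg_star, ← ofAlg_mul, star_mul]
  star_add x y := by
    have := continuous_star' N
    refine ind x ?_ fun a => ?_
    · exact isClosed_eq (by fun_prop) (by fun_prop)
    refine ind y ?_ fun b => ?_
    · exact isClosed_eq (by fun_prop) (by fun_prop)
    rw [← ofAlg_add, ← ofAlg_star, ← ofAlg_star, ← ofAlg_star, ← ofAlg_add, star_add]

instance : StarModule ℂ N.Completion where
  star_smul c x := by
    have h := continuous_star' N
    refine ind x ?_ fun a => ?_
    · exact isClosed_eq (h.comp (continuous_const_smul' N c))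
        ((continuous_const_smul' N (star c)).comp h)
    rw [← ofAlg_smul, ← ofAlg_star, ← ofAlg_star, ← ofAlg_smul, star_smul]

instance : NormedStarGroup N.Completion where
  norm_star_le x := by
    have := continuous_star' N
    refine ind x ?_ fun a => ?_
    · exact isClosed_le (by fun_prop) (by fun_prop)
    rw [← ofAlg_star, norm_ofAlg, norm_ofAlg]
    exact (N.star_eq' a).le

end Completion

end StarAlgSeminorm

/-! ### Integral operators on `L^p` whose kernels satisfy Schur's condition -/

section Schur

variable {α : Type u} [MeasurableSpace α] {m : Measure α}

/-- A measurable kernel `k` satisfies Schur's condition with constant `C`: its rows and its columns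
have `L^1`-norm at most `C`. -/
structure IsSchurKernel (m : Measure α) (k : α → α → ℂ) (C : ℝ≥0) : Prop where
  meas : AEStronglyMeasurable (Function.uncurry k) (m.prod m)
  row : ∀ᵐ a ∂m, ∫⁻ b, ‖k a b‖ₑ ∂m ≤ C
  col : ∀ᵐ b ∂m, ∫⁻ a, ‖k a b‖ₑ ∂m ≤ C

/-- The integral operator with kernel `k`, applied to the function `ξ`. -/
def kernelFun (m : Measure α) (k : α → α → ℂ) (ξ : α → ℂ) (a : α) : ℂ := ∫ b, k a b * ξ b ∂m

variable [SFinite m] {k l : α → α → ℂ} {C D : ℝ≥0} {p q : ℝ≥0∞}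

lemma IsSchurKernel.row_meas (hk : IsSchurKernel m k C) :
    ∀ᵐ a ∂m, AEStronglyMeasurable (k a) m := hk.meas.prodMk_left

lemma IsSchurKernel.lintegral_meas (hk : IsSchurKernel m k C) {g : α → ℝ≥0∞}
    (hg : AEMeasurable g m) : AEMeasurable (fun a => ∫⁻ b, ‖k a b‖ₑ * g b ∂m) m := by
  have : AEMeasurable (fun z : α × α => ‖k z.1 z.2‖ₑ * g z.2) (m.prod m) :=
    hk.meas.enorm.mul hg.comp_snd
  exact this.lintegral_prod_right'

lemma IsSchurKernel.lintegral_rpow (hk : IsSchurKernel m k C) {g : α → ℝ≥0∞}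
    (hg : AEMeasurable g m) {r : ℝ} (hr : 1 ≤ r) :
    ∫⁻ a, (∫⁻ b, ‖k a b‖ₑ * g b ∂m) ^ r ∂m ≤ (C : ℝ≥0∞) ^ r * ∫⁻ b, g b ^ r ∂m := by
  have hr0 : 0 < r := by linarith
  have h1 : ∀ᵐ a ∂m, (∫⁻ b, ‖k a b‖ₑ * g b ∂m) ^ r ≤
      (C : ℝ≥0∞) ^ (r - 1) * ∫⁻ b, ‖k a b‖ₑ * g b ^ r ∂m := by
    filter_upwards [hk.row, hk.row_meas] with a ha hma
    have e : ∀ b, ‖k a b‖ₑ * g b =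
        (‖k a b‖ₑ * g b ^ r) ^ (1 / r) * ‖k a b‖ₑ ^ (1 - 1 / r) := by
      intro b
      rw [ENNReal.mul_rpow_of_nonneg _ _ (by positivity), ← ENNReal.rpow_mul,
        mul_one_div_cancel hr0.ne', ENNReal.rpow_one, mul_right_comm,
        ← ENNReal.rpow_add_of_nonneg _ _ (by positivity)
          (by rw [sub_nonneg, div_le_one hr0]; exact hr)]
      simp
    have h2 := ENNReal.lintegral_mul_norm_pow_le (μ := m)
      (f := fun b => ‖k a b‖ₑ * g b ^ r) (g := fun b => ‖k a b‖ₑ)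
      (hma.enorm.mul (hg.pow_const r)) hma.enorm (p := 1 / r) (q := 1 - 1 / r)
      (by positivity) (by rw [sub_nonneg, div_le_one hr0]; exact hr) (by ring)
    simp_rw [← e] at h2
    calc (∫⁻ b, ‖k a b‖ₑ * g b ∂m) ^ r
        ≤ ((∫⁻ b, ‖k a b‖ₑ * g b ^ r ∂m) ^ (1 / r) * (C : ℝ≥0∞) ^ (1 - 1 / r)) ^ r := by
          refine ENNReal.rpow_le_rpow (h2.trans ?_) hr0.le
          gcongr
          rw [sub_nonneg, div_le_one hr0]; exact hr
      _ = (C : ℝ≥0∞) ^ (r - 1) * ∫⁻ b, ‖k a b‖ₑ * g b ^ r ∂m := by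
          rw [ENNReal.mul_rpow_of_nonneg _ _ hr0.le, ← ENNReal.rpow_mul, ← ENNReal.rpow_mul,
            one_div_mul_cancel hr0.ne', ENNReal.rpow_one, mul_comm]
          congr 2
          field_simp
  have hm2 : AEMeasurable (fun z : α × α => ‖k z.1 z.2‖ₑ * g z.2 ^ r) (m.prod m) :=
    hk.meas.enorm.mul ((hg.pow_const r).comp_snd)
  calc _ ≤ ∫⁻ a, (C : ℝ≥0∞) ^ (r - 1) * ∫⁻ b, ‖k a b‖ₑ * g b ^ r ∂m ∂m := lintegral_mono_ae h1
    _ = (C : ℝ≥0∞) ^ (r - 1) * ∫⁻ a, ∫⁻ b, ‖k a b‖ₑ * g b ^ r ∂m ∂m :=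
        lintegral_const_mul'' _ hm2.lintegral_prod_right'
    _ = (C : ℝ≥0∞) ^ (r - 1) * ∫⁻ b, (∫⁻ a, ‖k a b‖ₑ ∂m) * g b ^ r ∂m := by
        rw [lintegral_lintegral_swap hm2]
        congr 1
        refine lintegral_congr_ae ?_
        filter_upwards [hk.meas.prodMk_right] with b hb
        exact lintegral_mul_const'' _ hb.enorm
    _ ≤ (C : ℝ≥0∞) ^ (r - 1) * ∫⁻ b, C * g b ^ r ∂m := by
        gcongr 1
        refine lintegral_mono_ae ?_
        filter_upwards [hk.col] with b hb
        gcongr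
    _ = (C : ℝ≥0∞) ^ r * ∫⁻ b, g b ^ r ∂m := by
        rw [lintegral_const_mul'' _ (hg.pow_const r), ← mul_assoc]
        congr 1
        nth_rw 2 [← ENNReal.rpow_one (C : ℝ≥0∞)]
        rw [← ENNReal.rpow_add_of_nonneg _ _ (by linarith) (by norm_num)]
        simp

lemma IsSchurKernel.eLpNorm_lintegral (hk : IsSchurKernel m k C) {g : α → ℝ≥0∞}
    (hg : AEMeasurable g m) (hp : 1 ≤ p) :
    eLpNorm (fun a => ∫⁻ b, ‖k a b‖ₑ * g b ∂m) p m ≤ C * eLpNorm g p m := by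
  rcases eq_or_ne p ∞ with rfl | hp'
  · rw [eLpNorm_exponent_top, eLpNorm_exponent_top]
    refine eLpNormEssSup_le_of_ae_enorm_bound ?_
    filter_upwards [hk.row, hk.row_meas] with a ha hma
    calc ‖∫⁻ b, ‖k a b‖ₑ * g b ∂m‖ₑ = ∫⁻ b, ‖k a b‖ₑ * g b ∂m := rfl
      _ ≤ ∫⁻ b, ‖k a b‖ₑ * eLpNormEssSup g m ∂m := by
        refine lintegral_mono_ae ?_
        filter_upwards [ae_le_eLpNormEssSup (f := g) (μ := m)] with b hb
        gcongr
        exact hb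
      _ = (∫⁻ b, ‖k a b‖ₑ ∂m) * eLpNormEssSup g m := lintegral_mul_const'' _ hma.enorm
      _ ≤ _ := by gcongr
  · have hp0 : p ≠ 0 := (zero_lt_one.trans_le hp).ne'
    have hr : 1 ≤ p.toReal := by
      rw [← ENNReal.toReal_one]; exact ENNReal.toReal_mono hp' hp
    have hr0 : 0 < p.toReal := by linarith
    rw [eLpNorm_eq_lintegral_rpow_enorm_toReal hp0 hp',
      eLpNorm_eq_lintegral_rpow_enorm_toReal hp0 hp']
    refine (ENNReal.rpow_le_rpow (hk.lintegral_rpow hg hr) (by positivity)).trans (le_of_eq ?_)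
    change _ = C * (∫⁻ b, g b ^ p.toReal ∂m) ^ (1 / p.toReal)
    rw [ENNReal.mul_rpow_of_nonneg _ _ (by positivity), ← ENNReal.rpow_mul,
      mul_one_div_cancel hr0.ne', ENNReal.rpow_one]

lemma IsSchurKernel.ae_lt_top (hk : IsSchurKernel m k C) {g : α → ℝ≥0∞}
    (hg : AEMeasurable g m) (hp : 1 ≤ p) (h : eLpNorm g p m < ∞) :
    ∀ᵐ a ∂m, ∫⁻ b, ‖k a b‖ₑ * g b ∂m < ∞ := by
  have h1 := (hk.eLpNorm_lintegral hg hp).trans_lt (ENNReal.mul_lt_top ENNReal.coe_lt_top h)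
  rcases eq_or_ne p ∞ with rfl | hp'
  · rw [eLpNorm_exponent_top] at h1
    filter_upwards [ae_le_eLpNormEssSup (f := fun a => ∫⁻ b, ‖k a b‖ₑ * g b ∂m) (μ := m)] with a ha
    exact lt_of_le_of_lt ha h1
  · have hp0 : p ≠ 0 := (zero_lt_one.trans_le hp).ne'
    have hr0 : 0 < p.toReal := ENNReal.toReal_pos hp0 hp'
    have h2 := lintegral_rpow_enorm_lt_top_of_eLpNorm_lt_top hp0 hp' h1
    filter_upwards [ae_lt_top' ((hk.lintegral_meas hg).pow_const _) h2.ne] with a ha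
    by_contra hc
    rw [not_lt, top_le_iff] at hc
    change (∫⁻ b, ‖k a b‖ₑ * g b ∂m) ^ p.toReal < ∞ at ha
    rw [hc, ENNReal.top_rpow_of_pos hr0] at ha
    exact lt_irrefl _ ha

lemma IsSchurKernel.integrable (hk : IsSchurKernel m k C) {ξ : α → ℂ} (hξ : MemLp ξ p m)
    (hp : 1 ≤ p) : ∀ᵐ a ∂m, Integrable (fun b => k a b * ξ b) m := by
  have h := hk.ae_lt_top hξ.1.enorm hp (by simpa using hξ.2)
  filter_upwards [h, hk.row_meas] with a ha hma
  refine ⟨hma.mul hξ.1, ?_⟩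
  simpa [HasFiniteIntegral, enorm_mul] using ha

lemma IsSchurKernel.fun_meas (hk : IsSchurKernel m k C) {ξ : α → ℂ}
    (hξ : AEStronglyMeasurable ξ m) : AEStronglyMeasurable (kernelFun m k ξ) m := by
  have : AEStronglyMeasurable (fun z : α × α => k z.1 z.2 * ξ z.2) (m.prod m) :=
    hk.meas.mul hξ.comp_snd
  exact this.integral_prod_right'

lemma IsSchurKernel.eLpNorm_fun (hk : IsSchurKernel m k C) {ξ : α → ℂ}
    (hξ : AEStronglyMeasurable ξ m) (hp : 1 ≤ p) :
    eLpNorm (kernelFun m k ξ) p m ≤ C * eLpNorm ξ p m := by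
  have h := hk.eLpNorm_lintegral hξ.enorm hp
  rw [eLpNorm_enorm] at h
  refine le_trans (eLpNorm_mono_enorm fun a => ?_) h
  refine (enorm_integral_le_lintegral_enorm _).trans ?_
  simp [enorm_mul]

lemma IsSchurKernel.memLp (hk : IsSchurKernel m k C) {ξ : α → ℂ} (hξ : MemLp ξ p m)
    (hp : 1 ≤ p) : MemLp (kernelFun m k ξ) p m :=
  ⟨hk.fun_meas hξ.1, (hk.eLpNorm_fun hξ.1 hp).trans_lt (ENNReal.mul_lt_top ENNReal.coe_lt_top hξ.2)⟩

lemma kernelFun_congr {ξ η : α → ℂ} (h : ξ =ᵐ[m] η) : kernelFun m k ξ = kernelFun m k η := by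
  funext a
  refine integral_congr_ae ?_
  filter_upwards [h] with b hb
  rw [hb]

/-- The operator on `L^p` with integral kernel `k`, as a linear map. -/
def kernelLin (p : ℝ≥0∞) [hp : Fact (1 ≤ p)] (k : α → α → ℂ) (hk : IsSchurKernel m k C) :
    Lp ℂ p m →ₗ[ℂ] Lp ℂ p m where
  toFun ξ := (hk.memLp (Lp.memLp ξ) hp.out).toLp (kernelFun m k ξ)
  map_add' ξ η := by
    refine Lp.ext ?_
    filter_upwards [(hk.memLp (Lp.memLp (ξ + η)) hp.out).coeFn_toLp,
      (hk.memLp (Lp.memLp ξ) hp.out).coeFn_toLp, (hk.memLp (Lp.memLp η) hp.out).coeFn_toLp,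
      Lp.coeFn_add ((hk.memLp (Lp.memLp ξ) hp.out).toLp (kernelFun m k ξ))
        ((hk.memLp (Lp.memLp η) hp.out).toLp (kernelFun m k η)),
      hk.integrable (Lp.memLp ξ) hp.out, hk.integrable (Lp.memLp η) hp.out]
      with a h1 h2 h3 h4 h5 h6
    rw [h1, h4, Pi.add_apply, h2, h3, kernelFun_congr (Lp.coeFn_add ξ η)]
    simp only [kernelFun, Pi.add_apply, mul_add]
    exact integral_add h5 h6
  map_smul' c ξ := by
    refine Lp.ext ?_
    filter_upwards [(hk.memLp (Lp.memLp (c • ξ)) hp.out).coeFn_toLp,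
      (hk.memLp (Lp.memLp ξ) hp.out).coeFn_toLp,
      Lp.coeFn_smul c ((hk.memLp (Lp.memLp ξ) hp.out).toLp (kernelFun m k ξ))]
      with a h1 h2 h4
    rw [h1, RingHom.id_apply, h4, Pi.smul_apply, h2, kernelFun_congr (Lp.coeFn_smul c ξ)]
    simp only [kernelFun, Pi.smul_apply, smul_eq_mul, mul_left_comm _ c]
    exact integral_const_mul _ _

/-- The bounded operator on `L^p` with integral kernel `k`. -/
def kernelOp (p : ℝ≥0∞) [hp : Fact (1 ≤ p)] (k : α → α → ℂ) (hk : IsSchurKernel m k C) :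
    Lp ℂ p m →L[ℂ] Lp ℂ p m :=
  LinearMap.mkContinuous (kernelLin p k hk) C fun ξ => by
    change ‖(hk.memLp (Lp.memLp ξ) hp.out).toLp (kernelFun m k ξ)‖ ≤ _
    rw [Lp.norm_toLp, Lp.norm_def]
    refine ENNReal.toReal_le_of_le_ofReal (by positivity) ?_
    rw [ENNReal.ofReal_mul NNReal.zero_le_coe, ENNReal.ofReal_coe_nnreal,
      ENNReal.ofReal_toReal (Lp.eLpNorm_ne_top ξ)]
    exact hk.eLpNorm_fun (Lp.memLp ξ).1 hp.out

variable [hp : Fact (1 ≤ p)] [hq : Fact (1 ≤ q)]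

lemma norm_kernelOp_le (hk : IsSchurKernel m k C) : ‖kernelOp p k hk‖ ≤ C :=
  LinearMap.mkContinuous_norm_le _ C.2 _

lemma kernelOp_coeFn (hk : IsSchurKernel m k C) (ξ : Lp ℂ p m) :
    kernelOp p k hk ξ =ᵐ[m] kernelFun m k ξ :=
  (hk.memLp (Lp.memLp ξ) hp.out).coeFn_toLp

lemma kernelOp_add {E : ℝ≥0} {n : α → α → ℂ} (hk : IsSchurKernel m k C) (hl : IsSchurKernel m l D)
    (hn : IsSchurKernel m n E) (h : ∀ᵐ a ∂m, ∀ᵐ b ∂m, n a b = k a b + l a b) :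
    kernelOp p n hn = kernelOp p k hk + kernelOp p l hl := by
  ext1 ξ
  refine Lp.ext ?_
  change _ =ᵐ[m] ↑↑(kernelOp p k hk ξ + kernelOp p l hl ξ)
  filter_upwards [kernelOp_coeFn hn ξ, kernelOp_coeFn hk ξ, kernelOp_coeFn hl ξ,
    Lp.coeFn_add (kernelOp p k hk ξ) (kernelOp p l hl ξ), hk.integrable (Lp.memLp ξ) hp.out,
    hl.integrable (Lp.memLp ξ) hp.out, h] with a h1 h2 h3 h4 h5 h6 h7
  rw [h1, h4, Pi.add_apply, h2, h3]
  simp only [kernelFun]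
  rw [← integral_add h5 h6]
  refine integral_congr_ae ?_
  filter_upwards [h7] with b hb
  rw [hb, add_mul]

lemma kernelOp_smul (c : ℂ) (hk : IsSchurKernel m k C) (hl : IsSchurKernel m l D)
    (h : ∀ᵐ a ∂m, ∀ᵐ b ∂m, l a b = c * k a b) :
    kernelOp p l hl = c • kernelOp p k hk := by
  ext1 ξ
  refine Lp.ext ?_
  change _ =ᵐ[m] ↑↑(c • kernelOp p k hk ξ)
  filter_upwards [kernelOp_coeFn hl ξ, kernelOp_coeFn hk ξ,
    Lp.coeFn_smul c (kernelOp p k hk ξ), h] with a h1 h2 h4 h7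
  rw [h1, h4, Pi.smul_apply, h2]
  simp only [kernelFun, smul_eq_mul]
  rw [← integral_const_mul]
  refine integral_congr_ae ?_
  filter_upwards [h7] with b hb
  rw [hb, mul_assoc]

lemma kernelOp_comp {E : ℝ≥0} {n : α → α → ℂ} (hk : IsSchurKernel m k C) (hl : IsSchurKernel m l D)
    (hn : IsSchurKernel m n E) (h : ∀ᵐ a ∂m, ∀ᵐ c ∂m, n a c = ∫ b, k a b * l b c ∂m) :
    kernelOp p n hn = (kernelOp p k hk).comp (kernelOp p l hl) := by
  ext1 ξ
  refine Lp.ext ?_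
  rw [ContinuousLinearMap.comp_apply]
  have hξ := Lp.memLp ξ
  have hg : AEMeasurable (fun b => ∫⁻ c, ‖l b c‖ₑ * ‖ξ c‖ₑ ∂m) m := hl.lintegral_meas hξ.1.enorm
  have hg2 : eLpNorm (fun b => ∫⁻ c, ‖l b c‖ₑ * ‖ξ c‖ₑ ∂m) p m < ∞ := by
    refine (hl.eLpNorm_lintegral hξ.1.enorm hp.out).trans_lt (ENNReal.mul_lt_top ENNReal.coe_lt_top ?_)
    simpa using hξ.2
  filter_upwards [kernelOp_coeFn hn ξ, kernelOp_coeFn hk (kernelOp p l hl ξ), h, hk.row_meas,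
    hk.ae_lt_top hg hp.out hg2] with a h1 h2 h3 h4 h5
  rw [h1, h2, kernelFun_congr (kernelOp_coeFn hl ξ)]
  simp only [kernelFun]
  have hm : AEStronglyMeasurable (fun z : α × α => k a z.1 * (l z.1 z.2 * ξ z.2)) (m.prod m) :=
    h4.comp_fst.mul (hl.meas.mul hξ.1.comp_snd)
  have hint : Integrable (fun z : α × α => k a z.1 * (l z.1 z.2 * ξ z.2)) (m.prod m) := by
    refine ⟨hm, ?_⟩
    rw [HasFiniteIntegral, lintegral_prod _ hm.enorm]
    refine lt_of_le_of_lt (le_of_eq ?_) h5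
    refine lintegral_congr_ae ?_
    filter_upwards [hl.row_meas] with b hb
    simp only [enorm_mul]
    exact lintegral_const_mul'' _ (hb.enorm.mul hξ.1.enorm)
  simp only [← integral_const_mul]
  rw [integral_integral_swap hint]
  refine integral_congr_ae ?_
  filter_upwards [h3] with c hc
  rw [hc, ← integral_mul_const]
  simp only [mul_assoc]

/-- The operators on `L^p` and on the dual `L^q` given by adjoint kernels have the same norm. -/
lemma norm_kernelOp_adjoint_le [hpq : ENNReal.HolderConjugate p q] (hp1 : p ≠ ∞) (hq1 : q ≠ ∞)
    (hk : IsSchurKernel m k C)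
    (hl : IsSchurKernel m l D) (h : ∀ᵐ b ∂m, ∀ᵐ a ∂m, l b a = star (k a b)) :
    ‖kernelOp p k hk‖ ≤ ‖kernelOp q l hl‖ := by
  have hP := ENNReal.HolderConjugate.toReal_of_ne_top hp1 hq1
  set P := p.toReal with hPdef
  set Q := q.toReal with hQdef
  have hp0 : p ≠ 0 := (zero_lt_one.trans_le hp.out).ne'
  have hq0 : q ≠ 0 := (zero_lt_one.trans_le hq.out).ne'
  refine ContinuousLinearMap.opNorm_le_bound _ (norm_nonneg _) fun ξ => ?_
  set f : α → ℂ := kernelFun m k ξ with hf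
  have hfm : MemLp f p m := hk.memLp (Lp.memLp ξ) hp.out
  set ζ : α → ℂ := fun a => ((‖f a‖ ^ (P - 2) : ℝ) : ℂ) * f a with hζ
  have hζm : AEStronglyMeasurable ζ m := by
    refine AEStronglyMeasurable.mul ?_ hfm.1
    exact (Complex.measurable_ofReal.comp_aemeasurable
      (hfm.1.norm.aemeasurable.pow_const _)).aestronglyMeasurable
  have hζn : ∀ a, ‖ζ a‖ = ‖f a‖ ^ (P - 1) := by
    intro a
    rcases eq_or_ne (f a) 0 with h0 | h0
    · simp [hζ, h0, Real.zero_rpow (sub_pos.2 hP.lt).ne']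
    · have : 0 < ‖f a‖ := norm_pos_iff.2 h0
      simp only [hζ, norm_mul, Complex.norm_real, Real.norm_eq_abs,
        abs_of_nonneg (Real.rpow_nonneg this.le _)]
      rw [← Real.rpow_add_one this.ne']
      congr 1
      ring
  have hζe : ∀ a, ‖ζ a‖ₑ ^ Q = ‖f a‖ₑ ^ P := by
    intro a
    rw [← ofReal_norm, hζn, ← ofReal_norm,
      ENNReal.ofReal_rpow_of_nonneg (by positivity) hP.symm.nonneg,
      ENNReal.ofReal_rpow_of_nonneg (by positivity) hP.nonneg, ← Real.rpow_mul (by positivity)]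
    congr 2
    have := hP.sub_one_mul_conj
    linarith
  set I : ℝ≥0∞ := ∫⁻ a, ‖f a‖ₑ ^ P ∂m with hI
  have hfI : eLpNorm f p m = I ^ (1 / P) := eLpNorm_eq_lintegral_rpow_enorm_toReal hp0 hp1
  have hζI : eLpNorm ζ q m = I ^ (1 / Q) := by
    rw [eLpNorm_eq_lintegral_rpow_enorm_toReal hq0 hq1]
    simp only [← hQdef, hζe]
    rfl
  have hItop : I ≠ ∞ := by
    intro hh
    have := hfm.2
    rw [hfI, hh, ENNReal.top_rpow_of_pos (by have := hP.pos; positivity)] at this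
    exact lt_irrefl _ this
  have hζmem : MemLp ζ q m := by
    refine ⟨hζm, ?_⟩
    rw [hζI]
    exact ENNReal.rpow_lt_top_of_nonneg (by have := hP.symm.pos; positivity) hItop
  set η : Lp ℂ q m := kernelOp q l hl (hζmem.toLp ζ) with hη
  have hηc : η =ᵐ[m] kernelFun m l ζ := by
    refine (kernelOp_coeFn hl _).trans ?_
    rw [kernelFun_congr hζmem.coeFn_toLp]
  have hξm := Lp.memLp ξ
  -- the Fubini computation
  have hmeas : AEStronglyMeasurable (fun z : α × α => star (ζ z.1) * (k z.1 z.2 * ξ z.2))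
      (m.prod m) :=
    (continuous_star.comp_aestronglyMeasurable hζm).comp_fst.mul (hk.meas.mul hξm.1.comp_snd)
  have hG := hk.eLpNorm_lintegral (p := p) hξm.1.enorm hp.out
  rw [eLpNorm_enorm] at hG
  have hint : Integrable (fun z : α × α => star (ζ z.1) * (k z.1 z.2 * ξ z.2)) (m.prod m) := by
    refine ⟨hmeas, ?_⟩
    rw [HasFiniteIntegral, lintegral_prod _ hmeas.enorm]
    have e : ∫⁻ a, ∫⁻ b, ‖star (ζ a) * (k a b * ξ b)‖ₑ ∂m ∂m =
        ∫⁻ a, ((fun a => ∫⁻ b, ‖k a b‖ₑ * ‖ξ b‖ₑ ∂m) * fun a => ‖ζ a‖ₑ) a ∂m := by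
      refine lintegral_congr_ae ?_
      filter_upwards [hk.row_meas] with a ha
      simp only [enorm_mul, Pi.mul_apply]
      rw [lintegral_const_mul' _ _ enorm_ne_top, mul_comm]
      congr 1
      rw [← ofReal_norm, ← ofReal_norm, norm_star]
    rw [e]
    refine (ENNReal.lintegral_mul_le_Lp_mul_Lq m hP (hk.lintegral_meas hξm.1.enorm)
      hζm.enorm).trans_lt (ENNReal.mul_lt_top ?_ ?_)
    · have := hG.trans_lt (ENNReal.mul_lt_top ENNReal.coe_lt_top hξm.2)
      rwa [eLpNorm_eq_lintegral_rpow_enorm_toReal hp0 hp1] at this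
    · have := hζmem.2
      rwa [eLpNorm_eq_lintegral_rpow_enorm_toReal hq0 hq1] at this
  have hk' : ∀ᵐ b ∂m, kernelFun m l ζ b = ∫ a, star (k a b) * ζ a ∂m := by
    filter_upwards [h] with b hb
    refine integral_congr_ae ?_
    filter_upwards [hb] with a ha
    rw [ha]
  have key : ∫ a, star (ζ a) * f a ∂m = ∫ b, ξ b * star (η b) ∂m := by
    calc ∫ a, star (ζ a) * f a ∂m = ∫ a, ∫ b, star (ζ a) * (k a b * ξ b) ∂m ∂m := by
          simp only [hf, kernelFun, integral_const_mul]
      _ = ∫ b, ∫ a, star (ζ a) * (k a b * ξ b) ∂m ∂m := integral_integral_swap hint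
      _ = ∫ b, ξ b * star (η b) ∂m := by
          refine integral_congr_ae ?_
          filter_upwards [hηc, hk'] with b hb1 hb2
          rw [hb1, hb2]
          have : star (∫ a, star (k a b) * ζ a ∂m) = ∫ a, k a b * star (ζ a) ∂m := by
            rw [← starRingEnd_apply, ← integral_conj]
            simp
          rw [this, ← integral_const_mul]
          refine integral_congr_ae (.of_forall fun a => ?_)
          ring
  have hself : ∀ a, star (ζ a) * f a = ((‖f a‖ ^ P : ℝ) : ℂ) := by
    intro a
    rcases eq_or_ne (f a) 0 with h0 | h0
    · simp [h0, Real.zero_rpow hP.pos.ne']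
    · have h1 : 0 < ‖f a‖ := norm_pos_iff.2 h0
      have h2 : star (f a) * f a = ((‖f a‖ ^ 2 : ℝ) : ℂ) := by
        rw [Complex.star_def, ← Complex.normSq_eq_conj_mul_self, Complex.normSq_eq_norm_sq]
      simp only [hζ, star_mul', Complex.star_def, Complex.conj_ofReal]
      rw [Complex.star_def] at h2
      rw [mul_assoc, h2, ← Complex.ofReal_mul, ← Real.rpow_natCast, ← Real.rpow_add h1]
      congr 2
      push_cast
      ring
  have hIn : I = ‖∫ a, star (ζ a) * f a ∂m‖ₑ := by
    simp only [hself]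
    rw [integral_complex_ofReal, ← ofReal_norm, Complex.norm_real, Real.norm_eq_abs,
      abs_of_nonneg (integral_nonneg fun a => by positivity),
      ofReal_integral_eq_lintegral_ofReal]
    · refine lintegral_congr fun a => ?_
      rw [← ENNReal.ofReal_rpow_of_nonneg (by positivity) hP.nonneg, ofReal_norm]
    · have := hfm.integrable_norm_rpow hp0 hp1
      exact this
    · exact .of_forall fun a => by positivity
  have hhol : I ≤ eLpNorm ξ p m * eLpNorm η q m := by
    rw [hIn, key]
    refine (enorm_integral_le_lintegral_enorm _).trans ?_
    have h3 := ENNReal.lintegral_mul_le_Lp_mul_Lq m hP hξm.1.enorm (Lp.memLp η).1.enorm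
    rw [eLpNorm_eq_lintegral_rpow_enorm_toReal hp0 hp1,
      eLpNorm_eq_lintegral_rpow_enorm_toReal hq0 hq1]
    refine le_trans (le_of_eq ?_) h3
    refine lintegral_congr fun b => ?_
    simp only [enorm_mul, Pi.mul_apply]
    congr 1
    rw [← ofReal_norm, ← ofReal_norm, norm_star]
  have hn1 : ‖kernelOp p k hk ξ‖ = I.toReal ^ (1 / P) := by
    rw [Lp.norm_def, eLpNorm_congr_ae (kernelOp_coeFn hk ξ), ← hf, hfI, ENNReal.toReal_rpow]
  have hn2 : ‖hζmem.toLp ζ‖ = I.toReal ^ (1 / Q) := by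
    rw [Lp.norm_toLp, hζI, ENNReal.toReal_rpow]
  have hfin : I.toReal ≤ ‖ξ‖ * (‖kernelOp q l hl‖ * I.toReal ^ (1 / Q)) := by
    have h4 : I.toReal ≤ ‖ξ‖ * ‖η‖ := by
      rw [Lp.norm_def, Lp.norm_def, ← ENNReal.toReal_mul]
      exact ENNReal.toReal_mono
        (ENNReal.mul_ne_top (Lp.eLpNorm_ne_top ξ) (Lp.eLpNorm_ne_top η)) hhol
    refine h4.trans (mul_le_mul_of_nonneg_left ?_ (norm_nonneg _))
    rw [← hn2]
    exact ContinuousLinearMap.le_opNorm _ _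
  rw [hn1]
  rcases (ENNReal.toReal_nonneg (a := I)).eq_or_lt with h0 | h0
  · rw [← h0, Real.zero_rpow (by have := hP.pos; positivity)]
    positivity
  · have hpos : 0 < I.toReal ^ (1 / Q) := Real.rpow_pos_of_pos h0 _
    refine le_of_mul_le_mul_right ?_ hpos
    rw [← Real.rpow_add h0]
    have : 1 / P + 1 / Q = 1 := by rw [one_div, one_div]; exact hP.inv_add_inv_eq_one
    rw [this, Real.rpow_one]
    linarith

end Schur

/-! ### Topological groupoids, Haar systems and twists -/

/-- A topological groupoid with space of arrows `G`; the units are identified with the identity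
arrows. The product `gmul a b` has a meaning only when `src a = rng b`; its values at the other
pairs are irrelevant and are not constrained. -/
class TopologicalGroupoid (G : Type u) [TopologicalSpace G] where
  src : G → G
  rng : G → G
  ginv : G → G
  gmul : G → G → G
  src_src : ∀ a, src (src a) = src a
  rng_src : ∀ a, rng (src a) = src a
  src_rng : ∀ a, src (rng a) = rng a
  rng_rng : ∀ a, rng (rng a) = rng a
  src_gmul : ∀ {a b}, src a = rng b → src (gmul a b) = src b
  rng_gmul : ∀ {a b}, src a = rng b → rng (gmul a b) = rng a
  gmul_assoc : ∀ {a b c}, src a = rng b → src b = rng c →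
    gmul (gmul a b) c = gmul a (gmul b c)
  gmul_src : ∀ a, gmul a (src a) = a
  rng_gmul_self : ∀ a, gmul (rng a) a = a
  src_ginv : ∀ a, src (ginv a) = rng a
  rng_ginv : ∀ a, rng (ginv a) = src a
  ginv_gmul : ∀ a, gmul (ginv a) a = src a
  gmul_ginv : ∀ a, gmul a (ginv a) = rng a
  continuous_ginv : Continuous ginv
  continuousOn_gmul :
    ContinuousOn (fun z : G × G => gmul z.1 z.2) {z : G × G | src z.1 = rng z.2}

namespace TopologicalGroupoid

section Basic

variable (G : Type u) [TopologicalSpace G] [TopologicalGroupoid G]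

/-- The set of composable pairs. -/
def Composable : Set (G × G) := {z | src z.1 = rng z.2}

/-- The unit space. -/
def UnitSpace : Type u := {x : G // src x = x}

instance : TopologicalSpace (UnitSpace G) := inferInstanceAs (TopologicalSpace {x : G // src x = x})

variable {G}

/-- The source of an arrow, as an element of the unit space. -/
def srcU (a : G) : UnitSpace G := ⟨src a, src_src a⟩

/-- The range of an arrow, as an element of the unit space. -/
def rngU (a : G) : UnitSpace G := ⟨rng a, src_rng a⟩

/-- The set of arrows with source `x`. -/
def Fiber (x : UnitSpace G) : Set G := {a | src a = x.1}

lemma mem_fiber {x : UnitSpace G} {a : G} : a ∈ Fiber x ↔ src a = x.1 := Iff.rfl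

lemma srcU_eq {x : UnitSpace G} {a : G} (h : a ∈ Fiber x) : srcU a = x := Subtype.ext h

lemma mem_fiber_srcU (a : G) : a ∈ Fiber (srcU a) := rfl

/-- `gdiv a b` is the product of `a` and the inverse of `b`. -/
def gdiv (a b : G) : G := gmul a (ginv b)

variable {a b c : G}

lemma gmul_right_cancel' (h : src a = rng b) : gdiv (gmul a b) b = a := by
  rw [gdiv, gmul_assoc h (rng_ginv b).symm, gmul_ginv, ← h, gmul_src]

lemma gdiv_gmul (h : src a = src b) : gmul (gdiv a b) b = a := by
  rw [gdiv, gmul_assoc (by rw [rng_ginv, h]) (src_ginv b), ginv_gmul, ← h, gmul_src]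

lemma src_gdiv (h : src a = src b) : src (gdiv a b) = rng b := by
  rw [gdiv, src_gmul (by rw [rng_ginv, h]), src_ginv]

lemma rng_gdiv (h : src a = src b) : rng (gdiv a b) = rng a := by
  rw [gdiv, rng_gmul (by rw [rng_ginv, h])]

lemma gdiv_self (a : G) : gdiv a a = rng a := gmul_ginv a

/-- Cancellation on the right. -/
lemma eq_of_gmul_eq (ha : src a = rng c) (hb : src b = rng c) (h : gmul a c = gmul b c) : a = b := by
  rw [← gmul_right_cancel' ha, h, gmul_right_cancel' hb]

lemma gmul_gdiv_gdiv (h1 : src a = src b) (h2 : src b = src c) :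
    gmul (gdiv a b) (gdiv b c) = gdiv a c := by
  have h3 : src (gdiv a b) = rng (gdiv b c) := by rw [src_gdiv h1, rng_gdiv h2]
  refine eq_of_gmul_eq (c := c) ?_ (src_gdiv (h1.trans h2)) ?_
  · rw [src_gmul h3, src_gdiv h2]
  · rw [gmul_assoc h3 (src_gdiv h2), gdiv_gmul h2, gdiv_gmul h1, gdiv_gmul (h1.trans h2)]

lemma ginv_gdiv (h : src a = src b) : ginv (gdiv a b) = gdiv b a := by
  refine eq_of_gmul_eq (c := gdiv a b) (src_ginv _) ?_ ?_
  · rw [src_gdiv h.symm, rng_gdiv h]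
  · rw [ginv_gmul, gmul_gdiv_gdiv h.symm h, gdiv_self, src_gdiv h]

lemma ginv_src (a : G) : ginv (src a) = src a := by
  have h := gmul_ginv (src a)
  rw [rng_src] at h
  have h2 := rng_gmul_self (ginv (src a))
  rw [rng_ginv, src_src] at h2
  rw [← h2, h]

lemma gdiv_src (a : G) : gdiv a (src a) = a := by rw [gdiv, ginv_src, gmul_src]

lemma ginv_ginv (a : G) : ginv (ginv a) = a := by
  have h1 : src (ginv (ginv a)) = rng (ginv a) := src_ginv _
  have h2 : src a = rng (ginv a) := (rng_ginv a).symm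
  refine eq_of_gmul_eq h1 h2 ?_
  rw [ginv_gmul, gmul_ginv, src_ginv]

lemma gdiv_gmul_right (h1 : src a = src c) (h2 : src b = rng c) :
    gdiv a (gmul b c) = gdiv (gdiv a c) b := by
  have e : src a = src (gmul b c) := by rw [src_gmul h2, h1]
  have e2 : src (gdiv a c) = src b := by rw [src_gdiv h1, h2]
  have e3 : src (gdiv a (gmul b c)) = rng b := by rw [src_gdiv e, rng_gmul h2]
  refine eq_of_gmul_eq (c := b) e3 (src_gdiv e2) ?_
  have e4 : src (gmul (gdiv a (gmul b c)) b) = rng c := by rw [src_gmul e3, h2]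
  refine eq_of_gmul_eq (c := c) e4 ?_ ?_
  · rw [gdiv_gmul e2, src_gdiv h1]
  · rw [gmul_assoc e3 h2, gdiv_gmul e, gdiv_gmul e2, gdiv_gmul h1]

lemma continuous_src : Continuous (src : G → G) := by
  have h : ∀ a : G, src a = gmul (ginv a) a := fun a => (ginv_gmul a).symm
  rw [continuous_congr h]
  exact continuousOn_gmul.comp_continuous (f := fun a : G => (ginv a, a))
    (continuous_ginv.prodMk continuous_id) fun a => src_ginv a

lemma continuous_rng : Continuous (rng : G → G) := by
  have h : ∀ a : G, rng a = src (ginv a) := fun a => (src_ginv a).symm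
  rw [continuous_congr h]
  exact continuous_src.comp continuous_ginv

lemma continuous_srcU : Continuous (srcU : G → UnitSpace G) := continuous_src.subtype_mk _

variable (G) in
/-- The set of pairs of arrows with the same source. -/
def SameSource : Set (G × G) := {z | src z.1 = src z.2}

lemma continuousOn_gdiv : ContinuousOn (fun z : G × G => gdiv z.1 z.2) (SameSource G) := by
  refine continuousOn_gmul.comp (f := fun z : G × G => (z.1, ginv z.2))
    (continuous_fst.prodMk (continuous_ginv.comp continuous_snd)).continuousOn ?_
  intro z hz
  change src z.1 = rng (ginv z.2)
  rw [rng_ginv]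
  exact hz

variable [T2Space G]

lemma isClosed_sameSource : IsClosed (SameSource G) :=
  isClosed_eq (continuous_src.comp continuous_fst) (continuous_src.comp continuous_snd)

lemma isClosed_composable : IsClosed (Composable G) :=
  isClosed_eq (continuous_src.comp continuous_fst) (continuous_rng.comp continuous_snd)

lemma isClosed_fiber (x : UnitSpace G) : IsClosed (Fiber x) :=
  isClosed_eq continuous_src continuous_const

end Basic

end TopologicalGroupoid

open TopologicalGroupoid

/-- A (right) Haar system: a family of Radon measures `μ x` on `G`, with support the fiber of the
source map over `x`, that is continuous and invariant. (In a second-countable locally compact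
Hausdorff space a Borel measure is Radon as soon as it is finite on compact sets.) -/
structure HaarSystem (G : Type u) [TopologicalSpace G] [TopologicalGroupoid G]
    [MeasurableSpace G] where
  measure : UnitSpace G → Measure G
  finite_on_compacts : ∀ x, IsFiniteMeasureOnCompacts (measure x)
  support_eq : ∀ x, (measure x).support = Fiber x
  continuous_integral : ∀ f : C_c(G, ℂ), Continuous fun x => ∫ a, f a ∂(measure x)
  invariant : ∀ (b : G) (f : C_c(G, ℂ)),
    ∫ a, f (gmul a b) ∂(measure (rngU b)) = ∫ a, f a ∂(measure (srcU b))

/-- A normalized continuous `2`-cocycle with values in the circle. Only its values at composable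
pairs matter. -/
structure TwoCocycle (G : Type u) [TopologicalSpace G] [TopologicalGroupoid G] where
  toFun : G → G → Circle
  continuousOn : ContinuousOn (fun z : G × G => toFun z.1 z.2) (Composable G)
  rng_left : ∀ a, toFun (rng a) a = 1
  src_right : ∀ a, toFun a (src a) = 1
  cocycle : ∀ {a b c}, src a = rng b → src b = rng c →
    toFun a b * toFun (gmul a b) c = toFun b c * toFun a (gmul b c)

instance (G : Type u) [TopologicalSpace G] [TopologicalGroupoid G] :
    CoeFun (TwoCocycle G) (fun _ => G → G → Circle) := ⟨TwoCocycle.toFun⟩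

namespace HaarSystem

variable {G : Type u} [TopologicalSpace G] [TopologicalGroupoid G] [MeasurableSpace G]
  [SecondCountableTopology G] [LocallyCompactSpace G] [T2Space G] [BorelSpace G]
  (lam : HaarSystem G)

instance (x : UnitSpace G) : IsFiniteMeasureOnCompacts (lam.measure x) := lam.finite_on_compacts x

lemma ae_mem (x : UnitSpace G) : ∀ᵐ a ∂(lam.measure x), a ∈ Fiber x := by
  rw [← lam.support_eq x]
  exact Measure.support_mem_ae

lemma aestronglyMeasurable {E : Type*} [NormedAddCommGroup E] [SecondCountableTopology E]
    {x : UnitSpace G} {h : G → E} (hh : ContinuousOn h (Fiber x)) :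
    AEStronglyMeasurable h (lam.measure x) := by
  borelize E
  have := (hh.aemeasurable (μ := lam.measure x)
    (isClosed_fiber x).measurableSet).aestronglyMeasurable
  rwa [Measure.restrict_eq_self_of_ae_mem (lam.ae_mem x)] at this

lemma aemeasurable_map (b : G) :
    AEMeasurable (fun a => gmul a b) (lam.measure (rngU b)) := by
  have hc : ContinuousOn (fun a => gmul a b) (Fiber (rngU b)) :=
    continuousOn_gmul.comp (f := fun a => (a, b)) (by fun_prop) fun a ha => ha
  have := hc.aemeasurable (μ := lam.measure (rngU b)) (isClosed_fiber _).measurableSet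
  rwa [Measure.restrict_eq_self_of_ae_mem (lam.ae_mem _)] at this

lemma map_eq (b : G) :
    (lam.measure (rngU b)).map (fun a => gmul a b) = lam.measure (srcU b) := by
  have hfin : IsFiniteMeasureOnCompacts ((lam.measure (rngU b)).map (fun a => gmul a b)) := by
    constructor
    intro K hK
    rw [Measure.map_apply_of_aemeasurable (lam.aemeasurable_map b) hK.measurableSet]
    have hK2 : IsCompact ((fun a => gmul a (ginv b)) '' (K ∩ Fiber (srcU b))) := by
      refine (hK.inter_right (isClosed_fiber _)).image_of_continuousOn ?_
      refine continuousOn_gmul.comp (f := fun a => (a, ginv b)) (by fun_prop) fun a ha => ?_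
      change src a = rng (ginv b)
      rw [rng_ginv]
      exact ha.2
    refine lt_of_le_of_lt (measure_mono_ae ?_) hK2.measure_lt_top
    filter_upwards [lam.ae_mem (rngU b)] with a ha haK
    exact ⟨gmul a b, ⟨haK, src_gmul ha⟩, gmul_right_cancel' ha⟩
  have := hfin
  refine Measure.ext_of_integral_eq_on_compactlySupported fun f => ?_
  rw [integral_map (lam.aemeasurable_map b) (map_continuous f).aestronglyMeasurable]
  let g : C_c(G, ℂ) := ⟨⟨fun a => (f a : ℂ), by fun_prop⟩,
    f.hasCompactSupport.comp_left (g := fun r : ℝ => (r : ℂ)) (by simp)⟩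
  have h := lam.invariant b g
  change ∫ a, ((f (gmul a b) : ℝ) : ℂ) ∂_ = ∫ a, ((f a : ℝ) : ℂ) ∂_ at h
  rw [integral_complex_ofReal, integral_complex_ofReal] at h
  exact_mod_cast h

lemma lintegral_gmul {b : G} {x : UnitSpace G} (hb : b ∈ Fiber x) {h : G → ℝ≥0∞}
    (hh : ContinuousOn h (Fiber x)) :
    ∫⁻ a, h (gmul a b) ∂(lam.measure (rngU b)) = ∫⁻ a, h a ∂(lam.measure x) := by
  obtain rfl := srcU_eq hb
  have hm := hh.aemeasurable (μ := lam.measure (srcU b)) (isClosed_fiber _).measurableSet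
  rw [Measure.restrict_eq_self_of_ae_mem (lam.ae_mem _)] at hm
  rw [← lam.map_eq b]
  rw [← lam.map_eq b] at hm
  rw [lintegral_map' hm (lam.aemeasurable_map b)]

lemma integral_gmul {b : G} {x : UnitSpace G} (hb : b ∈ Fiber x) {h : G → ℂ}
    (hh : ContinuousOn h (Fiber x)) :
    ∫ a, h (gmul a b) ∂(lam.measure (rngU b)) = ∫ a, h a ∂(lam.measure x) := by
  obtain rfl := srcU_eq hb
  have hm := lam.aestronglyMeasurable hh
  rw [← lam.map_eq b]
  rw [← lam.map_eq b] at hm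
  rw [integral_map (lam.aemeasurable_map b) hm]

lemma continuous_integral_norm (f : C_c(G, ℂ)) :
    Continuous fun x => ∫ a, ‖f a‖ ∂(lam.measure x) := by
  let g : C_c(G, ℂ) := ⟨⟨fun a => (‖f a‖ : ℂ), by fun_prop⟩,
    f.hasCompactSupport.comp_left (g := fun r : ℂ => (‖r‖ : ℂ)) (by simp)⟩
  have h := Complex.continuous_re.comp (lam.continuous_integral g)
  refine h.congr fun x => ?_
  change (∫ a, ((‖f a‖ : ℝ) : ℂ) ∂_).re = _
  rw [integral_complex_ofReal, Complex.ofReal_re]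

lemma bddAbove_integral_norm (f : C_c(G, ℂ)) :
    BddAbove (range fun x => ∫ a, ‖f a‖ ∂(lam.measure x)) := by
  have hs : HasCompactSupport fun x => ∫ a, ‖f a‖ ∂(lam.measure x) := by
    have : T2Space (UnitSpace G) := inferInstanceAs (T2Space {x : G // src x = x})
    refine HasCompactSupport.intro (K := srcU '' tsupport f)
      (f.hasCompactSupport.isCompact.image continuous_srcU) fun x hx => ?_
    refine integral_eq_zero_of_ae ?_
    filter_upwards [lam.ae_mem x] with a ha
    simp only [Pi.zero_apply, norm_eq_zero]
    by_contra h0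
    exact hx ⟨a, subset_tsupport _ h0, srcU_eq ha⟩
  obtain ⟨C, hC⟩ := (lam.continuous_integral_norm f).bounded_above_of_compact_support hs
  refine ⟨C, ?_⟩
  rintro _ ⟨x, rfl⟩
  exact (le_abs_self _).trans (hC x)

lemma continuous_parametric_integral {H : G × G → ℂ} (hH : Continuous H) {K : Set G}
    (hK : IsCompact K) (hz : ∀ a b, b ∉ K → H (a, b) = 0) :
    Continuous fun a => ∫ b, H (a, b) ∂(lam.measure (srcU a)) := by
  obtain ⟨ψ, hψ1, -, hψc, hψ01⟩ :=
    exists_continuous_one_zero_of_isCompact hK isClosed_empty (disjoint_empty K)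
  let ψc : C_c(G, ℂ) := ⟨⟨fun a => (ψ a : ℂ), by fun_prop⟩,
    hψc.comp_left (g := fun r : ℝ => (r : ℂ)) (by simp)⟩
  have hψn : ∀ a, ‖ψc a‖ = ψ a := fun a => by
    change ‖((ψ a : ℝ) : ℂ)‖ = _
    rw [Complex.norm_real, Real.norm_eq_abs, abs_of_nonneg (hψ01 a).1]
  obtain ⟨M, hM⟩ := lam.bddAbove_integral_norm ψc
  have hM' : ∀ x, ∫ b, ψ b ∂(lam.measure x) ≤ M := fun x => by
    have := hM ⟨x, rfl⟩
    simpa only [hψn] using this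
  have hHc : ∀ a, HasCompactSupport fun b => H (a, b) := fun a =>
    HasCompactSupport.intro hK fun b hb => hz a b hb
  have hHi : ∀ a x, Integrable (fun b => H (a, b)) (lam.measure x) := fun a x =>
    Continuous.integrable_of_hasCompactSupport (by fun_prop) (hHc a)
  rw [continuous_iff_continuousAt]
  intro a₀
  have h1 : ContinuousAt (fun a => ∫ b, H (a₀, b) ∂(lam.measure (srcU a))) a₀ :=
    ((lam.continuous_integral ⟨⟨fun b => H (a₀, b), by fun_prop⟩, hHc a₀⟩).comp
      continuous_srcU).continuousAt
  have h2 : Tendsto (fun a => ∫ b, H (a, b) ∂(lam.measure (srcU a)) -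
      ∫ b, H (a₀, b) ∂(lam.measure (srcU a))) (𝓝 a₀) (𝓝 0) := by
    rw [Metric.tendsto_nhds]
    intro ε hε
    have hM0 : 0 < |M| + 1 := by positivity
    have h3 : ∀ᶠ a in 𝓝 a₀, ∀ b ∈ K, ‖H (a, b) - H (a₀, b)‖ < ε / (|M| + 1) := by
      refine hK.eventually_forall_of_forall_eventually fun b _ => ?_
      have hc : Continuous fun z : G × G => ‖H (z.1, z.2) - H (a₀, z.2)‖ := by fun_prop
      refine hc.continuousAt.eventually_lt_const ?_
      simpa using by positivity
    filter_upwards [h3] with a ha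
    rw [dist_zero_right, ← integral_sub (hHi _ _) (hHi _ _)]
    have hψi : Integrable ψ (lam.measure (srcU a)) :=
      ψ.continuous.integrable_of_hasCompactSupport hψc
    calc ‖∫ b, (H (a, b) - H (a₀, b)) ∂(lam.measure (srcU a))‖
        ≤ ∫ b, ε / (|M| + 1) * ψ b ∂(lam.measure (srcU a)) := by
          refine norm_integral_le_of_norm_le (hψi.const_mul _) (.of_forall fun b => ?_)
          by_cases hb : b ∈ K
          · rw [hψ1 hb]
            simpa using (ha b hb).le
          · rw [hz a b hb, hz a₀ b hb]
            simpa using mul_nonneg (by positivity) (hψ01 b).1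
      _ = ε / (|M| + 1) * ∫ b, ψ b ∂(lam.measure (srcU a)) := integral_const_mul _ _
      _ ≤ ε / (|M| + 1) * |M| := by
          gcongr
          exact (hM' _).trans (le_abs_self M)
      _ < ε := by
          rw [div_mul_eq_mul_div, div_lt_iff₀ hM0]
          nlinarith
  have h4 := h2.add h1
  simpa [ContinuousAt] using h4

end HaarSystem

/-! ### The twisted convolution algebra -/

section Twisted

variable {G : Type u} [TopologicalSpace G] [TopologicalGroupoid G] [MeasurableSpace G]

/-- The space `C_c(G)`, to be equipped with the `*`-algebra structure twisted by `σ`. -/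
def TwistedCc (_lam : HaarSystem G) (_σ : TwoCocycle G) : Type u := C_c(G, ℂ)

namespace TwistedCc

lemma continuous_circle_coe : Continuous (fun z : Circle => (z : ℂ)) := continuous_subtype_val

variable {lam : HaarSystem G} {σ : TwoCocycle G}

instance : FunLike (TwistedCc lam σ) G ℂ := inferInstanceAs (FunLike C_c(G, ℂ) G ℂ)
instance : AddCommGroup (TwistedCc lam σ) := inferInstanceAs (AddCommGroup C_c(G, ℂ))
instance : Module ℂ (TwistedCc lam σ) := inferInstanceAs (Module ℂ C_c(G, ℂ))

lemma ext {f g : TwistedCc lam σ} (h : ∀ a, f a = g a) : f = g := DFunLike.ext f g h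

lemma add_apply (f g : TwistedCc lam σ) (a : G) : (f + g) a = f a + g a := rfl
lemma zero_apply (a : G) : (0 : TwistedCc lam σ) a = 0 := rfl
lemma smul_apply (c : ℂ) (f : TwistedCc lam σ) (a : G) : (c • f) a = c * f a := rfl

/-- The underlying function of an element of the twisted algebra. -/
def toCc (f : TwistedCc lam σ) : C_c(G, ℂ) := f

lemma continuous (f : TwistedCc lam σ) : Continuous f := map_continuous f.toCc

lemma hasCompactSupport (f : TwistedCc lam σ) : HasCompactSupport f :=
  f.toCc.hasCompactSupport

/-- A continuous function with compact support, as an element of the twisted algebra. -/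
def mk (f : G → ℂ) (hf : Continuous f) (hs : HasCompactSupport f) : TwistedCc lam σ :=
  (⟨⟨f, hf⟩, hs⟩ : C_c(G, ℂ))

lemma mk_apply (f : G → ℂ) (hf : Continuous f) (hs : HasCompactSupport f) (a : G) :
    (mk f hf hs : TwistedCc lam σ) a = f a := rfl

/-- The kernel `σ(ab⁻¹, b) f(ab⁻¹)` of the operator of convolution by `f`. -/
def ker (f : TwistedCc lam σ) (a b : G) : ℂ := (σ (gdiv a b) b : ℂ) * f (gdiv a b)

lemma norm_ker (f : TwistedCc lam σ) (a b : G) : ‖ker f a b‖ = ‖f (gdiv a b)‖ := by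
  rw [ker, norm_mul, Circle.norm_coe, one_mul]

lemma ker_add (f g : TwistedCc lam σ) (a b : G) : ker (f + g) a b = ker f a b + ker g a b := by
  simp only [ker, add_apply, mul_add]

lemma ker_smul (c : ℂ) (f : TwistedCc lam σ) (a b : G) : ker (c • f) a b = c * ker f a b := by
  simp only [ker, smul_apply, mul_left_comm]

lemma ker_zero (a b : G) : ker (0 : TwistedCc lam σ) a b = 0 := by
  simp only [ker, zero_apply, mul_zero]

lemma ker_src (f : TwistedCc lam σ) (a : G) : ker f a (src a) = f a := by
  rw [ker, gdiv_src, σ.src_right, Circle.coe_one, one_mul]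

lemma continuousOn_ker (f : TwistedCc lam σ) :
    ContinuousOn (fun z : G × G => ker f z.1 z.2) (SameSource G) := by
  have h1 : ContinuousOn (fun z : G × G => σ (gdiv z.1 z.2) z.2) (SameSource G) := by
    refine σ.continuousOn.comp (f := fun z : G × G => (gdiv z.1 z.2, z.2))
      (continuousOn_gdiv.prodMk continuous_snd.continuousOn) fun z hz => ?_
    exact src_gdiv hz
  exact (continuous_circle_coe.comp_continuousOn h1).mul
    (f.continuous.comp_continuousOn continuousOn_gdiv)

lemma continuousOn_ker_left {x : UnitSpace G} {b : G} (hb : b ∈ Fiber x) (f : TwistedCc lam σ) :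
    ContinuousOn (fun a => ker f a b) (Fiber x) :=
  f.continuousOn_ker.comp (f := fun a => (a, b)) (by fun_prop) fun _ ha =>
    Eq.trans ha (Eq.symm hb)

lemma continuousOn_ker_right {x : UnitSpace G} {a : G} (ha : a ∈ Fiber x) (f : TwistedCc lam σ) :
    ContinuousOn (fun b => ker f a b) (Fiber x) :=
  f.continuousOn_ker.comp (f := fun b => (a, b)) (by fun_prop) fun _ hb =>
    Eq.trans ha (Eq.symm hb)

/-- The twisted convolution product, as a function. -/
def convFun (f g : TwistedCc lam σ) (a : G) : ℂ :=
  ∫ b, f (gdiv a b) * g b * (σ (gdiv a b) b : ℂ) ∂(lam.measure (srcU a))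

lemma convFun_eq (f g : TwistedCc lam σ) (a : G) :
    convFun f g a = ∫ b, ker f a b * g b ∂(lam.measure (srcU a)) := by
  simp only [convFun, ker]
  congr 1
  funext b
  ring

/-- The twisted involution, as a function. -/
def starFun (f : TwistedCc lam σ) (a : G) : ℂ :=
  star (σ (ginv a) a : ℂ) * star (f (ginv a))

lemma norm_starFun (f : TwistedCc lam σ) (a : G) : ‖starFun f a‖ = ‖f (ginv a)‖ := by
  rw [starFun, norm_mul, norm_star, norm_star, Circle.norm_coe, one_mul]

lemma continuous_starFun (f : TwistedCc lam σ) : Continuous (starFun f) := by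
  have h1 : Continuous fun a => σ (ginv a) a :=
    σ.continuousOn.comp_continuous (f := fun a : G => (ginv a, a))
      (continuous_ginv.prodMk continuous_id) fun a => src_ginv a
  exact (continuous_star.comp (continuous_circle_coe.comp h1)).mul
    (continuous_star.comp (f.continuous.comp continuous_ginv))

variable [T2Space G]

lemma hasCompactSupport_starFun (f : TwistedCc lam σ) : HasCompactSupport (starFun f) := by
  refine HasCompactSupport.intro (K := ginv '' tsupport f)
    (f.hasCompactSupport.isCompact.image continuous_ginv) fun a ha => ?_
  rw [← norm_eq_zero, norm_starFun, norm_eq_zero]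
  by_contra h
  exact ha ⟨ginv a, subset_tsupport _ h, ginv_ginv a⟩

instance : Star (TwistedCc lam σ) :=
  ⟨fun f => mk (starFun f) f.continuous_starFun f.hasCompactSupport_starFun⟩

lemma star_apply (f : TwistedCc lam σ) (a : G) :
    (star f) a = star (σ (ginv a) a : ℂ) * star (f (ginv a)) := rfl

lemma norm_star_apply (f : TwistedCc lam σ) (a : G) : ‖(star f) a‖ = ‖f (ginv a)‖ :=
  f.norm_starFun a

lemma cocycle_inv (a : G) : σ a (ginv a) = σ (ginv a) a := by
  have h := σ.cocycle (a := a) (b := ginv a) (c := a) (rng_ginv a).symm (src_ginv a)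
  rw [gmul_ginv, ginv_gmul, σ.rng_left, σ.src_right, mul_one, mul_one] at h
  exact h

lemma ker_star {a b : G} (h : src a = src b) (f : TwistedCc lam σ) :
    ker (star f) a b = star (ker f b a) := by
  have hc := σ.cocycle (a := gdiv b a) (b := gdiv a b) (c := b)
    (by rw [src_gdiv h.symm, rng_gdiv h]) (src_gdiv h)
  rw [gdiv_gmul h, gmul_gdiv_gdiv h.symm h, gdiv_self, σ.rng_left, mul_one] at hc
  rw [ker, ker, star_apply, ginv_gdiv h, hc, star_mul', Circle.coe_mul, star_mul']
  have h1 : ((σ (gdiv a b) b : Circle) : ℂ) * star ((σ (gdiv a b) b : Circle) : ℂ) = 1 := by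
    rw [Complex.star_def, Complex.mul_conj, Circle.normSq_coe, Complex.ofReal_one]
  linear_combination (star (σ (gdiv b a) a : ℂ) * star (f (gdiv b a))) * h1

variable [SecondCountableTopology G] [LocallyCompactSpace G] [BorelSpace G]

lemma continuous_convFun (f g : TwistedCc lam σ) : Continuous (convFun f g) := by
  have hF : ContinuousOn (fun z : G × G => ker f z.1 z.2 * g z.2) (SameSource G) :=
    f.continuousOn_ker.mul (g.continuous.comp continuous_snd).continuousOn
  obtain ⟨F, hF2⟩ := ContinuousMap.exists_restrict_eq (X := G × G) (Y := ℂ) isClosed_sameSource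
    ⟨_, continuousOn_iff_continuous_domRestrict.1 hF⟩
  have hF3 : ∀ a b, src a = src b → F (a, b) = ker f a b * g b := fun a b hab =>
    congrArg (fun φ : C(SameSource G, ℂ) => φ ⟨(a, b), hab⟩) hF2
  obtain ⟨χ, hχ1, -, hχc, -⟩ := exists_continuous_one_zero_of_isCompact
    g.hasCompactSupport.isCompact isClosed_empty (disjoint_empty _)
  have h := lam.continuous_parametric_integral (H := fun z => F z * χ z.2) (by fun_prop)
    hχc.isCompact fun a b hb => by simp [image_eq_zero_of_notMem_tsupport hb]
  refine h.congr fun a => ?_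
  rw [convFun_eq]
  refine integral_congr_ae ?_
  filter_upwards [lam.ae_mem (srcU a)] with b hb
  rw [hF3 a b (Eq.symm hb)]
  by_cases hb2 : b ∈ tsupport g
  · simp [hχ1 hb2]
  · simp [image_eq_zero_of_notMem_tsupport hb2]

lemma hasCompactSupport_convFun (f g : TwistedCc lam σ) : HasCompactSupport (convFun f g) := by
  have hK : IsCompact ((fun z : G × G => gmul z.1 z.2) ''
      ((tsupport f ×ˢ tsupport g) ∩ Composable G)) :=
    ((f.hasCompactSupport.isCompact.prod g.hasCompactSupport.isCompact).inter_right
      isClosed_composable).image_of_continuousOn (continuousOn_gmul.mono inter_subset_right)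
  refine HasCompactSupport.intro hK fun a ha => ?_
  rw [convFun]
  refine integral_eq_zero_of_ae ?_
  filter_upwards [lam.ae_mem (srcU a)] with b hb
  have hab : src a = src b := Eq.symm hb
  by_contra h0
  refine ha ⟨(gdiv a b, b), ⟨⟨subset_tsupport _ ?_, subset_tsupport _ ?_⟩, src_gdiv hab⟩,
    gdiv_gmul hab⟩
  · intro h; exact h0 (by simp [h])
  · intro h; exact h0 (by simp [h])

instance : Mul (TwistedCc lam σ) :=
  ⟨fun f g => mk (convFun f g) (continuous_convFun f g) (hasCompactSupport_convFun f g)⟩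

lemma mul_apply (f g : TwistedCc lam σ) (a : G) :
    (f * g) a = ∫ b, f (gdiv a b) * g b * (σ (gdiv a b) b : ℂ) ∂(lam.measure (srcU a)) := rfl

lemma mul_apply' {x : UnitSpace G} {a : G} (ha : a ∈ Fiber x) (f g : TwistedCc lam σ) :
    (f * g) a = ∫ b, ker f a b * g b ∂(lam.measure x) := by
  obtain rfl := srcU_eq ha
  exact convFun_eq f g a

/-- Kernels compose like matrices. -/
lemma ker_mul {x : UnitSpace G} {a c : G} (ha : a ∈ Fiber x) (hc : c ∈ Fiber x)
    (f g : TwistedCc lam σ) :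
    ker (f * g) a c = ∫ b, ker f a b * ker g b c ∂(lam.measure x) := by
  have hac : src a = src c := Eq.trans ha (Eq.symm hc)
  have h1 : gdiv a c ∈ Fiber (rngU c) := src_gdiv hac
  have hs := lam.integral_gmul hc (h := fun b => ker f a b * ker g b c)
    ((f.continuousOn_ker_right ha).mul (g.continuousOn_ker_left hc))
  rw [ker, mul_apply' h1, ← integral_const_mul]
  refine Eq.trans ?_ hs
  refine integral_congr_ae ?_
  filter_upwards [lam.ae_mem (rngU c)] with b hb
  have hb' : src b = rng c := hb
  have e1 := gdiv_gmul_right hac hb'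
  have e2 : src (gdiv a c) = src b := (src_gdiv hac).trans hb'.symm
  have hcc := σ.cocycle (a := gdiv (gdiv a c) b) (b := b) (c := c) (src_gdiv e2) hb'
  rw [gdiv_gmul e2] at hcc
  have hcc' := congrArg (fun z : Circle => (z : ℂ)) hcc
  simp only [Circle.coe_mul] at hcc'
  simp only [ker, e1, gmul_right_cancel' hb']
  linear_combination (f (gdiv (gdiv a c) b) * g b) * hcc'

/-! #### The `I`-norm -/

lemma bddAbove_one (f : TwistedCc lam σ) :
    BddAbove (range fun x => max (∫ a, ‖f a‖ ∂(lam.measure x))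
      (∫ a, ‖f (ginv a)‖ ∂(lam.measure x))) := by
  obtain ⟨C, hC⟩ := lam.bddAbove_integral_norm f.toCc
  obtain ⟨D, hD⟩ := lam.bddAbove_integral_norm (star f).toCc
  refine ⟨max C D, ?_⟩
  rintro _ ⟨x, rfl⟩
  refine max_le_max (hC ⟨x, rfl⟩) ?_
  have h : ∫ a, ‖(star f) a‖ ∂(lam.measure x) ≤ D := hD ⟨x, rfl⟩
  simpa only [norm_star_apply] using h

/-- The `I`-norm. -/
def normI (f : TwistedCc lam σ) : ℝ :=
  ⨆ x : UnitSpace G, max (∫ a, ‖f a‖ ∂(lam.measure x)) (∫ a, ‖f (ginv a)‖ ∂(lam.measure x))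

lemma normI_nonneg (f : TwistedCc lam σ) : 0 ≤ normI f :=
  Real.iSup_nonneg fun _ => le_max_of_le_left (integral_nonneg fun _ => norm_nonneg _)

lemma integral_norm_le (f : TwistedCc lam σ) (x : UnitSpace G) :
    ∫ a, ‖f a‖ ∂(lam.measure x) ≤ normI f :=
  (le_max_left _ _).trans (le_ciSup f.bddAbove_one x)

lemma integral_norm_inv_le (f : TwistedCc lam σ) (x : UnitSpace G) :
    ∫ a, ‖f (ginv a)‖ ∂(lam.measure x) ≤ normI f :=
  (le_max_right _ _).trans (le_ciSup f.bddAbove_one x)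

lemma normI_le {f : TwistedCc lam σ} {C : ℝ} (hC : 0 ≤ C)
    (h1 : ∀ x, ∫ a, ‖f a‖ ∂(lam.measure x) ≤ C)
    (h2 : ∀ x, ∫ a, ‖f (ginv a)‖ ∂(lam.measure x) ≤ C) : normI f ≤ C :=
  Real.iSup_le (fun x => max_le (h1 x) (h2 x)) hC

lemma normI_star (f : TwistedCc lam σ) : normI (star f) = normI f := by
  simp only [normI, norm_star_apply, ginv_ginv]
  congr 1
  funext x
  exact max_comm _ _

lemma integrable (f : TwistedCc lam σ) (x : UnitSpace G) : Integrable f (lam.measure x) :=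
  f.continuous.integrable_of_hasCompactSupport f.hasCompactSupport

lemma lintegral_enorm_le (f : TwistedCc lam σ) (x : UnitSpace G) :
    ∫⁻ a, ‖f a‖ₑ ∂(lam.measure x) ≤ (normI f).toNNReal := by
  have h := ofReal_integral_norm_eq_lintegral_enorm (f.integrable x)
  rw [← h]
  exact ENNReal.ofReal_le_ofReal (f.integral_norm_le x)

lemma lintegral_row_le {x : UnitSpace G} {a : G} (ha : a ∈ Fiber x) (f : TwistedCc lam σ) :
    ∫⁻ b, ‖ker f a b‖ₑ ∂(lam.measure x) ≤ (normI f).toNNReal := by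
  have e : ∫⁻ b, ‖ker f a b‖ₑ ∂(lam.measure x) =
      ∫⁻ b, ‖(star f) b‖ₑ ∂(lam.measure (rngU a)) := by
    have h := lam.lintegral_gmul ha
      (h := fun b => ‖ker f a b‖ₑ) (f.continuousOn_ker_right ha).enorm
    rw [← h]
    refine lintegral_congr_ae ?_
    filter_upwards [lam.ae_mem (rngU a)] with b hb
    have hb' : src b = rng a := hb
    have h2 : gdiv (rng a) b = ginv b := by
      have := rng_gmul_self (ginv b)
      rw [rng_ginv, hb'] at this
      exact this
    rw [← ofReal_norm, ← ofReal_norm, norm_ker, norm_star_apply,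
      gdiv_gmul_right rfl hb', gdiv_self, h2]
  rw [e, ← normI_star]
  exact (star f).lintegral_enorm_le _

lemma lintegral_col_le {x : UnitSpace G} {b : G} (hb : b ∈ Fiber x) (f : TwistedCc lam σ) :
    ∫⁻ a, ‖ker f a b‖ₑ ∂(lam.measure x) ≤ (normI f).toNNReal := by
  have e : ∫⁻ a, ‖ker f a b‖ₑ ∂(lam.measure x) = ∫⁻ a, ‖f a‖ₑ ∂(lam.measure (rngU b)) := by
    have h := lam.lintegral_gmul hb
      (h := fun a => ‖ker f a b‖ₑ) (f.continuousOn_ker_left hb).enorm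
    rw [← h]
    refine lintegral_congr_ae ?_
    filter_upwards [lam.ae_mem (rngU b)] with a ha
    have ha' : src a = rng b := ha
    rw [← ofReal_norm, ← ofReal_norm, norm_ker, gmul_right_cancel' ha']
  rw [e]
  exact f.lintegral_enorm_le _

lemma aestronglyMeasurable_ker (f : TwistedCc lam σ) (x : UnitSpace G) :
    AEStronglyMeasurable (Function.uncurry (ker f)) ((lam.measure x).prod (lam.measure x)) := by
  have h1 : ∀ᵐ z ∂((lam.measure x).prod (lam.measure x)), z ∈ Fiber x ×ˢ Fiber x := by
    have hm : MeasurableSet (Fiber x ×ˢ Fiber x) :=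
      (isClosed_fiber x).measurableSet.prod (isClosed_fiber x).measurableSet
    refine (Measure.ae_prod_mem_iff_ae_ae_mem hm).2 ?_
    filter_upwards [lam.ae_mem x] with a ha
    filter_upwards [lam.ae_mem x] with b hb
    exact ⟨ha, hb⟩
  have h2 : ContinuousOn (Function.uncurry (ker f)) (Fiber x ×ˢ Fiber x) :=
    f.continuousOn_ker.mono fun z hz => Eq.trans hz.1 (Eq.symm hz.2)
  have h3 := h2.aestronglyMeasurable (μ := (lam.measure x).prod (lam.measure x))
    ((isClosed_fiber x).prod (isClosed_fiber x)).measurableSet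
  rwa [Measure.restrict_eq_self_of_ae_mem h1] at h3

lemma isSchurKernel (f : TwistedCc lam σ) (x : UnitSpace G) :
    IsSchurKernel (lam.measure x) (ker f) (normI f).toNNReal where
  meas := f.aestronglyMeasurable_ker x
  row := by
    filter_upwards [lam.ae_mem x] with a ha
    exact f.lintegral_row_le ha
  col := by
    filter_upwards [lam.ae_mem x] with b hb
    exact f.lintegral_col_le hb

/-! #### The `*`-algebra structure -/

lemma integrable_ker {x : UnitSpace G} {a : G} (ha : a ∈ Fiber x) (f : TwistedCc lam σ) :
    Integrable (ker f a) (lam.measure x) :=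
  ⟨lam.aestronglyMeasurable (f.continuousOn_ker_right ha),
    (f.lintegral_row_le ha).trans_lt ENNReal.coe_lt_top⟩

lemma exists_bound (f : TwistedCc lam σ) : ∃ C, ∀ a, ‖f a‖ ≤ C :=
  f.continuous.bounded_above_of_compact_support f.hasCompactSupport

lemma integrable_ker_mul {x : UnitSpace G} {a : G} (ha : a ∈ Fiber x) (f g : TwistedCc lam σ) :
    Integrable (fun b => ker f a b * g b) (lam.measure x) := by
  obtain ⟨C, hC⟩ := g.exists_bound
  exact (f.integrable_ker ha).mul_bdd (c := C) g.continuous.aestronglyMeasurable (.of_forall hC)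

lemma mul_assoc' (f g h : TwistedCc lam σ) : f * g * h = f * (g * h) := by
  refine ext fun a => ?_
  set x := srcU a with hx
  have ha : a ∈ Fiber x := mem_fiber_srcU a
  obtain ⟨C, hC⟩ := g.exists_bound
  have hint : Integrable (fun z : G × G => ker f a z.1 * (ker g z.1 z.2 * h z.2))
      ((lam.measure x).prod (lam.measure x)) := by
    have h1 : Integrable (fun z : G × G => ker f a z.1 * h z.2)
        ((lam.measure x).prod (lam.measure x)) := (f.integrable_ker ha).mul_prod (h.integrable x)
    have h2 := h1.mul_bdd (c := C) (g.aestronglyMeasurable_ker x)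
      (.of_forall fun z => (norm_ker g z.1 z.2).trans_le (hC _))
    refine h2.congr (.of_forall fun z => ?_)
    simp only [Function.uncurry]
    ring
  calc (f * g * h) a = ∫ c, ker (f * g) a c * h c ∂(lam.measure x) := mul_apply' ha _ _
    _ = ∫ c, ∫ b, ker f a b * (ker g b c * h c) ∂(lam.measure x) ∂(lam.measure x) := by
        refine integral_congr_ae ?_
        filter_upwards [lam.ae_mem x] with c hc
        rw [ker_mul ha hc, ← integral_mul_const]
        simp only [mul_assoc]
    _ = ∫ b, ∫ c, ker f a b * (ker g b c * h c) ∂(lam.measure x) ∂(lam.measure x) :=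
        (integral_integral_swap hint).symm
    _ = ∫ b, ker f a b * (g * h) b ∂(lam.measure x) := by
        refine integral_congr_ae ?_
        filter_upwards [lam.ae_mem x] with b hb
        rw [mul_apply' hb, ← integral_const_mul]
    _ = (f * (g * h)) a := (mul_apply' ha _ _).symm

lemma add_mul' (f g h : TwistedCc lam σ) : (f + g) * h = f * h + g * h := by
  refine ext fun a => ?_
  have ha := mem_fiber_srcU a
  rw [add_apply, mul_apply' ha, mul_apply' ha, mul_apply' ha,
    ← integral_add (integrable_ker_mul ha f h) (integrable_ker_mul ha g h)]
  simp only [ker_add, add_mul]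

lemma mul_add' (f g h : TwistedCc lam σ) : f * (g + h) = f * g + f * h := by
  refine ext fun a => ?_
  have ha := mem_fiber_srcU a
  rw [add_apply, mul_apply' ha, mul_apply' ha, mul_apply' ha,
    ← integral_add (integrable_ker_mul ha f g) (integrable_ker_mul ha f h)]
  simp only [add_apply, mul_add]

lemma smul_mul' (c : ℂ) (f g : TwistedCc lam σ) : (c • f) * g = c • (f * g) := by
  refine ext fun a => ?_
  have ha := mem_fiber_srcU a
  rw [smul_apply, mul_apply' ha, mul_apply' ha, ← integral_const_mul]
  simp only [ker_smul, mul_assoc]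

lemma mul_smul' (c : ℂ) (f g : TwistedCc lam σ) : f * (c • g) = c • (f * g) := by
  refine ext fun a => ?_
  have ha := mem_fiber_srcU a
  rw [smul_apply, mul_apply' ha, mul_apply' ha, ← integral_const_mul]
  simp only [smul_apply, mul_left_comm]

lemma zero_mul' (f : TwistedCc lam σ) : 0 * f = 0 := by
  refine ext fun a => ?_
  rw [mul_apply' (mem_fiber_srcU a)]
  simp [ker_zero, zero_apply]

lemma mul_zero' (f : TwistedCc lam σ) : f * 0 = 0 := by
  refine ext fun a => ?_
  rw [mul_apply' (mem_fiber_srcU a)]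
  simp [zero_apply]

instance : NonUnitalRing (TwistedCc lam σ) :=
  { (inferInstance : AddCommGroup (TwistedCc lam σ)),
    (inferInstance : Mul (TwistedCc lam σ)) with
    left_distrib := mul_add'
    right_distrib := add_mul'
    zero_mul := zero_mul'
    mul_zero := mul_zero'
    mul_assoc := mul_assoc' }

instance : IsScalarTower ℂ (TwistedCc lam σ) (TwistedCc lam σ) := ⟨smul_mul'⟩

instance : SMulCommClass ℂ (TwistedCc lam σ) (TwistedCc lam σ) :=
  ⟨fun c f g => (mul_smul' c f g).symm⟩

lemma ext_ker {f g : TwistedCc lam σ}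
    (h : ∀ (x : UnitSpace G) (a b : G), a ∈ Fiber x → b ∈ Fiber x → ker f a b = ker g a b) :
    f = g := by
  refine ext fun a => ?_
  have := h (srcU a) a (src a) (mem_fiber_srcU a) (src_src a)
  rwa [ker_src, ker_src] at this

instance : StarRing (TwistedCc lam σ) where
  star_involutive f := by
    refine ext_ker fun x a b ha hb => ?_
    have h : src a = src b := Eq.trans ha (Eq.symm hb)
    rw [ker_star h, ker_star h.symm, star_star]
  star_mul f g := by
    refine ext_ker fun x a b ha hb => ?_
    have h : src a = src b := Eq.trans ha (Eq.symm hb)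
    rw [ker_star h, ker_mul hb ha, ker_mul ha hb, Complex.star_def, ← integral_conj]
    refine integral_congr_ae ?_
    filter_upwards [lam.ae_mem x] with c hc
    have h1 : src a = src c := Eq.trans ha (Eq.symm hc)
    have h2 : src c = src b := Eq.trans hc (Eq.symm hb)
    rw [ker_star h1, ker_star h2, map_mul, mul_comm]
    rfl
  star_add f g := by
    refine ext fun a => ?_
    simp only [star_apply, add_apply, star_add, mul_add]

instance : StarModule ℂ (TwistedCc lam σ) where
  star_smul c f := by
    refine ext fun a => ?_
    simp only [star_apply, smul_apply, star_mul', mul_left_comm]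

end TwistedCc

end Twisted

/-! ### The regular representations and the three Banach `*`-algebras -/

section Algebras

variable {G : Type u} [TopologicalSpace G] [TopologicalGroupoid G] [MeasurableSpace G]
  [T2Space G] [SecondCountableTopology G] [LocallyCompactSpace G] [BorelSpace G]

namespace TwistedCc

variable {lam : HaarSystem G} {σ : TwoCocycle G}

lemma normI_add_le (f g : TwistedCc lam σ) : normI (f + g) ≤ normI f + normI g := by
  refine normI_le (add_nonneg (normI_nonneg f) (normI_nonneg g)) (fun x => ?_) fun x => ?_
  · refine le_trans ?_ (add_le_add (f.integral_norm_le x) (g.integral_norm_le x))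
    rw [← integral_add (f.integrable x).norm (g.integrable x).norm]
    exact integral_mono ((f + g).integrable x).norm ((f.integrable x).norm.add
      (g.integrable x).norm) fun a => norm_add_le (f a) (g a)
  · refine le_trans ?_ (add_le_add (f.integral_norm_inv_le x) (g.integral_norm_inv_le x))
    have hi : ∀ h : TwistedCc lam σ, Integrable (fun a => ‖h (ginv a)‖) (lam.measure x) := by
      intro h
      simpa only [norm_star_apply] using ((star h).integrable x).norm
    rw [← integral_add (hi f) (hi g)]
    exact integral_mono (hi (f + g)) ((hi f).add (hi g)) fun a => norm_add_le _ _

lemma normI_smul (c : ℂ) (f : TwistedCc lam σ) : normI (c • f) = ‖c‖ * normI f := by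
  simp only [normI, smul_apply, norm_mul, integral_const_mul]
  rw [Real.mul_iSup_of_nonneg (norm_nonneg c)]
  congr 1
  funext x
  exact (mul_max_of_nonneg _ _ (norm_nonneg c)).symm

lemma integral_norm_mul_le (f g : TwistedCc lam σ) (x : UnitSpace G) :
    ∫ a, ‖(f * g) a‖ ∂(lam.measure x) ≤ normI f * normI g := by
  have h := (f.isSchurKernel x).eLpNorm_fun (g.integrable x).1 le_rfl
  rw [eLpNorm_one_eq_lintegral_enorm, eLpNorm_one_eq_lintegral_enorm] at h
  have e : ∫⁻ a, ‖kernelFun (lam.measure x) (ker f) g a‖ₑ ∂(lam.measure x) =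
      ∫⁻ a, ‖(f * g) a‖ₑ ∂(lam.measure x) := by
    refine lintegral_congr_ae ?_
    filter_upwards [lam.ae_mem x] with a ha
    rw [mul_apply' ha]
    rfl
  rw [e] at h
  rw [integral_norm_eq_lintegral_enorm ((f * g).integrable x).1]
  refine ENNReal.toReal_le_of_le_ofReal (mul_nonneg (normI_nonneg f) (normI_nonneg g)) (h.trans ?_)
  rw [ENNReal.ofReal_mul (normI_nonneg f)]
  exact mul_le_mul_right (g.lintegral_enorm_le x) _

lemma normI_mul_le (f g : TwistedCc lam σ) : normI (f * g) ≤ normI f * normI g := by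
  refine normI_le (mul_nonneg (normI_nonneg f) (normI_nonneg g))
    (integral_norm_mul_le f g) fun x => ?_
  have h := integral_norm_mul_le (star g) (star f) x
  rw [← star_mul, normI_star, normI_star, mul_comm] at h
  simpa only [norm_star_apply] using h

/-- The `σ`-twisted left regular representation of `C_c(G)` on `L^p(G_x)`:
`(L f ξ)(a) = ∫ σ(ab⁻¹, b) f(ab⁻¹) ξ(b) dλ_x(b)`. -/
def leftRegular (p : ℝ≥0∞) [Fact (1 ≤ p)] (x : UnitSpace G) (f : TwistedCc lam σ) :
    Lp ℂ p (lam.measure x) →L[ℂ] Lp ℂ p (lam.measure x) :=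
  kernelOp p (ker f) (f.isSchurKernel x)

/-- The norm `‖f‖_{r,p}`, the supremum over all units `x` of the norms of the operators of the left
regular representation on `L^p(G_x)`. -/
def reducedNorm (p : ℝ≥0∞) [Fact (1 ≤ p)] (f : TwistedCc lam σ) : ℝ :=
  ⨆ x : UnitSpace G, ‖leftRegular p x f‖

variable {p q : ℝ≥0∞} [Fact (1 ≤ p)] [Fact (1 ≤ q)]

lemma leftRegular_add (x : UnitSpace G) (f g : TwistedCc lam σ) :
    leftRegular p x (f + g) = leftRegular p x f + leftRegular p x g :=
  kernelOp_add _ _ _ (.of_forall fun a => .of_forall fun b => ker_add f g a b)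

lemma leftRegular_smul (x : UnitSpace G) (c : ℂ) (f : TwistedCc lam σ) :
    leftRegular p x (c • f) = c • leftRegular p x f :=
  kernelOp_smul c _ _ (.of_forall fun a => .of_forall fun b => ker_smul c f a b)

lemma leftRegular_mul (x : UnitSpace G) (f g : TwistedCc lam σ) :
    leftRegular p x (f * g) = (leftRegular p x f).comp (leftRegular p x g) := by
  refine kernelOp_comp _ _ _ ?_
  filter_upwards [lam.ae_mem x] with a ha
  filter_upwards [lam.ae_mem x] with c hc
  exact ker_mul ha hc f g

lemma norm_leftRegular_le_normI (x : UnitSpace G) (f : TwistedCc lam σ) :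
    ‖leftRegular p x f‖ ≤ normI f := by
  refine (norm_kernelOp_le (p := p) (f.isSchurKernel x)).trans ?_
  rw [Real.coe_toNNReal _ (normI_nonneg f)]

lemma norm_leftRegular_star_le [ENNReal.HolderConjugate p q] (hp : p ≠ ∞) (hq : q ≠ ∞)
    (x : UnitSpace G) (f : TwistedCc lam σ) :
    ‖leftRegular p x (star f)‖ ≤ ‖leftRegular q x f‖ := by
  refine norm_kernelOp_adjoint_le hp hq _ _ ?_
  filter_upwards [lam.ae_mem x] with b hb
  filter_upwards [lam.ae_mem x] with a ha
  rw [ker_star (Eq.trans ha (Eq.symm hb)), star_star]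

lemma bddAbove_leftRegular (f : TwistedCc lam σ) :
    BddAbove (range fun x : UnitSpace G => ‖leftRegular p x f‖) :=
  ⟨normI f, by rintro _ ⟨x, rfl⟩; exact norm_leftRegular_le_normI x f⟩

lemma norm_leftRegular_le (x : UnitSpace G) (f : TwistedCc lam σ) :
    ‖leftRegular p x f‖ ≤ reducedNorm p f := le_ciSup (bddAbove_leftRegular f) x

lemma reducedNorm_nonneg (f : TwistedCc lam σ) : 0 ≤ reducedNorm p f :=
  Real.iSup_nonneg fun _ => norm_nonneg _

lemma reducedNorm_add_le (f g : TwistedCc lam σ) :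
    reducedNorm p (f + g) ≤ reducedNorm p f + reducedNorm p g := by
  refine Real.iSup_le (fun x => ?_) (add_nonneg (reducedNorm_nonneg f) (reducedNorm_nonneg g))
  rw [leftRegular_add]
  exact (norm_add_le _ _).trans (add_le_add (norm_leftRegular_le x f) (norm_leftRegular_le x g))

lemma reducedNorm_smul (c : ℂ) (f : TwistedCc lam σ) :
    reducedNorm p (c • f) = ‖c‖ * reducedNorm p f := by
  simp only [reducedNorm, leftRegular_smul, norm_smul]
  rw [Real.mul_iSup_of_nonneg (norm_nonneg c)]

lemma reducedNorm_mul_le (f g : TwistedCc lam σ) :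
    reducedNorm p (f * g) ≤ reducedNorm p f * reducedNorm p g := by
  refine Real.iSup_le (fun x => ?_) (mul_nonneg (reducedNorm_nonneg f) (reducedNorm_nonneg g))
  rw [leftRegular_mul]
  exact (ContinuousLinearMap.opNorm_comp_le _ _).trans (mul_le_mul (norm_leftRegular_le x f)
    (norm_leftRegular_le x g) (norm_nonneg _) (reducedNorm_nonneg f))

lemma reducedNorm_star_le [ENNReal.HolderConjugate p q] (hp : p ≠ ∞) (hq : q ≠ ∞)
    (f : TwistedCc lam σ) : reducedNorm p (star f) ≤ reducedNorm q f :=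
  Real.iSup_le (fun x => (norm_leftRegular_star_le hp hq x f).trans (norm_leftRegular_le x f))
    (reducedNorm_nonneg f)

/-- The norm `‖f‖_{♯,p} = max (‖f‖_{r,p}) (‖f‖_{r,q})`, for conjugate exponents `p` and `q`. -/
def sharpNorm (p q : ℝ≥0∞) [Fact (1 ≤ p)] [Fact (1 ≤ q)] (f : TwistedCc lam σ) : ℝ :=
  max (reducedNorm p f) (reducedNorm q f)

lemma sharpNorm_star_le [ENNReal.HolderConjugate p q] (hp : p ≠ ∞) (hq : q ≠ ∞)
    (f : TwistedCc lam σ) : sharpNorm p q (star f) ≤ sharpNorm p q f :=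
  have : ENNReal.HolderConjugate q p := ENNReal.HolderConjugate.symm
  max_le (le_max_of_le_right (reducedNorm_star_le hp hq f))
    (le_max_of_le_left (reducedNorm_star_le hq hp f))

end TwistedCc

open TwistedCc

variable (lam : HaarSystem G) (σ : TwoCocycle G)

/-- The `I`-norm, as a `*`-algebra seminorm on `C_c(G, σ)`. -/
def seminormI : StarAlgSeminorm (TwistedCc lam σ) where
  __ := Seminorm.of normI normI_add_le normI_smul
  mul_le' := normI_mul_le
  star_eq' := normI_star

/-- The norm `‖·‖_{♯,p}` for conjugate exponents `1 < p, q < ∞`, as a `*`-algebra seminorm. -/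
def seminormSharpAux (p q : ℝ≥0∞) [Fact (1 ≤ p)] [Fact (1 ≤ q)] [ENNReal.HolderConjugate p q]
    (hp : p ≠ ∞) (hq : q ≠ ∞) : StarAlgSeminorm (TwistedCc lam σ) where
  __ := Seminorm.of (sharpNorm p q)
    (fun f g => max_le
      ((reducedNorm_add_le f g).trans (add_le_add (le_max_left _ _) (le_max_left _ _)))
      ((reducedNorm_add_le f g).trans (add_le_add (le_max_right _ _) (le_max_right _ _))))
    (fun c f => by
      simp only [sharpNorm, reducedNorm_smul]
      exact (mul_max_of_nonneg _ _ (norm_nonneg c)).symm)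
  mul_le' f g := max_le
    ((reducedNorm_mul_le f g).trans (mul_le_mul (le_max_left _ _) (le_max_left _ _)
      (reducedNorm_nonneg g) (le_max_of_le_left (reducedNorm_nonneg f))))
    ((reducedNorm_mul_le f g).trans (mul_le_mul (le_max_right _ _) (le_max_right _ _)
      (reducedNorm_nonneg g) (le_max_of_le_left (reducedNorm_nonneg f))))
  star_eq' f := le_antisymm (sharpNorm_star_le hp hq f)
    (by
      have h := sharpNorm_star_le hp hq (star f)
      rw [star_star] at h
      exact h)

/-- The norm `‖·‖_{♯,p}` for a real exponent `1 < p < ∞`, with conjugate exponent `p / (p - 1)`. -/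
def seminormSharp (p : ℝ) (hp : 1 < p) : StarAlgSeminorm (TwistedCc lam σ) :=
  have h : p.HolderConjugate (p / (p - 1)) := Real.HolderConjugate.conjExponent hp
  have := h.ennrealOfReal
  have : Fact (1 ≤ ENNReal.ofReal p) := ⟨ENNReal.one_le_ofReal.2 h.lt.le⟩
  have : Fact (1 ≤ ENNReal.ofReal (p / (p - 1))) := ⟨ENNReal.one_le_ofReal.2 h.symm.lt.le⟩
  seminormSharpAux lam σ (ENNReal.ofReal p) (ENNReal.ofReal (p / (p - 1)))
    ENNReal.ofReal_ne_top ENNReal.ofReal_ne_top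

/-- The norm `‖·‖_{r,2}` of the reduced `C*`-algebra, as a `*`-algebra seminorm. -/
def seminormReduced : StarAlgSeminorm (TwistedCc lam σ) where
  __ := Seminorm.of (reducedNorm 2) reducedNorm_add_le reducedNorm_smul
  mul_le' := reducedNorm_mul_le
  star_eq' f := le_antisymm
    (reducedNorm_star_le (p := 2) (q := 2) (by simp) (by simp) f)
    (by
      have h := reducedNorm_star_le (p := 2) (q := 2) (by simp) (by simp) (star f)
      rw [star_star] at h
      exact h)

/-- The Banach `*`-algebra `L^1(G, σ)`, the completion of `C_c(G, σ)` in the `I`-norm. -/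
abbrev L1Algebra : Type u := (seminormI lam σ).Completion

/-- The Banach `*`-algebra `F^p_♯(G, σ)`, the completion in the norm `‖·‖_{♯,p}`. As `C_c(G, σ)` is
dense in `L^1(G, σ)` and `‖·‖_{♯,p} ≤ ‖·‖_I`, completing `C_c(G, σ)` or `L^1(G, σ)` is the same. -/
abbrev FSharpAlgebra (p : ℝ) (hp : 1 < p) : Type u := (seminormSharp lam σ p hp).Completion

/-- The reduced twisted groupoid `C*`-algebra, the completion of `C_c(G, σ)` in the norm
`‖·‖_{r,2}`. -/
abbrev ReducedCStarAlgebra : Type u := (seminormReduced lam σ).Completion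

end Algebras

/-! ### Nested triples and spectral interpolation -/

section Nested

/-- A Banach `*`-algebra is reduced if its elements are separated by its `*`-representations on
Hilbert spaces (it suffices to consider the Hilbert spaces in the universe of the algebra). -/
def IsReducedStarAlgebra (A : Type u) [NonUnitalNormedRing A] [NormedSpace ℂ A] [StarRing A] :
    Prop :=
  ∀ a : A, (∀ (H : Type u) [NormedAddCommGroup H] [InnerProductSpace ℂ H] [CompleteSpace H]
    (π : A →⋆ₙₐ[ℂ] (H →L[ℂ] H)), π a = 0) → a = 0

/-- The spectral radius of an element of a complex algebra, computed in the unitization. (For an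
algebra that already has a unit, the passage to the unitization only adds `0` to the spectrum and
does not change the spectral radius.) -/
def specRadius {A : Type u} [NonUnitalNormedRing A] [NormedSpace ℂ A] [IsScalarTower ℂ A A]
    [SMulCommClass ℂ A A] (a : A) : ℝ≥0∞ :=
  spectralRadius ℂ (a : Unitization ℂ A)

variable {A B C : Type u}
  [NonUnitalNormedRing A] [NormedSpace ℂ A] [IsScalarTower ℂ A A] [SMulCommClass ℂ A A]
  [StarRing A] [StarModule ℂ A] [NormedStarGroup A] [CompleteSpace A]
  [NonUnitalNormedRing B] [NormedSpace ℂ B] [IsScalarTower ℂ B B] [SMulCommClass ℂ B B]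
  [StarRing B] [StarModule ℂ B] [NormedStarGroup B] [CompleteSpace B]
  [NonUnitalNormedRing C] [NormedSpace ℂ C] [IsScalarTower ℂ C C] [SMulCommClass ℂ C C]
  [StarRing C] [StarModule ℂ C] [NormedStarGroup C] [CompleteSpace C]

/-- `φ` exhibits `A ⊆ B` as a nested pair of reduced Banach `*`-algebras: it embeds `A` continuously
as a dense `*`-subalgebra of `B`. -/
structure IsNestedPair (φ : A →⋆ₙₐ[ℂ] B) : Prop where
  reduced_left : IsReducedStarAlgebra A
  reduced_right : IsReducedStarAlgebra B
  continuous : Continuous φ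
  injective : Function.Injective φ
  denseRange : DenseRange φ

/-- `φ` and `ψ` exhibit `A ⊆ B ⊆ C` as a nested triple of reduced Banach `*`-algebras. -/
structure IsNestedTriple (φ : A →⋆ₙₐ[ℂ] B) (ψ : B →⋆ₙₐ[ℂ] C) : Prop where
  left : IsNestedPair φ
  right : IsNestedPair ψ

/-- The nested triple `A ⊆ B ⊆ C` is a spectral interpolation triple relative to the dense
`*`-subalgebra `S` of `A`. -/
structure IsSpectralInterpolationTriple (φ : A →⋆ₙₐ[ℂ] B) (ψ : B →⋆ₙₐ[ℂ] C)
    (S : NonUnitalStarSubalgebra ℂ A) : Prop where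
  nested : IsNestedTriple φ ψ
  dense : Dense (S : Set A)
  interpolation : ∃ θ : ℝ, 0 < θ ∧ θ < 1 ∧ ∀ a ∈ S, IsSelfAdjoint a →
    specRadius (φ a) ≤ specRadius a ^ (1 - θ) * specRadius (ψ (φ a)) ^ θ

end Nested

end

/-! Everything comes from one norm inequality on $C_c(\mathcal G,\sigma)$:
$\|f\|_{\sharp,p}\le\|f\|_I^{1-\theta}\|f\|_{r,2}^{\theta}$ (`sharpNorm_le_interp`). By Schur's test
each operator $L^r_x(f)$, with $r=1$ and $r=\infty$ included, has norm at most $\|f\|_I$.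
Riesz–Thorin between $L^1$ and $L^2$ then bounds $L^p_x(f)$, and between $L^\infty$ and $L^2$ it
bounds $L^q_x(f)$. The exponent $\theta$ solves $1/p=(1-\theta)+\theta/2$; since
$1/q=1-1/p=\theta/2$, the same $\theta$ serves $q$. The inequality passes to $L^1(\mathcal
G,\sigma)$ by continuity. Applied to the powers of $f$, it becomes the inequality of spectral radii
through Gelfand's formula (`specRadius_le_interp`).

The homomorphisms exist because $\|f\|_{r,2}\le\|f\|_{\sharp,p}\le\|f\|_I$. The second bound is
Schur's test; the first is Riesz–Thorin at the midpoint of $p$ and $q$, as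
$\frac12=\frac12(\frac1p+\frac1q)$.

Injectivity is not automatic for maps between completions. The criterion `mapHom_injective` asks
that the stronger norm be lower semicontinuous for the weaker one, and the two cases are
`sharpNorm_le_of_approx` and `normI_le_of_approx`. The norm $\|\cdot\|_{\sharp,p}$ is a supremum of
pairings of the kernel of $f$ with simple functions, and each pairing is continuous for
$\|\cdot\|_{r,2}$. The $I$-norm is a supremum of values $|(f\star g)(x)|$ and $|(f^*\star g)(x)|$ at
units $x$, with $|g|\le1$. Smallness in $\|\cdot\|_{r,2}$ only makes $f\star g$ small in
$L^2(\mathcal G_x)$, but products are continuous and $x$ lies in the support of $\lambda_x$, so the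
value at $x$ is controlled.

Finally $C^*_r(\mathcal G,\sigma)$ is reduced because the regular representations on $L^2(\mathcal
G_x)$ determine its norm, and reducedness pulls back along the injective homomorphisms. -/

noncomputable section

/-! ### The Riesz–Thorin theorem for integral kernels -/

section RieszThorin

/-- The complex number of modulus `‖y‖ ^ c.re` obtained from `y` by raising its modulus to the
power `c`. -/
def phasePow (c y : ℂ) : ℂ := y / ‖y‖ * (‖y‖ : ℂ) ^ c

lemma phasePow_zero (c : ℂ) : phasePow c 0 = 0 := by simp [phasePow]

lemma norm_phasePow (c : ℂ) {y : ℂ} (hy : y ≠ 0) : ‖phasePow c y‖ = ‖y‖ ^ c.re := by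
  have h := norm_pos_iff.2 hy
  rw [phasePow, norm_mul, norm_div, Complex.norm_real, norm_norm, div_self h.ne', one_mul,
    Complex.norm_cpow_eq_rpow_re_of_pos h]

lemma phasePow_one (y : ℂ) : phasePow 1 y = y := by
  rcases eq_or_ne y 0 with rfl | hy
  · exact phasePow_zero 1
  · have h : (‖y‖ : ℂ) ≠ 0 := by simpa using hy
    rw [phasePow, Complex.cpow_one, div_mul_cancel₀ _ h]

lemma differentiable_phasePow {c : ℂ → ℂ} (hc : Differentiable ℂ c) {y : ℂ} (hy : y ≠ 0) :
    Differentiable ℂ fun z => phasePow (c z) y := by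
  have h : (‖y‖ : ℂ) ≠ 0 := by simpa using hy
  exact (hc.const_cpow (.inl h)).const_mul _

variable {α : Type*} [MeasurableSpace α] {m : Measure α}

/-- For finite `r` the modulus of the integrand is $|f|^{p/r}$, whose $r$-th power is $|f|^p$. At `r
= ∞` the convention `∞.toReal⁻¹ = 0` forces `c.re = 0`, so the modulus is at most 1. Only an
inequality holds there, since $f$ may vanish. -/
lemma eLpNorm_phasePow_le {p r : ℝ≥0∞} (hp0 : p ≠ 0) (hp : p ≠ ∞) (hr : r ≠ 0) {c : ℂ}
    (hc : c.re = p.toReal * r.toReal⁻¹) (f : α → ℂ) :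
    eLpNorm (fun a => phasePow c (f a)) r m ≤ eLpNorm f p m ^ c.re := by
  rcases eq_or_ne r ∞ with rfl | hr'
  · have hc0 : c.re = 0 := by simpa using hc
    rw [hc0, ENNReal.rpow_zero, eLpNorm_exponent_top]
    refine eLpNormEssSup_le_of_ae_enorm_bound (.of_forall fun a => ?_)
    rcases eq_or_ne (f a) 0 with h | h
    · simp [h, phasePow_zero]
    · rw [← ofReal_norm, norm_phasePow c h, hc0]
      simp
  · have hp1 := ENNReal.toReal_pos hp0 hp
    have hr1 := ENNReal.toReal_pos hr hr'
    have hc0 : 0 < c.re := by rw [hc]; positivity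
    have hpr : r * ENNReal.ofReal c.re = p := by
      rw [← ENNReal.ofReal_toReal hr', ← ENNReal.ofReal_mul hr1.le, hc, mul_comm p.toReal,
        mul_inv_cancel_left₀ hr1.ne', ENNReal.ofReal_toReal hp]
    rw [← hpr, ← eLpNorm_norm_rpow f hc0]
    refine (eLpNorm_congr_norm_ae (.of_forall fun a => ?_)).le
    rcases eq_or_ne (f a) 0 with h | h
    · simp [h, phasePow_zero, Real.zero_rpow hc0.ne']
    · rw [norm_phasePow c h, Real.norm_of_nonneg (by positivity)]

/-- The dependence on `φ` is confined to finitely many scalars while the level sets stay fixed. The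
value 0 is left out because its level set may have infinite measure. -/
lemma SimpleFunc.comp_eq_sum_indicator (f : SimpleFunc α ℂ) {φ : ℂ → ℂ} (hφ : φ 0 = 0) (a : α) :
    φ (f a) = ∑ y ∈ f.range.erase 0, φ y * (f ⁻¹' {y}).indicator 1 a := by
  classical
  rcases eq_or_ne (f a) 0 with h | h
  · rw [h, hφ]
    refine (Finset.sum_eq_zero fun y hy => ?_).symm
    rw [indicator_of_notMem, mul_zero]
    intro hy'
    exact (Finset.mem_erase.1 hy).1 (by rw [← h]; exact hy'.symm)
  · rw [Finset.sum_eq_single (f a)]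
    · rw [indicator_of_mem (by rfl)]; simp
    · intro y _ hy
      rw [indicator_of_notMem, mul_zero]
      exact fun hy' => hy hy'.symm
    · intro h2
      exact absurd (Finset.mem_erase.2 ⟨h, f.mem_range_self a⟩) h2

/-! ### The bilinear form of a kernel on simple functions, and its interpolation. -/

variable {K : α → α → ℂ}

/-- The pairing of a kernel with the functions `f` and `g`. -/
def kernelPairing (m : Measure α) (K : α → α → ℂ) (f g : α → ℂ) : ℂ :=
  ∫ z : α × α, K z.1 z.2 * (g z.1 * f z.2) ∂(m.prod m)

/-- With `φ` and `ψ` depending holomorphically on a parameter, this displays the pairing as a finite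
sum of holomorphic functions with constant coefficients, so no differentiation under the integral is
needed. -/
lemma kernelPairing_comp_eq_sum
    (hK : ∀ s t, MeasurableSet s → MeasurableSet t → m s < ∞ → m t < ∞ →
      IntegrableOn (Function.uncurry K) (s ×ˢ t) (m.prod m))
    {f g : SimpleFunc α ℂ} (hf : Integrable f m) (hg : Integrable g m) {φ ψ : ℂ → ℂ}
    (hφ : φ 0 = 0) (hψ : ψ 0 = 0) :
    kernelPairing m K (fun a => φ (f a)) (fun a => ψ (g a)) =
      ∑ w ∈ g.range.erase 0, ∑ y ∈ f.range.erase 0,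
        ψ w * φ y * ∫ z in (g ⁻¹' {w}) ×ˢ (f ⁻¹' {y}), K z.1 z.2 ∂(m.prod m) := by
  have hm : ∀ (w y : ℂ), MeasurableSet ((g ⁻¹' {w}) ×ˢ (f ⁻¹' {y})) := fun w y =>
    (g.measurableSet_fiber w).prod (f.measurableSet_fiber y)
  have hi : ∀ w ∈ g.range.erase 0, ∀ y ∈ f.range.erase 0,
      Integrable (fun z : α × α => ψ w * φ y *
        ((g ⁻¹' {w}) ×ˢ (f ⁻¹' {y})).indicator (fun z => K z.1 z.2) z) (m.prod m) := by
    intro w hw y hy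
    refine Integrable.const_mul ?_ _
    rw [integrable_indicator_iff (hm w y)]
    exact hK _ _ (g.measurableSet_fiber w) (f.measurableSet_fiber y)
      (SimpleFunc.measure_preimage_lt_top_of_integrable g hg (Finset.mem_erase.1 hw).1)
      (SimpleFunc.measure_preimage_lt_top_of_integrable f hf (Finset.mem_erase.1 hy).1)
  rw [kernelPairing]
  calc _ = ∫ z : α × α, ∑ w ∈ g.range.erase 0, ∑ y ∈ f.range.erase 0, ψ w * φ y *
        ((g ⁻¹' {w}) ×ˢ (f ⁻¹' {y})).indicator (fun z => K z.1 z.2) z ∂(m.prod m) := by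
        refine integral_congr_ae (.of_forall fun z => ?_)
        simp only []
        rw [SimpleFunc.comp_eq_sum_indicator f hφ, SimpleFunc.comp_eq_sum_indicator g hψ,
          Finset.sum_mul_sum, Finset.mul_sum]
        refine Finset.sum_congr rfl fun w _ => ?_
        rw [Finset.mul_sum]
        refine Finset.sum_congr rfl fun y _ => ?_
        by_cases h1 : z.1 ∈ g ⁻¹' {w} <;> by_cases h2 : z.2 ∈ f ⁻¹' {y} <;>
          simp [indicator, mem_prod, h1, h2]
        ring
    _ = _ := by
        rw [integral_finsetSum _ fun w hw => integrable_finsetSum _ fun y hy => hi w hw y hy]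
        refine Finset.sum_congr rfl fun w hw => ?_
        rw [integral_finsetSum _ fun y hy => hi w hw y hy]
        refine Finset.sum_congr rfl fun y _ => ?_
        rw [integral_const_mul, integral_indicator (hm w y)]

open Complex.HadamardThreeLines in
/-- The **Riesz–Thorin theorem** for integral kernels, in bilinear form. -/
theorem riesz_thorin_kernelPairing
    (hK : ∀ s t, MeasurableSet s → MeasurableSet t → m s < ∞ → m t < ∞ →
      IntegrableOn (Function.uncurry K) (s ×ˢ t) (m.prod m))
    {p q p₀ q₀ p₁ q₁ : ℝ≥0∞} {A₀ A₁ t : ℝ} (hp0 : p ≠ 0) (hp : p ≠ ∞) (hq0 : q ≠ 0) (hq : q ≠ ∞)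
    (hp₀ : p₀ ≠ 0) (hq₀ : q₀ ≠ 0) (hp₁ : p₁ ≠ 0) (hq₁ : q₁ ≠ 0) (hA₀ : 0 ≤ A₀) (hA₁ : 0 ≤ A₁)
    (ht0 : 0 ≤ t) (ht1 : t ≤ 1)
    (hpt : p.toReal⁻¹ = (1 - t) * p₀.toReal⁻¹ + t * p₁.toReal⁻¹)
    (hqt : q.toReal⁻¹ = (1 - t) * q₀.toReal⁻¹ + t * q₁.toReal⁻¹)
    (h₀ : ∀ f g : SimpleFunc α ℂ, Integrable f m → Integrable g m →
      ‖kernelPairing m K f g‖ ≤ A₀ * ((eLpNorm f p₀ m).toReal * (eLpNorm g q₀ m).toReal))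
    (h₁ : ∀ f g : SimpleFunc α ℂ, Integrable f m → Integrable g m →
      ‖kernelPairing m K f g‖ ≤ A₁ * ((eLpNorm f p₁ m).toReal * (eLpNorm g q₁ m).toReal))
    {f g : SimpleFunc α ℂ} (hf : Integrable f m) (hg : Integrable g m) :
    ‖kernelPairing m K f g‖ ≤
      A₀ ^ (1 - t) * A₁ ^ t * ((eLpNorm f p m).toReal * (eLpNorm g q m).toReal) := by
  have hP := ENNReal.toReal_pos hp0 hp
  have hQ := ENNReal.toReal_pos hq0 hq
  have hfp : eLpNorm f p m ≠ ∞ := ((SimpleFunc.memLp_iff_integrable hp0 hp).2 hf).2.ne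
  have hgq : eLpNorm g q m ≠ ∞ := ((SimpleFunc.memLp_iff_integrable hq0 hq).2 hg).2.ne
  -- This is $c(z)=p/p_z$ with $1/p_z=(1-z)/p_0+z/p_1$, and `d` is its analogue for $q$. At $z=t$
  -- both equal 1 and give back $f$ and $g$. On the edges of the strip their real parts are the
  -- ratios that turn $L^p$- and $L^q$-norms into the endpoint norms.
  let c : ℂ → ℂ := fun z => (p.toReal : ℂ) * ((1 - z) * (p₀.toReal⁻¹ : ℝ) + z * (p₁.toReal⁻¹ : ℝ))
  let d : ℂ → ℂ := fun z => (q.toReal : ℂ) * ((1 - z) * (q₀.toReal⁻¹ : ℝ) + z * (q₁.toReal⁻¹ : ℝ))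
  have hcre : ∀ z, (c z).re = p.toReal * ((1 - z.re) * p₀.toReal⁻¹ + z.re * p₁.toReal⁻¹) := by
    intro z
    simp only [c, Complex.re_ofReal_mul, Complex.add_re, Complex.re_mul_ofReal, Complex.sub_re,
      Complex.one_re]
  have hdre : ∀ z, (d z).re = q.toReal * ((1 - z.re) * q₀.toReal⁻¹ + z.re * q₁.toReal⁻¹) := by
    intro z
    simp only [d, Complex.re_ofReal_mul, Complex.add_re, Complex.re_mul_ofReal, Complex.sub_re,
      Complex.one_re]
  have hcd : Differentiable ℂ c := by fun_prop
  have hdd : Differentiable ℂ d := by fun_prop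
  have hct : c t = 1 := by
    have : c t = ((p.toReal * ((1 - t) * p₀.toReal⁻¹ + t * p₁.toReal⁻¹) : ℝ) : ℂ) := by
      simp only [c]; push_cast; ring
    rw [this, ← hpt, mul_inv_cancel₀ hP.ne', Complex.ofReal_one]
  have hdt : d t = 1 := by
    have : d t = ((q.toReal * ((1 - t) * q₀.toReal⁻¹ + t * q₁.toReal⁻¹) : ℝ) : ℂ) := by
      simp only [d]; push_cast; ring
    rw [this, ← hqt, mul_inv_cancel₀ hQ.ne', Complex.ofReal_one]
  let F : ℂ → ℂ := fun z =>
    kernelPairing m K (fun a => phasePow (c z) (f a)) (fun a => phasePow (d z) (g a))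
  have hFsum : ∀ z, F z = ∑ w ∈ g.range.erase 0, ∑ y ∈ f.range.erase 0,
        phasePow (d z) w * phasePow (c z) y *
          ∫ z in (g ⁻¹' {w}) ×ˢ (f ⁻¹' {y}), K z.1 z.2 ∂(m.prod m) := fun z =>
    kernelPairing_comp_eq_sum hK hf hg (phasePow_zero _) (phasePow_zero _)
  have hFd : Differentiable ℂ F := by
    rw [funext hFsum]
    refine Differentiable.fun_sum fun w hw => Differentiable.fun_sum fun y hy => ?_
    exact ((differentiable_phasePow hdd (Finset.mem_erase.1 hw).1).mul
      (differentiable_phasePow hcd (Finset.mem_erase.1 hy).1)).mul_const _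
  -- The modulus of each `phasePow` factor depends on `z` only through `z.re`, so `F` is dominated
  -- on the strip by a continuous function of `z.re` on the compact interval $[0,1]$.
  have hFb : BddAbove ((norm ∘ F) '' verticalClosedStrip 0 1) := by
    let H : ℝ → ℝ := fun s => ∑ w ∈ g.range.erase 0, ∑ y ∈ f.range.erase 0,
      ‖phasePow (d s) w‖ * ‖phasePow (c s) y‖ *
        ‖∫ z in (g ⁻¹' {w}) ×ˢ (f ⁻¹' {y}), K z.1 z.2 ∂(m.prod m)‖
    have hH : Continuous H := by
      refine continuous_finsetSum _ fun w hw => continuous_finsetSum _ fun y hy => ?_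
      have e1 := (differentiable_phasePow hdd (Finset.mem_erase.1 hw).1).continuous
      have e2 := (differentiable_phasePow hcd (Finset.mem_erase.1 hy).1).continuous
      exact ((e1.comp Complex.continuous_ofReal).norm.mul
        (e2.comp Complex.continuous_ofReal).norm).mul continuous_const
    obtain ⟨C, hC⟩ := (isCompact_Icc (a := (0 : ℝ)) (b := 1)).bddAbove_image hH.continuousOn
    refine ⟨C, ?_⟩
    rintro _ ⟨z, hz, rfl⟩
    refine le_trans ?_ (hC ⟨z.re, hz, rfl⟩)
    simp only [Function.comp_apply, hFsum, H]
    refine (norm_sum_le _ _).trans (Finset.sum_le_sum fun w hw => ?_)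
    refine (norm_sum_le _ _).trans (Finset.sum_le_sum fun y hy => ?_)
    rw [norm_mul, norm_mul, norm_phasePow _ (Finset.mem_erase.1 hw).1,
      norm_phasePow _ (Finset.mem_erase.1 hy).1, norm_phasePow _ (Finset.mem_erase.1 hw).1,
      norm_phasePow _ (Finset.mem_erase.1 hy).1, hcre, hdre, hcre, hdre, Complex.ofReal_re]
  -- The modified functions are again integrable simple functions, so an endpoint hypothesis applies
  -- to them. `eLpNorm_phasePow_le` then expresses the bound by the norms of the original $f$ and
  -- $g$, uniformly along the edge.
  have hedge : ∀ (z : ℂ) {r s : ℝ≥0∞} {A : ℝ}, r ≠ 0 → s ≠ 0 → 0 ≤ A →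
      (c z).re = p.toReal * r.toReal⁻¹ → (d z).re = q.toReal * s.toReal⁻¹ →
      (∀ f g : SimpleFunc α ℂ, Integrable f m → Integrable g m →
        ‖kernelPairing m K f g‖ ≤ A * ((eLpNorm f r m).toReal * (eLpNorm g s m).toReal)) →
      ‖F z‖ ≤ A * ((eLpNorm f p m).toReal ^ (p.toReal * r.toReal⁻¹) *
        (eLpNorm g q m).toReal ^ (q.toReal * s.toReal⁻¹)) := by
    intro z r s A hr hs hA hc hd h
    have hfi : Integrable (f.map (phasePow (c z))) m :=
      ((SimpleFunc.integrable_iff_finMeasSupp.1 hf).map (phasePow_zero _)).integrable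
    have hgi : Integrable (g.map (phasePow (d z))) m :=
      ((SimpleFunc.integrable_iff_finMeasSupp.1 hg).map (phasePow_zero _)).integrable
    refine (h _ _ hfi hgi).trans (mul_le_mul_of_nonneg_left ?_ hA)
    have e1 := eLpNorm_phasePow_le (m := m) hp0 hp hr hc f
    have e2 := eLpNorm_phasePow_le (m := m) hq0 hq hs hd g
    rw [← hc, ← hd, ENNReal.toReal_rpow, ENNReal.toReal_rpow]
    have hc0 : 0 ≤ (c z).re := by rw [hc]; positivity
    have hd0 : 0 ≤ (d z).re := by rw [hd]; positivity
    exact mul_le_mul (ENNReal.toReal_mono (ENNReal.rpow_ne_top_of_nonneg hc0 hfp) e1)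
      (ENNReal.toReal_mono (ENNReal.rpow_ne_top_of_nonneg hd0 hgq) e2) ENNReal.toReal_nonneg
      ENNReal.toReal_nonneg
  have key := norm_le_interp_of_mem_verticalClosedStrip₀₁' F (z := (t : ℂ))
    (a := A₀ * ((eLpNorm f p m).toReal ^ (p.toReal * p₀.toReal⁻¹) *
        (eLpNorm g q m).toReal ^ (q.toReal * q₀.toReal⁻¹)))
    (b := A₁ * ((eLpNorm f p m).toReal ^ (p.toReal * p₁.toReal⁻¹) *
        (eLpNorm g q m).toReal ^ (q.toReal * q₁.toReal⁻¹)))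
    ⟨by simpa using ht0, by simpa using ht1⟩ hFd.diffContOnCl hFb
    (fun z hz => hedge z hp₀ hq₀ hA₀
      (by rw [hcre, show z.re = 0 from hz]; ring) (by rw [hdre, show z.re = 0 from hz]; ring) h₀)
    (fun z hz => hedge z hp₁ hq₁ hA₁
      (by rw [hcre, show z.re = 1 from hz]; ring) (by rw [hdre, show z.re = 1 from hz]; ring) h₁)
  have hFt : F t = kernelPairing m K f g := by
    simp only [F, hct, hdt, phasePow_one]
  rw [hFt, Complex.ofReal_re] at key
  refine key.trans (le_of_eq ?_)
  set U := (eLpNorm f p m).toReal with hU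
  set V := (eLpNorm g q m).toReal with hV
  have hU0 : 0 ≤ U := ENNReal.toReal_nonneg
  have hV0 : 0 ≤ V := ENNReal.toReal_nonneg
  -- The exponents of `U` add up to $r((1-t)x+ty)=1$, so the two edge factors recombine into the
  -- norm itself, also when it is zero.
  have combine : ∀ {U x y r : ℝ}, 0 ≤ U → 0 < r → 0 ≤ x → 0 ≤ y → r⁻¹ = (1 - t) * x + t * y →
      (U ^ (r * x)) ^ (1 - t) * (U ^ (r * y)) ^ t = U := by
    intro U x y r hU hr hx hy h
    have h1 : 0 ≤ 1 - t := by linarith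
    rw [← Real.rpow_mul hU, ← Real.rpow_mul hU, ← Real.rpow_add_of_nonneg hU (by positivity)
      (by positivity)]
    have : r * x * (1 - t) + r * y * t = 1 := by
      rw [show r * x * (1 - t) + r * y * t = r * ((1 - t) * x + t * y) by ring, ← h,
        mul_inv_cancel₀ hr.ne']
    rw [this, Real.rpow_one]
  have eU := combine hU0 hP (inv_nonneg.2 (ENNReal.toReal_nonneg (a := p₀)))
    (inv_nonneg.2 (ENNReal.toReal_nonneg (a := p₁))) hpt
  have eV := combine hV0 hQ (inv_nonneg.2 (ENNReal.toReal_nonneg (a := q₀)))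
    (inv_nonneg.2 (ENNReal.toReal_nonneg (a := q₁))) hqt
  rw [Real.mul_rpow hA₀ (by positivity), Real.mul_rpow hA₁ (by positivity),
    Real.mul_rpow (by positivity) (by positivity), Real.mul_rpow (by positivity) (by positivity)]
  linear_combination (A₀ ^ (1 - t) * A₁ ^ t) * ((U ^ (p.toReal * p₀.toReal⁻¹)) ^ (1 - t) *
    (U ^ (p.toReal * p₁.toReal⁻¹)) ^ t) * eV + (A₀ ^ (1 - t) * A₁ ^ t) * V * eU

end RieszThorin

/-! ### Norms of integral operators -/

section KernelOp

variable {α : Type u} [MeasurableSpace α] {m : Measure α}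

lemma SimpleFunc.memLp_of_integrable {f : SimpleFunc α ℂ} (hf : Integrable f m) (p : ℝ≥0∞) :
    MemLp f p m :=
  SimpleFunc.memLp_of_finite_measure_preimage p (SimpleFunc.integrable_iff.1 hf)

lemma measurable_phasePow (c : ℂ) : Measurable (phasePow c) := by
  unfold phasePow
  fun_prop

lemma norm_integral_mul_le {p q : ℝ≥0∞} [ENNReal.HolderConjugate p q] {f g : α → ℂ}
    (hf : MemLp f p m) (hg : MemLp g q m) :
    ‖∫ a, f a * g a ∂m‖ ≤ (eLpNorm f p m).toReal * (eLpNorm g q m).toReal := by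
  rw [← ENNReal.toReal_mul, ← toReal_enorm]
  refine ENNReal.toReal_mono (ENNReal.mul_ne_top hf.2.ne hg.2.ne) ?_
  refine (enorm_integral_le_lintegral_enorm _).trans ?_
  rw [← eLpNorm_one_eq_lintegral_enorm]
  change eLpNorm (f • g) 1 m ≤ _
  exact eLpNorm_smul_le_mul_eLpNorm hg.1 hf.1

/-- The norm of a function in `L^p` is determined by its pairings with the functions in `L^q`. -/
lemma norm_le_of_forall_integral_mul_le {p q : ℝ≥0∞} [hp : Fact (1 ≤ p)] [hq : Fact (1 ≤ q)]
    [ENNReal.HolderConjugate p q] (hp1 : p ≠ ∞) (hq1 : q ≠ ∞) {M : ℝ} (hM : 0 ≤ M) (h : Lp ℂ p m)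
    (hh : ∀ ζ : Lp ℂ q m, ‖∫ a, h a * ζ a ∂m‖ ≤ M * ‖ζ‖) : ‖h‖ ≤ M := by
  have hP := ENNReal.HolderConjugate.toReal_of_ne_top hp1 hq1
  have hp0 : p ≠ 0 := (zero_lt_one.trans_le hp.out).ne'
  have hq0 : q ≠ 0 := (zero_lt_one.trans_le hq.out).ne'
  set P := p.toReal with hPdef
  have hmem := Lp.memLp h
  have hc : ((P - 1 : ℝ) : ℂ).re = P * q.toReal⁻¹ := by
    rw [Complex.ofReal_re, ← div_eq_mul_inv, eq_div_iff hP.symm.pos.ne', hP.sub_one_mul_conj]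
  -- The extremal function of Hölder's inequality, $\zeta=\bar h\,|h|^{P-2}$: then $h\zeta=|h|^P$,
  -- and $P-1=P/Q$ gives $\|\zeta\|_q\le\|h\|_p^{P-1}$.
  let ζ : α → ℂ := fun a => phasePow ((P - 1 : ℝ) : ℂ) (star (h a))
  have hζe : eLpNorm ζ q m ≤ eLpNorm h p m ^ (P - 1) := by
    have := eLpNorm_phasePow_le (m := m) hp0 hp1 hq0 hc (fun a => star (h a))
    rw [Complex.ofReal_re] at this
    refine this.trans (ENNReal.rpow_le_rpow (eLpNorm_congr_norm_ae (.of_forall fun a => ?_)).le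
      hP.sub_one_pos.le)
    exact norm_star _
  have hpow : eLpNorm h p m ^ (P - 1) ≠ ∞ :=
    ENNReal.rpow_ne_top_of_nonneg hP.sub_one_pos.le hmem.2.ne
  have hζ : MemLp ζ q m :=
    ⟨((measurable_phasePow _).comp_aemeasurable
      (continuous_star.comp_aestronglyMeasurable hmem.1).aemeasurable).aestronglyMeasurable,
      hζe.trans_lt (lt_top_iff_ne_top.2 hpow)⟩
  have h1 := hh (hζ.toLp ζ)
  have e1 : ∫ a, h a * hζ.toLp ζ a ∂m = ((∫ a, ‖h a‖ ^ P ∂m : ℝ) : ℂ) := by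
    rw [← integral_complex_ofReal]
    refine integral_congr_ae ?_
    filter_upwards [hζ.coeFn_toLp] with a ha
    rw [ha]
    rcases eq_or_ne (h a) 0 with h0 | h0
    · simp [h0, Real.zero_rpow hP.pos.ne']
    · have h2 : 0 < ‖h a‖ := norm_pos_iff.2 h0
      simp only [ζ, phasePow, norm_star]
      rw [← Complex.ofReal_cpow h2.le, ← mul_assoc, mul_div_assoc', Complex.star_def,
        Complex.mul_conj, Complex.normSq_eq_norm_sq, ← Complex.ofReal_div, ← Complex.ofReal_mul]
      congr 1
      rw [sq, mul_div_assoc, div_self h2.ne', mul_one, ← Real.rpow_one_add' h2.le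
        (by rw [add_sub_cancel]; exact hP.pos.ne')]
      congr 1
      ring
  have e2 : ∫ a, ‖h a‖ ^ P ∂m = ‖h‖ ^ P := by
    rw [Lp.norm_def, hmem.eLpNorm_eq_integral_rpow_norm hp0 hp1, ENNReal.toReal_ofReal
      (by positivity), ← Real.rpow_mul (integral_nonneg fun _ => by positivity),
      inv_mul_cancel₀ hP.pos.ne', Real.rpow_one]
  rw [e1, e2, Complex.norm_real, Real.norm_of_nonneg (by positivity)] at h1
  have h3 : ‖hζ.toLp ζ‖ ≤ ‖h‖ ^ (P - 1) := by
    rw [Lp.norm_toLp, Lp.norm_def, ENNReal.toReal_rpow]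
    exact ENNReal.toReal_mono hpow hζe
  -- The test against `ζ` has given $\|h\|^P\le M\|h\|^{P-1}$; it remains to cancel $\|h\|^{P-1}$
  -- when it is not zero.
  rcases (norm_nonneg h).eq_or_lt with h0 | h0
  · rwa [← h0]
  · refine le_of_mul_le_mul_right ?_ (Real.rpow_pos_of_pos h0 (P - 1))
    rw [← Real.rpow_one_add' h0.le (by rw [add_sub_cancel]; exact hP.pos.ne'), add_sub_cancel]
    exact h1.trans (mul_le_mul_of_nonneg_left h3 hM)

/-! ### Operator norms of Schur kernels, computed from pairings with simple functions. -/

variable [SFinite m] {k : α → α → ℂ} {C : ℝ≥0} {p q : ℝ≥0∞}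

/-- The row bound alone gives $\int_{s\times t}|k|\le C\,m(s)$. This supplies the local
integrability required by `riesz_thorin_kernelPairing`. -/
lemma IsSchurKernel.integrableOn_prod (hk : IsSchurKernel m k C) {s : Set α} (t : Set α)
    (hs : m s < ∞) : IntegrableOn (Function.uncurry k) (s ×ˢ t) (m.prod m) := by
  have hm : AEStronglyMeasurable (Function.uncurry k) ((m.restrict s).prod (m.restrict t)) := by
    rw [Measure.prod_restrict]
    exact hk.meas.restrict
  rw [IntegrableOn, ← Measure.prod_restrict]
  refine ⟨hm, ?_⟩
  rw [HasFiniteIntegral, lintegral_prod _ hm.enorm]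
  calc _ ≤ ∫⁻ _ in s, (C : ℝ≥0∞) ∂m := by
        refine lintegral_mono_ae (ae_restrict_of_ae ?_)
        filter_upwards [hk.row] with a ha
        exact (lintegral_mono' Measure.restrict_le_self le_rfl).trans ha
    _ < ∞ := by
        rw [setLIntegral_const]
        exact ENNReal.mul_lt_top ENNReal.coe_lt_top hs

/-- Integrating the rows first bounds the integral of the modulus by $C\,\|f\|_\infty\|g\|_1$.
Integrable simple functions satisfy both requirements, whatever the exponent in play. -/
lemma IsSchurKernel.integrable_pairing (hk : IsSchurKernel m k C) {f g : α → ℂ}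
    (hf : MemLp f ∞ m) (hg : Integrable g m) :
    Integrable (fun z : α × α => k z.1 z.2 * (g z.1 * f z.2)) (m.prod m) := by
  have hm : AEStronglyMeasurable (fun z : α × α => k z.1 z.2 * (g z.1 * f z.2)) (m.prod m) :=
    hk.meas.mul (hg.1.comp_fst.mul hf.1.comp_snd)
  refine ⟨hm, ?_⟩
  rw [HasFiniteIntegral, lintegral_prod _ hm.enorm]
  calc _ ≤ ∫⁻ a, C * eLpNorm f ∞ m * ‖g a‖ₑ ∂m := by
        refine lintegral_mono_ae ?_
        filter_upwards [hk.row, hk.row_meas] with a ha hma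
        calc ∫⁻ b, ‖k a b * (g a * f b)‖ₑ ∂m
            ≤ ∫⁻ b, ‖k a b‖ₑ * (eLpNorm f ∞ m * ‖g a‖ₑ) ∂m := by
              refine lintegral_mono_ae ?_
              rw [eLpNorm_exponent_top]
              filter_upwards [ae_le_eLpNormEssSup (f := f) (μ := m)] with b hb
              rw [enorm_mul, enorm_mul, mul_comm ‖g a‖ₑ]
              gcongr
          _ = (∫⁻ b, ‖k a b‖ₑ ∂m) * (eLpNorm f ∞ m * ‖g a‖ₑ) :=
              lintegral_mul_const'' _ hma.enorm
          _ ≤ _ := by rw [mul_assoc]; gcongr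
    _ = C * eLpNorm f ∞ m * ∫⁻ a, ‖g a‖ₑ ∂m := lintegral_const_mul'' _ hg.1.enorm
    _ < ∞ := ENNReal.mul_lt_top (ENNReal.mul_lt_top ENNReal.coe_lt_top hf.2) hg.2

/-- Pairing a kernel with two functions, one of which is bounded and the other integrable, is
pairing the image of one under the integral operator with the other. -/
lemma IsSchurKernel.kernelPairing_eq (hk : IsSchurKernel m k C) {f g : α → ℂ}
    (hf : MemLp f ∞ m) (hg : Integrable g m) :
    kernelPairing m k f g = ∫ a, kernelFun m k f a * g a ∂m := by
  rw [kernelPairing, integral_prod _ (hk.integrable_pairing hf hg)]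
  refine integral_congr_ae (.of_forall fun a => ?_)
  simp only [kernelFun]
  rw [← integral_mul_const]
  refine integral_congr_ae (.of_forall fun b => ?_)
  ring

variable [hp : Fact (1 ≤ p)] [hq : Fact (1 ≤ q)] [ENNReal.HolderConjugate p q]

/-- Hölder's inequality for $L^p$ and $L^q$. Integrable simple functions lie in every $L^r$, so the
exponents 1 and $\infty$ are allowed; they are endpoints of the interpolation. -/
lemma norm_kernelPairing_le (hk : IsSchurKernel m k C) {f g : SimpleFunc α ℂ}
    (hf : Integrable f m) (hg : Integrable g m) :
    ‖kernelPairing m k f g‖ ≤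
      ‖kernelOp p k hk‖ * ((eLpNorm f p m).toReal * (eLpNorm g q m).toReal) := by
  have hfp := SimpleFunc.memLp_of_integrable hf p
  have e : kernelOp p k hk (hfp.toLp f) =ᵐ[m] kernelFun m k f := by
    refine (kernelOp_coeFn hk _).trans ?_
    rw [kernelFun_congr hfp.coeFn_toLp]
  rw [hk.kernelPairing_eq (SimpleFunc.memLp_of_integrable hf ∞) hg]
  refine (norm_integral_mul_le (hk.memLp hfp hp.out)
    (SimpleFunc.memLp_of_integrable hg q)).trans ?_
  rw [← mul_assoc]
  refine mul_le_mul_of_nonneg_right ?_ ENNReal.toReal_nonneg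
  rw [← eLpNorm_congr_ae e, ← Lp.norm_def, ← Lp.norm_toLp f hfp]
  exact ContinuousLinearMap.le_opNorm _ _

/-- The converse of `norm_kernelPairing_le`: integrable simple functions are dense in $L^p$ and
$L^q$ for finite exponents, and $L^q$ is norming for $L^p$. It turns bilinear estimates into
operator norms. -/
lemma norm_kernelOp_le_of_kernelPairing (hp1 : p ≠ ∞) (hq1 : q ≠ ∞) (hk : IsSchurKernel m k C)
    {M : ℝ} (hM : 0 ≤ M) (h : ∀ f g : SimpleFunc α ℂ, Integrable f m → Integrable g m →
      ‖kernelPairing m k f g‖ ≤ M * ((eLpNorm f p m).toReal * (eLpNorm g q m).toReal)) :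
    ‖kernelOp p k hk‖ ≤ M := by
  have hp0 : p ≠ 0 := (zero_lt_one.trans_le hp.out).ne'
  have hq0 : q ≠ 0 := (zero_lt_one.trans_le hq.out).ne'
  let B := (ContinuousLinearMap.mul ℂ ℂ).lpPairing m p q
  have hB : ∀ (h : Lp ℂ p m) (ζ : Lp ℂ q m), B h ζ = ∫ a, h a * ζ a ∂m := fun h ζ =>
    (ContinuousLinearMap.mul ℂ ℂ).lpPairing_eq_integral h ζ
  -- With the duality written as the bounded bilinear map `B`, both sides are continuous in each
  -- variable, so one variable at a time can be reduced to simple functions.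
  have key : ∀ (ξ : Lp ℂ p m) (ζ : Lp ℂ q m), ‖B (kernelOp p k hk ξ) ζ‖ ≤ M * (‖ξ‖ * ‖ζ‖) := by
    intro ξ ζ
    refine (Lp.simpleFunc.denseRange (E := ℂ) (μ := m) hp1).induction_on
      (p := fun ξ => ‖B (kernelOp p k hk ξ) ζ‖ ≤ M * (‖ξ‖ * ‖ζ‖)) ξ
      (isClosed_le (by fun_prop) (by fun_prop)) fun f => ?_
    refine (Lp.simpleFunc.denseRange (E := ℂ) (μ := m) hq1).induction_on
      (p := fun ζ => ‖B (kernelOp p k hk f) ζ‖ ≤ M * (‖(f : Lp ℂ p m)‖ * ‖ζ‖)) ζ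
      (isClosed_le (by fun_prop) (by fun_prop)) fun g => ?_
    have ef := Lp.simpleFunc.toSimpleFunc_eq_toFun f
    have eg := Lp.simpleFunc.toSimpleFunc_eq_toFun g
    have hf := (SimpleFunc.memLp_iff_integrable hp0 hp1).1 (Lp.simpleFunc.memLp f)
    have hg := (SimpleFunc.memLp_iff_integrable hq0 hq1).1 (Lp.simpleFunc.memLp g)
    have h1 := h _ _ hf hg
    rw [hk.kernelPairing_eq (SimpleFunc.memLp_of_integrable hf ∞) hg, eLpNorm_congr_ae ef,
      eLpNorm_congr_ae eg, ← Lp.norm_def, ← Lp.norm_def] at h1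
    rw [hB]
    refine le_trans (le_of_eq (congrArg _ (integral_congr_ae ?_))) h1
    filter_upwards [kernelOp_coeFn hk (f : Lp ℂ p m), eg] with a h2 h3
    rw [h2, h3, kernelFun_congr ef]
  refine ContinuousLinearMap.opNorm_le_bound _ hM fun ξ => ?_
  refine norm_le_of_forall_integral_mul_le hp1 hq1 (by positivity) _ fun ζ => ?_
  rw [← hB, mul_assoc]
  exact key ξ ζ

/-- Interpolation of the norms of an integral operator on the spaces `L^p`. -/
theorem norm_kernelOp_le_interp {p₀ q₀ p₁ q₁ : ℝ≥0∞} [Fact (1 ≤ p₀)] [Fact (1 ≤ p₁)]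
    [Fact (1 ≤ q₀)] [Fact (1 ≤ q₁)]
    [ENNReal.HolderConjugate p₀ q₀] [ENNReal.HolderConjugate p₁ q₁] (hp1 : p ≠ ∞) (hq1 : q ≠ ∞)
    (hk : IsSchurKernel m k C) {t : ℝ} (ht0 : 0 ≤ t) (ht1 : t ≤ 1)
    (hpt : p.toReal⁻¹ = (1 - t) * p₀.toReal⁻¹ + t * p₁.toReal⁻¹)
    (hqt : q.toReal⁻¹ = (1 - t) * q₀.toReal⁻¹ + t * q₁.toReal⁻¹) :
    ‖kernelOp p k hk‖ ≤ ‖kernelOp p₀ k hk‖ ^ (1 - t) * ‖kernelOp p₁ k hk‖ ^ t := by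
  have h0 : ∀ {r : ℝ≥0∞}, Fact (1 ≤ r) → r ≠ 0 := fun h => (zero_lt_one.trans_le h.out).ne'
  refine norm_kernelOp_le_of_kernelPairing hp1 hq1 hk (by positivity) fun f g hf hg => ?_
  exact riesz_thorin_kernelPairing (fun s t _ _ hs _ => hk.integrableOn_prod t hs) (h0 ‹_›) hp1
    (h0 ‹_›) hq1 (h0 ‹Fact (1 ≤ p₀)›) (h0 ‹Fact (1 ≤ q₀)›) (h0 ‹Fact (1 ≤ p₁)›)
    (h0 ‹Fact (1 ≤ q₁)›) (norm_nonneg _) (norm_nonneg _) ht0 ht1 hpt hqt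
    (fun f g hf hg => norm_kernelPairing_le hk hf hg)
    (fun f g hf hg => norm_kernelPairing_le hk hf hg) hf hg

/-- Adjoint kernels give adjoint operators on `L^2`. -/
lemma inner_kernelOp {l : α → α → ℂ} {D : ℝ≥0} (hk : IsSchurKernel m k C)
    (hl : IsSchurKernel m l D) (h : ∀ᵐ b ∂m, ∀ᵐ a ∂m, l b a = star (k a b)) (ξ η : Lp ℂ 2 m) :
    inner ℂ (kernelOp 2 k hk ξ) η = inner ℂ ξ (kernelOp 2 l hl η) := by
  have hξ := Lp.memLp ξ
  have hη := Lp.memLp η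
  have hm : AEStronglyMeasurable (fun z : α × α => η z.1 * star (k z.1 z.2 * ξ z.2))
      (m.prod m) :=
    hη.1.comp_fst.mul (continuous_star.comp_aestronglyMeasurable (hk.meas.mul hξ.1.comp_snd))
  -- Absolute integrability for Fubini: $\int|k(\cdot,b)||\xi(b)|\,db$ is in $L^2$ by Schur's test,
  -- and it is paired with $|\eta|$ by Cauchy–Schwarz.
  have hi : Integrable (fun z : α × α => η z.1 * star (k z.1 z.2 * ξ z.2)) (m.prod m) := by
    refine ⟨hm, ?_⟩
    rw [HasFiniteIntegral, lintegral_prod _ hm.enorm]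
    have hG := hk.eLpNorm_lintegral (p := 2) hξ.1.enorm (by norm_num)
    rw [eLpNorm_enorm] at hG
    have h1 := ENNReal.lintegral_mul_le_Lp_mul_Lq m (Real.HolderConjugate.two_two) hη.1.enorm
      (hk.lintegral_meas hξ.1.enorm)
    have e : ∀ᵐ a ∂m, ∫⁻ b, ‖η a * star (k a b * ξ b)‖ₑ ∂m =
        ‖η a‖ₑ * ∫⁻ b, ‖k a b‖ₑ * ‖ξ b‖ₑ ∂m := by
      filter_upwards [hk.row_meas] with a ha
      rw [← lintegral_const_mul' _ _ enorm_ne_top]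
      refine lintegral_congr fun b => ?_
      rw [enorm_mul, ← ofReal_norm (star _), norm_star, ofReal_norm, enorm_mul]
    rw [lintegral_congr_ae e]
    refine h1.trans_lt (ENNReal.mul_lt_top ?_ ?_)
    · have := hη.2
      rwa [eLpNorm_eq_lintegral_rpow_enorm_toReal (by simp) (by simp)] at this
    · have := hG.trans_lt (ENNReal.mul_lt_top ENNReal.coe_lt_top hξ.2)
      rwa [eLpNorm_eq_lintegral_rpow_enorm_toReal (by simp) (by simp)] at this
  have hstar : ∀ z : ℂ, star z = (starRingEnd ℂ) z := fun _ => rfl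
  rw [L2.inner_def, L2.inner_def]
  calc ∫ a, inner ℂ (kernelOp 2 k hk ξ a) (η a) ∂m
      = ∫ a, ∫ b, η a * star (k a b * ξ b) ∂m ∂m := by
        refine integral_congr_ae ?_
        filter_upwards [kernelOp_coeFn hk ξ] with a ha
        rw [ha, RCLike.inner_apply, integral_const_mul]
        simp only [hstar]
        rw [integral_conj, kernelFun]
    _ = ∫ b, ∫ a, η a * star (k a b * ξ b) ∂m ∂m := integral_integral_swap hi
    _ = ∫ b, inner ℂ (ξ b) (kernelOp 2 l hl η b) ∂m := by
        refine integral_congr_ae ?_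
        filter_upwards [kernelOp_coeFn hl η, h] with b hb1 hb2
        rw [hb1, RCLike.inner_apply, kernelFun, ← integral_mul_const]
        refine integral_congr_ae ?_
        filter_upwards [hb2] with a ha
        rw [ha, star_mul', ← hstar]
        ring

end KernelOp

/-! ### Extension of `*`-homomorphisms to completions -/

namespace StarAlgSeminorm.Completion

variable {A : Type u} [NonUnitalRing A] [Module ℂ A] [StarRing A]
  [IsScalarTower ℂ A A] [SMulCommClass ℂ A A] [StarModule ℂ A] {N : StarAlgSeminorm A}
  {B : Type*} [NonUnitalNormedRing B] [NormedSpace ℂ B] [StarRing B] [ContinuousStar B]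
  [CompleteSpace B]

lemma uniformContinuous_of_norm_le {φ : A →⋆ₙₐ[ℂ] B} (hφ : ∀ a, ‖φ a‖ ≤ N.toSeminorm a) :
    UniformContinuous (fun a : N.Carrier => φ (show A from a)) := by
  let ψ : N.Carrier →+ B :=
    { toFun := fun a => φ (show A from a), map_zero' := map_zero φ, map_add' := map_add φ }
  exact (AddMonoidHomClass.lipschitz_of_bound ψ 1 fun a => by
    rw [one_mul]; exact hφ a).uniformContinuous

/-- The extension of a `*`-homomorphism dominated by the seminorm `N` to a function on the
completion. -/
def extendFun (N : StarAlgSeminorm A) (φ : A →⋆ₙₐ[ℂ] B) : N.Completion → B :=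
  UniformSpace.Completion.extension (α := N.Carrier) fun a => φ (show A from a)

lemma continuous_extendFun (φ : A →⋆ₙₐ[ℂ] B) : Continuous (extendFun N φ) :=
  UniformSpace.Completion.continuous_extension

lemma extendFun_ofAlg {φ : A →⋆ₙₐ[ℂ] B} (hφ : ∀ a, ‖φ a‖ ≤ N.toSeminorm a) (a : A) :
    extendFun N φ (ofAlg N a) = φ a :=
  UniformSpace.Completion.extension_coe (α := N.Carrier) (uniformContinuous_of_norm_le hφ) a

/-- The extension of a `*`-homomorphism dominated by the seminorm `N` to the completion. -/
def extendHom (φ : A →⋆ₙₐ[ℂ] B) (hφ : ∀ a, ‖φ a‖ ≤ N.toSeminorm a) : N.Completion →⋆ₙₐ[ℂ] B where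
  toFun := extendFun N φ
  map_zero' := by rw [← ofAlg_zero, extendFun_ofAlg hφ, map_zero]
  map_smul' c x := by
    have := continuous_extendFun (N := N) φ
    refine ind x (isClosed_eq (this.comp (continuous_const_smul' N c)) (this.const_smul c))
      fun a => ?_
    rw [← ofAlg_smul, extendFun_ofAlg hφ, extendFun_ofAlg hφ, map_smul]
    rfl
  map_add' x y := by
    have := continuous_extendFun (N := N) φ
    refine ind x (isClosed_eq (by fun_prop) (by fun_prop)) fun a => ?_
    refine ind y (isClosed_eq (by fun_prop) (by fun_prop)) fun b => ?_
    rw [← ofAlg_add, extendFun_ofAlg hφ, extendFun_ofAlg hφ, extendFun_ofAlg hφ, map_add]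
  map_mul' x y := by
    have := continuous_extendFun (N := N) φ
    refine ind x (isClosed_eq (by fun_prop) (by fun_prop)) fun a => ?_
    refine ind y (isClosed_eq (by fun_prop) (by fun_prop)) fun b => ?_
    rw [← ofAlg_mul, extendFun_ofAlg hφ, extendFun_ofAlg hφ, extendFun_ofAlg hφ, map_mul]
  map_star' x := by
    have := continuous_extendFun (N := N) φ
    refine ind x (isClosed_eq (this.comp (continuous_star' N)) this.star) fun a => ?_
    rw [← ofAlg_star, extendFun_ofAlg hφ, extendFun_ofAlg hφ, map_star]

variable {φ : A →⋆ₙₐ[ℂ] B} (hφ : ∀ a, ‖φ a‖ ≤ N.toSeminorm a)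

lemma continuous_extendHom : Continuous (extendHom φ hφ) := continuous_extendFun φ

lemma extendHom_ofAlg (a : A) : extendHom φ hφ (ofAlg N a) = φ a := extendFun_ofAlg hφ a

lemma norm_extendHom_le (x : N.Completion) : ‖extendHom φ hφ x‖ ≤ ‖x‖ := by
  have := continuous_extendHom hφ
  refine ind x (isClosed_le (by fun_prop) (by fun_prop)) fun a => ?_
  rw [extendHom_ofAlg, norm_ofAlg]
  exact hφ a

/-- The canonical `*`-homomorphism to the completion. -/
def ofAlgHom (N : StarAlgSeminorm A) : A →⋆ₙₐ[ℂ] N.Completion where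
  toFun := ofAlg N
  map_zero' := ofAlg_zero N
  map_smul' := ofAlg_smul N
  map_add' := ofAlg_add N
  map_mul' := ofAlg_mul N
  map_star' := ofAlg_star N

instance : ContinuousStar N.Completion := ⟨continuous_star' N⟩

lemma exists_norm_sub_lt (x : N.Completion) {ε : ℝ} (hε : 0 < ε) :
    ∃ a : A, ‖x - ofAlg N a‖ < ε := by
  obtain ⟨a, ha⟩ := (denseRange_ofAlg N).exists_dist_lt x hε
  exact ⟨a, by rwa [← dist_eq_norm]⟩

lemma ofAlg_sub (a b : A) : ofAlg N (a - b) = ofAlg N a - ofAlg N b := map_sub (ofAlgHom N) a b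

section Map

variable {N' : StarAlgSeminorm A} (h : ∀ a, N'.toSeminorm a ≤ N.toSeminorm a)

/-- The `*`-homomorphism between the completions in two comparable seminorms. -/
def mapHom : N.Completion →⋆ₙₐ[ℂ] N'.Completion :=
  extendHom (ofAlgHom N') fun a => (norm_ofAlg N' a).trans_le (h a)

lemma mapHom_ofAlg (a : A) : mapHom h (ofAlg N a) = ofAlg N' a := extendHom_ofAlg _ a

lemma continuous_mapHom : Continuous (mapHom h) := continuous_extendHom _

lemma norm_mapHom_le (x : N.Completion) : ‖mapHom h x‖ ≤ ‖x‖ := norm_extendHom_le _ x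

lemma denseRange_mapHom : DenseRange (mapHom h) := by
  refine (denseRange_ofAlg N').mono ?_
  rintro _ ⟨a, rfl⟩
  exact ⟨ofAlg N a, mapHom_ofAlg h a⟩

end Map

end StarAlgSeminorm.Completion

/-! ### The spectral radius formula without a unit -/

section SpecRadius

/-- The power `a ^ (n + 1)`. -/
def succPow {A : Type*} [Mul A] (a : A) : ℕ → A
  | 0 => a
  | n + 1 => succPow a n * a

lemma map_succPow {A B F : Type*} [Mul A] [Mul B] [FunLike F A B] [MulHomClass F A B] (φ : F)
    (a : A) (n : ℕ) : φ (succPow a n) = succPow (φ a) n := by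
  induction n with
  | zero => rfl
  | succ n ih => rw [succPow, map_mul, ih, succPow]

variable {A : Type u} [NonUnitalNormedRing A] [NormedSpace ℂ A] [IsScalarTower ℂ A A]
    [SMulCommClass ℂ A A]

lemma inr_succPow (a : A) (n : ℕ) :
    ((succPow a n : A) : Unitization ℂ A) = (a : Unitization ℂ A) ^ (n + 1) := by
  induction n with
  | zero => rw [zero_add, pow_one]; rfl
  | succ n ih => rw [succPow, Unitization.inr_mul, ih, ← pow_succ]

/-- **Gelfand's formula** in a Banach algebra without unit. -/
theorem tendsto_succPow_specRadius [CompleteSpace A] (a : A) :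
    Tendsto (fun n : ℕ => ‖succPow a n‖ₑ ^ (1 / (n + 1 : ℝ))) atTop (𝓝 (specRadius a)) := by
  -- The unitization with the $\ell^1$-norm is a Banach algebra containing `A` isometrically. The
  -- spectrum is purely algebraic, so the change of norm does not affect it.
  let e := WithLp.unitizationAlgEquiv (𝕜 := ℂ) (A := A) ℂ
  have h1 : specRadius a = spectralRadius ℂ (e.symm (a : Unitization ℂ A)) := by
    rw [specRadius, spectralRadius, spectralRadius, AlgEquiv.spectrum_eq]
  -- The sequence is shifted by one because the zeroth power is the adjoined unit, which is outside
  -- `A`.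
  have h2 := (spectrum.pow_nnnorm_pow_one_div_tendsto_nhds_spectralRadius
    (e.symm (a : Unitization ℂ A))).comp (tendsto_add_atTop_nat 1)
  rw [h1]
  refine h2.congr fun n => ?_
  simp only [Function.comp_apply]
  rw [← map_pow, ← inr_succPow]
  have h3 : ‖e.symm ((succPow a n : A) : Unitization ℂ A)‖₊ = ‖succPow a n‖₊ :=
    WithLp.unitization_nnnorm_inr _
  rw [h3]
  push_cast
  rfl

/-- Finiteness is needed to pass to the limit in a product of extended nonnegative reals, where
$0\cdot\infty$ would be an obstruction. -/
lemma specRadius_ne_top [CompleteSpace A] (a : A) : specRadius a ≠ ∞ := by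
  let e := WithLp.unitizationAlgEquiv (𝕜 := ℂ) (A := A) ℂ
  have h1 : specRadius a = spectralRadius ℂ (e.symm (a : Unitization ℂ A)) := by
    rw [specRadius, spectralRadius, spectralRadius, AlgEquiv.spectrum_eq]
  rw [h1]
  exact ((spectrum.spectralRadius_le_pow_nnnorm_pow_one_div ℂ _ 0).trans_lt
    (ENNReal.mul_lt_top (ENNReal.rpow_lt_top_of_nonneg (by positivity) ENNReal.coe_ne_top)
      (ENNReal.rpow_lt_top_of_nonneg (by positivity) ENNReal.coe_ne_top))).ne

/-- An interpolation inequality for norms implies one for spectral radii. -/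
theorem specRadius_le_interp {B C : Type u}
    [CompleteSpace A] [NonUnitalNormedRing B] [NormedSpace ℂ B] [IsScalarTower ℂ B B]
    [SMulCommClass ℂ B B] [CompleteSpace B]
    [NonUnitalNormedRing C] [NormedSpace ℂ C] [IsScalarTower ℂ C C]
    [SMulCommClass ℂ C C] [CompleteSpace C] {F₁ F₂ : Type*} [FunLike F₁ A B] [MulHomClass F₁ A B]
    [FunLike F₂ A C] [MulHomClass F₂ A C] (φ : F₁) (ψ : F₂) {t : ℝ} (ht0 : 0 ≤ t) (ht1 : t ≤ 1)
    (h : ∀ a, ‖φ a‖ ≤ ‖a‖ ^ (1 - t) * ‖ψ a‖ ^ t) (a : A) :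
    specRadius (φ a) ≤ specRadius a ^ (1 - t) * specRadius (ψ a) ^ t := by
  have ht1' : 0 ≤ 1 - t := by linarith
  have he : ∀ a, ‖φ a‖ₑ ≤ ‖a‖ₑ ^ (1 - t) * ‖ψ a‖ₑ ^ t := by
    intro a
    rw [← ofReal_norm, ← ofReal_norm, ← ofReal_norm,
      ENNReal.ofReal_rpow_of_nonneg (norm_nonneg _) ht1',
      ENNReal.ofReal_rpow_of_nonneg (norm_nonneg _) ht0, ← ENNReal.ofReal_mul (by positivity)]
    exact ENNReal.ofReal_le_ofReal (h a)
  have hA := (ENNReal.continuous_rpow_const (y := 1 - t)).continuousAt.tendsto.comp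
    (tendsto_succPow_specRadius a)
  have hC := (ENNReal.continuous_rpow_const (y := t)).continuousAt.tendsto.comp
    (tendsto_succPow_specRadius (ψ a))
  have hAC := ENNReal.Tendsto.mul hA
    (.inr (ENNReal.rpow_ne_top_of_nonneg ht0 (specRadius_ne_top _))) hC
    (.inr (ENNReal.rpow_ne_top_of_nonneg ht1' (specRadius_ne_top _)))
  refine le_of_tendsto_of_tendsto' (tendsto_succPow_specRadius (φ a)) hAC fun n => ?_
  have hn : (0 : ℝ) ≤ 1 / (n + 1 : ℝ) := by positivity
  simp only [Function.comp_apply]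
  -- Multiplicativity makes the norm inequality available for the power $a^{n+1}$; its $(n+1)$-st
  -- root is the desired inequality before the limit.
  rw [← map_succPow, ← map_succPow]
  refine (ENNReal.rpow_le_rpow (he _) hn).trans (le_of_eq ?_)
  rw [ENNReal.mul_rpow_of_nonneg _ _ hn, ← ENNReal.rpow_mul, ← ENNReal.rpow_mul,
    ← ENNReal.rpow_mul, ← ENNReal.rpow_mul, mul_comm (1 - t), mul_comm t]

end SpecRadius

section Groupoid

open TopologicalGroupoid

variable {G : Type u} [TopologicalSpace G] [TopologicalGroupoid G] [MeasurableSpace G]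
  [T2Space G] [SecondCountableTopology G] [LocallyCompactSpace G] [BorelSpace G]
  {lam : HaarSystem G} {σ : TwoCocycle G}

namespace TwistedCc

/-! ### Comparison of the norms -/

section Norms

variable {p q : ℝ≥0∞} [hp : Fact (1 ≤ p)] [hq : Fact (1 ≤ q)] [hpq : ENNReal.HolderConjugate p q]

lemma reducedNorm_le_normI (f : TwistedCc lam σ) : reducedNorm p f ≤ normI f :=
  Real.iSup_le (fun x => norm_leftRegular_le_normI x f) (normI_nonneg f)

lemma sharpNorm_le_normI (f : TwistedCc lam σ) : sharpNorm p q f ≤ normI f :=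
  max_le (reducedNorm_le_normI f) (reducedNorm_le_normI f)

lemma sharpNorm_nonneg (f : TwistedCc lam σ) : 0 ≤ sharpNorm p q f :=
  le_max_of_le_left (reducedNorm_nonneg f)

/-- Since $\frac1p+\frac1q=1$, the exponent 2 is the midpoint of $p$ and $q$, so the norm on $L^2$
is at most the geometric mean of those on $L^p$ and $L^q$. -/
lemma reducedNorm_two_le_sharpNorm (hp1 : p ≠ ∞) (hq1 : q ≠ ∞) (f : TwistedCc lam σ) :
    reducedNorm 2 f ≤ sharpNorm p q f := by
  have : ENNReal.HolderConjugate q p := ENNReal.HolderConjugate.symm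
  have h := (ENNReal.HolderConjugate.toReal_of_ne_top hp1 hq1).inv_add_inv_eq_one
  refine Real.iSup_le (fun x => ?_) (sharpNorm_nonneg f)
  have e : (2 : ℝ≥0∞).toReal⁻¹ =
      (1 - 2⁻¹) * p.toReal⁻¹ + 2⁻¹ * q.toReal⁻¹ := by
    rw [ENNReal.toReal_ofNat]; linarith
  have e' : (2 : ℝ≥0∞).toReal⁻¹ =
      (1 - 2⁻¹) * q.toReal⁻¹ + 2⁻¹ * p.toReal⁻¹ := by
    rw [ENNReal.toReal_ofNat]; linarith
  refine (norm_kernelOp_le_interp (p := 2) (q := 2) (p₀ := p) (q₀ := q) (p₁ := q) (q₁ := p)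
    (by simp) (by simp) (f.isSchurKernel x) (t := 2⁻¹) (by norm_num) (by norm_num) e e').trans ?_
  have h1 : ‖leftRegular p x f‖ ≤ sharpNorm p q f :=
    (norm_leftRegular_le x f).trans (le_max_left _ _)
  have h2 : ‖leftRegular q x f‖ ≤ sharpNorm p q f :=
    (norm_leftRegular_le x f).trans (le_max_right _ _)
  refine (mul_le_mul (Real.rpow_le_rpow (norm_nonneg _) h1 (by norm_num))
    (Real.rpow_le_rpow (norm_nonneg _) h2 (by norm_num)) (Real.rpow_nonneg (norm_nonneg _) _)
    (Real.rpow_nonneg (sharpNorm_nonneg f) _)).trans (le_of_eq ?_)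
  rw [← Real.rpow_add_of_nonneg (sharpNorm_nonneg f) (by norm_num) (by norm_num)]
  norm_num

/-- Riesz–Thorin in each fiber, with Schur's test at the endpoint $p_0$; the constants do not depend
on the unit $x$, so the supremum can be taken. -/
lemma reducedNorm_le_interp {p₀ q₀ : ℝ≥0∞} [Fact (1 ≤ p₀)] [Fact (1 ≤ q₀)]
    [ENNReal.HolderConjugate p₀ q₀] (hp1 : p ≠ ∞) (hq1 : q ≠ ∞) {t : ℝ} (ht0 : 0 ≤ t) (ht1 : t ≤ 1)
    (hpt : p.toReal⁻¹ = (1 - t) * p₀.toReal⁻¹ + t * 2⁻¹)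
    (hqt : q.toReal⁻¹ = (1 - t) * q₀.toReal⁻¹ + t * 2⁻¹) (f : TwistedCc lam σ) :
    reducedNorm p f ≤ normI f ^ (1 - t) * reducedNorm 2 f ^ t := by
  have h0 := Real.rpow_nonneg (normI_nonneg f) (1 - t)
  refine Real.iSup_le (fun x => ?_)
    (mul_nonneg h0 (Real.rpow_nonneg (reducedNorm_nonneg f) _))
  refine (norm_kernelOp_le_interp (p := p) (q := q) (p₀ := p₀) (q₀ := q₀) (p₁ := 2) (q₁ := 2)
    hp1 hq1 (f.isSchurKernel x) ht0 ht1 (by rwa [ENNReal.toReal_ofNat])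
    (by rwa [ENNReal.toReal_ofNat])).trans ?_
  exact mul_le_mul (Real.rpow_le_rpow (norm_nonneg _) (norm_leftRegular_le_normI x f)
    (by linarith)) (Real.rpow_le_rpow (norm_nonneg _) (norm_leftRegular_le x f) ht0)
    (Real.rpow_nonneg (norm_nonneg _) _) h0

/-- Here $p$ is interpolated between 1 and 2, and $q$ between $\infty$ and 2. The parameter is the
same because $1/q=1-1/p=t/2$, where `∞.toReal⁻¹ = 0` removes the endpoint term. -/
lemma sharpNorm_le_interp (hp1 : p ≠ ∞) (hq1 : q ≠ ∞) {t : ℝ} (ht0 : 0 ≤ t) (ht1 : t ≤ 1)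
    (hpt : p.toReal⁻¹ = 1 - t + t * 2⁻¹) (f : TwistedCc lam σ) :
    sharpNorm p q f ≤ normI f ^ (1 - t) * reducedNorm 2 f ^ t := by
  have : ENNReal.HolderConjugate q p := ENNReal.HolderConjugate.symm
  have h := (ENNReal.HolderConjugate.toReal_of_ne_top hp1 hq1).inv_add_inv_eq_one
  exact max_le
    (reducedNorm_le_interp (q := q) (p₀ := 1) (q₀ := ∞) hp1 hq1 ht0 ht1
      (by simpa using hpt) (by simp; linarith) f)
    (reducedNorm_le_interp (q := p) (p₀ := ∞) (q₀ := 1) hq1 hp1 ht0 ht1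
      (by simp; linarith) (by simpa using hpt) f)

end Norms

/-! ### Closability of the identity map between the completions -/

section Closability

lemma le_of_forall_pos_le_add_mul {a b c : ℝ} (h : ∀ η > 0, a ≤ b + η * c) : a ≤ b := by
  have h1 : Tendsto (fun η : ℝ => b + η * c) (𝓝[>] 0) (𝓝 (b + 0 * c)) :=
    Tendsto.mono_left (Continuous.tendsto (by fun_prop) 0) nhdsWithin_le_nhds
  rw [zero_mul, add_zero] at h1
  exact ge_of_tendsto h1 (eventually_mem_nhdsWithin.mono h)

variable {p q : ℝ≥0∞} [hp : Fact (1 ≤ p)] [hq : Fact (1 ≤ q)] [hpq : ENNReal.HolderConjugate p q]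

/-- Lower semicontinuity of $\|\cdot\|_{r,p}$ with respect to $\|\cdot\|_{r,2}$. For fixed simple
$u,v$ the kernel of $f$ splits: the part of $f-f'$ contributes at most $M\|u\|_p\|v\|_q$ and that of
$f'$ at most $\eta\|u\|_2\|v\|_2$, which disappears as $\eta\to0$. -/
lemma reducedNorm_le_of_approx (hp1 : p ≠ ∞) (hq1 : q ≠ ∞) {f : TwistedCc lam σ} {M : ℝ}
    (hM : 0 ≤ M)
    (h : ∀ η > 0, ∃ f' : TwistedCc lam σ, reducedNorm p (f - f') ≤ M ∧ reducedNorm 2 f' ≤ η) :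
    reducedNorm p f ≤ M := by
  refine Real.iSup_le (fun x => ?_) hM
  refine norm_kernelOp_le_of_kernelPairing (q := q) hp1 hq1 _ hM fun u v hu hv => ?_
  refine le_of_forall_pos_le_add_mul
    (c := (eLpNorm u 2 (lam.measure x)).toReal * (eLpNorm v 2 (lam.measure x)).toReal)
    fun η hη => ?_
  obtain ⟨f', h1, h2⟩ := h η hη
  have e : kernelPairing (lam.measure x) (ker f) u v =
      kernelPairing (lam.measure x) (ker (f - f')) u v +
        kernelPairing (lam.measure x) (ker f') u v := by
    have hu' := SimpleFunc.memLp_of_integrable hu ∞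
    rw [kernelPairing, kernelPairing, kernelPairing,
      ← integral_add (((f - f').isSchurKernel x).integrable_pairing hu' hv)
        ((f'.isSchurKernel x).integrable_pairing hu' hv)]
    refine integral_congr_ae (.of_forall fun z => ?_)
    simp only [← add_mul, ← ker_add, sub_add_cancel]
  rw [e]
  refine (norm_add_le _ _).trans (add_le_add ?_ ?_)
  · exact (norm_kernelPairing_le (p := p) (q := q) ((f - f').isSchurKernel x) hu hv).trans
      (mul_le_mul_of_nonneg_right ((norm_leftRegular_le x _).trans h1) (by positivity))
  · exact (norm_kernelPairing_le (p := 2) (q := 2) (f'.isSchurKernel x) hu hv).trans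
      (mul_le_mul_of_nonneg_right ((norm_leftRegular_le x _).trans h2) (by positivity))

lemma sharpNorm_le_of_approx (hp1 : p ≠ ∞) (hq1 : q ≠ ∞) {f : TwistedCc lam σ} {M : ℝ}
    (hM : 0 ≤ M)
    (h : ∀ η > 0, ∃ f' : TwistedCc lam σ, sharpNorm p q (f - f') ≤ M ∧ reducedNorm 2 f' ≤ η) :
    sharpNorm p q f ≤ M := by
  have : ENNReal.HolderConjugate q p := ENNReal.HolderConjugate.symm
  refine max_le (reducedNorm_le_of_approx (q := q) hp1 hq1 hM fun η hη => ?_)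
    (reducedNorm_le_of_approx (q := p) hq1 hp1 hM fun η hη => ?_)
  · obtain ⟨f', h1, h2⟩ := h η hη
    exact ⟨f', (le_max_left _ _).trans h1, h2⟩
  · obtain ⟨f', h1, h2⟩ := h η hη
    exact ⟨f', (le_max_right _ _).trans h1, h2⟩

/-! ### Recovering the $I$-norm from values of products at units. -/

lemma norm_mul_apply_le (f g : TwistedCc lam σ) (hg : ∀ a, ‖g a‖ ≤ 1) (a : G) :
    ‖(f * g) a‖ ≤ normI f := by
  have ha := mem_fiber_srcU a
  rw [mul_apply' ha]
  have hi := f.integrable_ker ha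
  refine (norm_integral_le_of_norm_le hi.norm (.of_forall fun b => ?_)).trans ?_
  · rw [norm_mul]
    exact mul_le_of_le_one_right (norm_nonneg _) (hg b)
  · rw [integral_norm_eq_lintegral_enorm hi.1]
    refine (ENNReal.toReal_mono ENNReal.coe_ne_top (f.lintegral_row_le ha)).trans ?_
    rw [ENNReal.coe_toReal, Real.coe_toNNReal _ (normI_nonneg f)]

/-- On the fiber over $x$ the product $f\star g$ is $L^2_x(f)g$. This is how smallness in
$\|\cdot\|_{r,2}$ becomes smallness of products in $L^2(\mathcal G_x)$. -/
lemma eLpNorm_mul_le (f g : TwistedCc lam σ) (x : UnitSpace G) :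
    eLpNorm (f * g : TwistedCc lam σ) 2 (lam.measure x) ≤
      ENNReal.ofReal (reducedNorm 2 f) * eLpNorm g 2 (lam.measure x) := by
  have hg : MemLp g 2 (lam.measure x) :=
    g.continuous.memLp_of_hasCompactSupport g.hasCompactSupport
  have e : (f * g : TwistedCc lam σ) =ᵐ[lam.measure x] leftRegular 2 x f (hg.toLp g) := by
    have e1 : leftRegular 2 x f (hg.toLp g) =ᵐ[lam.measure x] kernelFun (lam.measure x) (ker f) g := by
      refine (kernelOp_coeFn (f.isSchurKernel x) _).trans ?_
      rw [kernelFun_congr hg.coeFn_toLp]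
    filter_upwards [e1, lam.ae_mem x] with a h1 ha
    rw [h1, mul_apply' ha]
    rfl
  rw [eLpNorm_congr_ae e, ← Lp.enorm_def, ← ofReal_norm]
  calc _ ≤ ENNReal.ofReal (reducedNorm 2 f * ‖hg.toLp g‖) :=
        ENNReal.ofReal_le_ofReal ((ContinuousLinearMap.le_opNorm _ _).trans
          (mul_le_mul_of_nonneg_right (norm_leftRegular_le x f) (norm_nonneg _)))
    _ = _ := by
        rw [ENNReal.ofReal_mul (reducedNorm_nonneg f), ofReal_norm, Lp.enorm_def,
          eLpNorm_congr_ae hg.coeFn_toLp]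

/-- If $|(f\star g)(x)|>M$, then $|f\star g|>M+\delta$ on a neighbourhood $U$ of $x$ by continuity,
while $|(f-f')\star g|\le M$ everywhere. Hence $|f'\star g|\ge\delta$ on $U$, and Chebyshev's
inequality gives $\delta^2\lambda_x(U)\le\eta^2\|g\|_2^2$. Since $x$ is in the support of
$\lambda_x$, $\lambda_x(U)>0$, and letting $\eta\to0$ is a contradiction. -/
lemma norm_mul_apply_le_of_approx {f : TwistedCc lam σ} {M : ℝ}
    (h : ∀ η > 0, ∃ f' : TwistedCc lam σ, normI (f - f') ≤ M ∧ reducedNorm 2 f' ≤ η)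
    {g : TwistedCc lam σ} (hg : ∀ a, ‖g a‖ ≤ 1) (x : UnitSpace G) : ‖(f * g) x.1‖ ≤ M := by
  by_contra! hc
  -- Half of the excess, so that $M+\delta$ is still strictly below the value at $x$ and the strict
  -- inequality persists on an open set.
  set δ := (‖(f * g) x.1‖ - M) / 2 with hδ
  have hδ0 : 0 < δ := by rw [hδ]; linarith
  set U : Set G := {a | M + δ < ‖(f * g) a‖} with hU
  have hUo : U ∈ 𝓝 x.1 :=
    (isOpen_lt continuous_const (f * g).continuous.norm).mem_nhds
      (show M + δ < ‖(f * g) x.1‖ by rw [hδ]; linarith)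
  have hx : x.1 ∈ (lam.measure x).support := by
    rw [lam.support_eq]
    exact x.2
  have hpos := (Measure.mem_support_iff_forall _).1 hx U hUo
  have hg2 : eLpNorm g 2 (lam.measure x) ≠ ∞ :=
    (g.continuous.memLp_of_hasCompactSupport g.hasCompactSupport).2.ne
  have key : ∀ η > 0, ENNReal.ofReal δ ^ (2 : ℝ) * lam.measure x U ≤
      (ENNReal.ofReal η * eLpNorm g 2 (lam.measure x)) ^ (2 : ℝ) := by
    intro η hη
    obtain ⟨f', h1, h2⟩ := h η hη
    have hsub : U ⊆ {a | ENNReal.ofReal δ ≤ ‖(f' * g) a‖ₑ} := by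
      intro a ha
      have ha' : M + δ < ‖(f * g) a‖ := ha
      have h3 : (f * g) a = ((f - f') * g) a + (f' * g) a := by
        rw [← add_apply, ← add_mul, sub_add_cancel]
      have h4 := (norm_mul_apply_le (f - f') g hg a).trans h1
      have h5 := norm_add_le (((f - f') * g) a) ((f' * g) a)
      rw [← h3] at h5
      rw [mem_ofPred_eq, ← ofReal_norm]
      exact ENNReal.ofReal_le_ofReal (by linarith)
    have h6 := mul_meas_ge_le_pow_eLpNorm' (lam.measure x) (p := 2) (by simp) (by simp)
      (f' * g).continuous.aestronglyMeasurable (ENNReal.ofReal δ)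
    rw [ENNReal.toReal_ofNat] at h6
    refine (mul_le_mul_right (measure_mono hsub) _).trans (h6.trans ?_)
    refine ENNReal.rpow_le_rpow ((eLpNorm_mul_le f' g x).trans ?_) (by norm_num)
    gcongr
  have hlim : Tendsto (fun η : ℝ => (ENNReal.ofReal η * eLpNorm g 2 (lam.measure x)) ^ (2 : ℝ))
      (𝓝[>] 0) (𝓝 0) := by
    have h1 : Continuous fun η : ℝ =>
        (ENNReal.ofReal η * eLpNorm g 2 (lam.measure x)) ^ (2 : ℝ) :=
      ENNReal.continuous_rpow_const.comp
        ((ENNReal.continuous_mul_const hg2).comp ENNReal.continuous_ofReal)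
    have h2 := h1.tendsto 0
    simp only [ENNReal.ofReal_zero, zero_mul] at h2
    rw [ENNReal.zero_rpow_of_pos (by norm_num)] at h2
    exact h2.mono_left nhdsWithin_le_nhds
  have h0 := ge_of_tendsto hlim (eventually_mem_nhdsWithin.mono key)
  have h1 : 0 < ENNReal.ofReal δ ^ (2 : ℝ) :=
    ENNReal.rpow_pos (ENNReal.ofReal_pos.2 hδ0) ENNReal.ofReal_ne_top
  exact (ENNReal.mul_pos h1.ne' hpos.ne').not_ge h0

/-- The row of the kernel of $f$ at a unit is, by `ker_star`, the conjugate of the column of $f^*$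
at that unit, and that column is $f^*$ itself. Values at units thus test $f^*$ against arbitrary
$g$. -/
lemma mul_apply_unit (f g : TwistedCc lam σ) (x : UnitSpace G) :
    (f * g) x.1 = ∫ b, star ((star f) b) * g b ∂(lam.measure x) := by
  have hx : x.1 ∈ Fiber x := x.2
  rw [mul_apply' hx]
  refine integral_congr_ae ?_
  filter_upwards [lam.ae_mem x] with b hb
  have hb' : src b = x.1 := hb
  have h1 : src b = src x.1 := hb'.trans x.2.symm
  have h2 := ker_src (star f) b
  rw [hb', ker_star h1] at h2
  rw [← h2, star_star]

/-- The ideal test function $h/|h|$ need not be continuous. It is replaced by $h/(|h|+\delta)$,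
which has modulus at most 1 and is in $C_c$; the resulting integrals of $|h|^2/(|h|+\delta)$ tend to
that of $|h|$ by dominated convergence as $\delta\to0$. -/
lemma integral_norm_le_of_forall {h : TwistedCc lam σ} {M : ℝ} {x : UnitSpace G}
    (H : ∀ g : TwistedCc lam σ, (∀ a, ‖g a‖ ≤ 1) →
      ‖∫ b, star (h b) * g b ∂(lam.measure x)‖ ≤ M) :
    ∫ b, ‖h b‖ ∂(lam.measure x) ≤ M := by
  have hlim : Tendsto (fun δ : ℝ => ∫ b, ‖h b‖ ^ 2 / (‖h b‖ + δ) ∂(lam.measure x)) (𝓝[>] 0)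
      (𝓝 (∫ b, ‖h b‖ ∂(lam.measure x))) := by
    refine tendsto_integral_filter_of_dominated_convergence (fun b => ‖h b‖) ?_ ?_
      (h.integrable x).norm ?_
    · refine .of_forall fun δ => ?_
      have := h.continuous.measurable
      exact Measurable.aestronglyMeasurable (by fun_prop)
    · refine eventually_mem_nhdsWithin.mono fun δ hδ => .of_forall fun b => ?_
      have hδ' : 0 < δ := hδ
      have h0 := norm_nonneg (h b)
      rw [Real.norm_of_nonneg (by positivity), div_le_iff₀ (by positivity)]
      nlinarith
    · refine .of_forall fun b => ?_
      rcases eq_or_ne (h b) 0 with h0 | h0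
      · simp [h0]
      · have h1 : ‖h b‖ ≠ 0 := norm_ne_zero_iff.2 h0
        have h2 : ContinuousAt (fun δ : ℝ => ‖h b‖ ^ 2 / (‖h b‖ + δ)) 0 :=
          ContinuousAt.div (by fun_prop) (by fun_prop) (by simpa using h1)
        have h3 := h2.tendsto
        simp only [add_zero, sq, mul_div_assoc, div_self h1, mul_one] at h3
        simpa only [sq, mul_div_assoc] using h3.mono_left nhdsWithin_le_nhds
  refine le_of_tendsto hlim (eventually_mem_nhdsWithin.mono fun δ hδ => ?_)
  have hδ' : 0 < δ := hδ
  have hne : ∀ a, ((‖h a‖ + δ : ℝ) : ℂ) ≠ 0 := fun a => by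
    have : 0 < ‖h a‖ + δ := by positivity
    exact_mod_cast this.ne'
  have hc := h.continuous
  let g : TwistedCc lam σ := mk (fun a => h a / ((‖h a‖ + δ : ℝ) : ℂ))
    (hc.div (Complex.continuous_ofReal.comp (by fun_prop)) hne)
    (h.hasCompactSupport.mono' fun a ha => subset_tsupport _ fun h0 => ha (by simp [h0]))
  have hg : ∀ a, ‖g a‖ ≤ 1 := by
    intro a
    have h0 : 0 < ‖h a‖ + δ := by positivity
    change ‖h a / ((‖h a‖ + δ : ℝ) : ℂ)‖ ≤ 1
    rw [norm_div, Complex.norm_real, Real.norm_of_nonneg h0.le, div_le_one h0]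
    linarith
  have h1 := H g hg
  have e : ∫ b, star (h b) * g b ∂(lam.measure x) =
      ((∫ b, ‖h b‖ ^ 2 / (‖h b‖ + δ) ∂(lam.measure x) : ℝ) : ℂ) := by
    rw [← integral_complex_ofReal]
    refine integral_congr_ae (.of_forall fun b => ?_)
    change star (h b) * (h b / ((‖h b‖ + δ : ℝ) : ℂ)) = _
    rw [← mul_div_assoc, Complex.star_def, ← Complex.normSq_eq_conj_mul_self,
      Complex.normSq_eq_norm_sq, ← Complex.ofReal_div]
  rw [e, Complex.norm_real] at h1
  exact (le_abs_self _).trans h1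

lemma reducedNorm_two_star (f : TwistedCc lam σ) : reducedNorm 2 (star f) = reducedNorm 2 f :=
  (seminormReduced lam σ).star_eq' f

/-- Lower semicontinuity of the $I$-norm with respect to $\|\cdot\|_{r,2}$. Products with $f$
control the integrals of $|f^*|$; those of $|f|$ follow by applying this to $f^*$, as the involution
preserves both norms. -/
lemma normI_le_of_approx {f : TwistedCc lam σ} {M : ℝ} (hM : 0 ≤ M)
    (h : ∀ η > 0, ∃ f' : TwistedCc lam σ, normI (f - f') ≤ M ∧ reducedNorm 2 f' ≤ η) :
    normI f ≤ M := by
  have core : ∀ f : TwistedCc lam σ,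
      (∀ η > 0, ∃ f' : TwistedCc lam σ, normI (f - f') ≤ M ∧ reducedNorm 2 f' ≤ η) →
      ∀ x, ∫ a, ‖(star f) a‖ ∂(lam.measure x) ≤ M := by
    intro f h x
    refine integral_norm_le_of_forall fun g hg => ?_
    rw [← mul_apply_unit]
    exact norm_mul_apply_le_of_approx h hg x
  refine normI_le hM (fun x => ?_) fun x => ?_
  · have := core (star f) (fun η hη => ?_) x
    · rwa [star_star] at this
    · obtain ⟨f', h1, h2⟩ := h η hη
      refine ⟨star f', ?_, by rwa [reducedNorm_two_star]⟩
      rwa [← star_sub, normI_star]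
  · simpa only [norm_star_apply] using core f h x

end Closability

/-! ### The regular representations on `L²` -/

/-- The regular representation on the Hilbert space `L²(G_x)`, as a `*`-homomorphism. -/
def regularRep (lam : HaarSystem G) (σ : TwoCocycle G) (x : UnitSpace G) :
    TwistedCc lam σ →⋆ₙₐ[ℂ] (Lp ℂ 2 (lam.measure x) →L[ℂ] Lp ℂ 2 (lam.measure x)) where
  toFun f := leftRegular 2 x f
  map_smul' c f := leftRegular_smul x c f
  map_zero' := by
    have := leftRegular_smul (p := 2) x (0 : ℂ) (0 : TwistedCc lam σ)
    rwa [zero_smul, zero_smul] at this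
  map_add' f g := leftRegular_add x f g
  map_mul' f g := leftRegular_mul x f g
  map_star' f := by
    rw [ContinuousLinearMap.star_eq_adjoint, ContinuousLinearMap.eq_adjoint_iff]
    intro ξ η
    refine inner_kernelOp _ _ ?_ ξ η
    filter_upwards [lam.ae_mem x] with b hb
    filter_upwards [lam.ae_mem x] with a ha
    rw [ker_star (Eq.trans ha (Eq.symm hb)), star_star]

end TwistedCc

end Groupoid

/-! ### Nested triples -/

section Nested

open StarAlgSeminorm.Completion

lemma IsReducedStarAlgebra.of_injective {A B : Type u} [NonUnitalNormedRing A] [NormedSpace ℂ A]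
    [StarRing A] [NonUnitalNormedRing B] [NormedSpace ℂ B] [StarRing B]
    (hB : IsReducedStarAlgebra B) (φ : A →⋆ₙₐ[ℂ] B) (hφ : Function.Injective φ) :
    IsReducedStarAlgebra A := by
  intro a ha
  refine hφ ((hB (φ a) fun H _ _ _ π => ha H (π.comp φ)).trans (map_zero φ).symm)

/-- `H` is lower semicontinuity of `N` with respect to `N'`. If $x$ is in the kernel, elements $b$
of `A` close to $x$ in `N` are automatically small in `N'`, because their images are close to 0. So
`H` bounds `N` of any $a$ close to $x$, and hence the norm of $x$. -/
lemma mapHom_injective {A : Type u} [NonUnitalRing A] [Module ℂ A] [StarRing A]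
    [IsScalarTower ℂ A A] [SMulCommClass ℂ A A] [StarModule ℂ A] {N N' : StarAlgSeminorm A}
    (h : ∀ a, N'.toSeminorm a ≤ N.toSeminorm a)
    (H : ∀ (a : A) (M : ℝ), 0 ≤ M →
      (∀ η > 0, ∃ b, N.toSeminorm (a - b) ≤ M ∧ N'.toSeminorm b ≤ η) → N.toSeminorm a ≤ M) :
    Function.Injective (mapHom h) := by
  rw [injective_iff_map_eq_zero]
  intro x hx
  rw [← norm_le_zero_iff]
  refine le_of_forall_pos_le_add fun ε hε => ?_
  obtain ⟨a, ha⟩ := exists_norm_sub_lt x (ε := ε / 3) (by positivity)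
  have h1 : N.toSeminorm a ≤ 2 * (ε / 3) := by
    refine H a _ (by positivity) fun η hη => ?_
    -- The bound $\varepsilon/3$ keeps `b` within $2\varepsilon/3$ of `a` in `N`, and the bound `η`
    -- makes `b` small in `N'`.
    obtain ⟨b, hb⟩ := exists_norm_sub_lt x (ε := min (ε / 3) η) (by positivity)
    refine ⟨b, ?_, ?_⟩
    · rw [← norm_ofAlg, ofAlg_sub]
      have e : ofAlg N a - ofAlg N b = (x - ofAlg N b) - (x - ofAlg N a) := by abel
      rw [e]
      have := hb.trans_le (min_le_left _ _)
      exact (norm_sub_le _ _).trans (by linarith)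
    · rw [← norm_ofAlg, ← mapHom_ofAlg h]
      have e : mapHom h (ofAlg N b) = - mapHom h (x - ofAlg N b) := by
        rw [map_sub, hx, zero_sub, neg_neg]
      rw [e, norm_neg]
      exact (norm_mapHom_le h _).trans (hb.le.trans (min_le_right _ _))
  have h2 : ‖x‖ ≤ ‖x - ofAlg N a‖ + ‖ofAlg N a‖ := by
    simpa using norm_add_le (x - ofAlg N a) (ofAlg N a)
  rw [norm_ofAlg] at h2
  linarith

variable {G : Type u} [TopologicalSpace G] [TopologicalGroupoid G]
    [MeasurableSpace G] [BorelSpace G]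
    [T2Space G] [SecondCountableTopology G] [LocallyCompactSpace G]
    (lam : HaarSystem G) (σ : TwoCocycle G)

open TwistedCc TopologicalGroupoid

/-- The regular representations extend contractively to the completion, and their norms have
supremum $\|\cdot\|_{r,2}$ on $C_c(\mathcal G,\sigma)$. If they all kill $a$, any approximant $f$ of
$a$ has $\|f\|_{r,2}$ at most the approximation error, so $a=0$. -/
lemma isReducedStarAlgebra_reducedCStarAlgebra :
    IsReducedStarAlgebra (ReducedCStarAlgebra lam σ) := by
  intro a ha
  have hrep : ∀ (x : UnitSpace G) (f : TwistedCc lam σ),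
      ‖regularRep lam σ x f‖ ≤ (seminormReduced lam σ).toSeminorm f := fun x f =>
    norm_leftRegular_le x f
  rw [← norm_le_zero_iff]
  refine le_of_forall_pos_le_add fun ε hε => ?_
  obtain ⟨f, hf⟩ := exists_norm_sub_lt a (ε := ε / 2) (by positivity)
  have h1 : reducedNorm 2 f ≤ ε / 2 := by
    refine Real.iSup_le (fun x => ?_) (by positivity)
    have h2 := ha _ (extendHom (regularRep lam σ x) (hrep x))
    have h3 := norm_extendHom_le (hrep x) (a - ofAlg _ f)
    rw [map_sub, h2, zero_sub, norm_neg, extendHom_ofAlg] at h3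
    exact h3.trans hf.le
  have h2 : ‖a‖ ≤ ‖a - ofAlg _ f‖ + ‖ofAlg (seminormReduced lam σ) f‖ := by
    calc ‖a‖ = ‖a - ofAlg _ f + ofAlg (seminormReduced lam σ) f‖ := by rw [sub_add_cancel]
      _ ≤ _ := norm_add_le _ _
  have h3 : ‖ofAlg (seminormReduced lam σ) f‖ = reducedNorm 2 f := norm_ofAlg _ f
  rw [h3] at h2
  linarith

end Nested

end

/-! ### The nested triple and its spectral interpolation inequality. -/

theorem mainTheorem8 {G : Type u} [TopologicalSpace G] [TopologicalGroupoid G]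
    [MeasurableSpace G] [BorelSpace G]
    [T2Space G] [SecondCountableTopology G] [LocallyCompactSpace G]
    (lam : HaarSystem G) (σ : TwoCocycle G) (p : ℝ) (hp : 1 < p) (hp2 : p < 2) :
    ∃ (Φ : L1Algebra lam σ →⋆ₙₐ[ℂ] FSharpAlgebra lam σ p hp)
      (π : FSharpAlgebra lam σ p hp →⋆ₙₐ[ℂ] ReducedCStarAlgebra lam σ),
      (∀ f : TwistedCc lam σ,
        Φ (StarAlgSeminorm.Completion.ofAlg _ f) = StarAlgSeminorm.Completion.ofAlg _ f) ∧
      (∀ f : TwistedCc lam σ,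
        π (StarAlgSeminorm.Completion.ofAlg _ f) = StarAlgSeminorm.Completion.ofAlg _ f) ∧
      IsNestedTriple Φ π ∧
      IsSpectralInterpolationTriple Φ π ⊤ ∧
      ∀ f : L1Algebra lam σ,
        specRadius (Φ f) ≤
          specRadius f ^ (1 - (2 * p - 2) / p) * specRadius (π (Φ f)) ^ ((2 * p - 2) / p) := by
  have hc : p.HolderConjugate (p / (p - 1)) := Real.HolderConjugate.conjExponent hp
  have := hc.ennrealOfReal
  have : Fact (1 ≤ ENNReal.ofReal p) := ⟨ENNReal.one_le_ofReal.2 hc.lt.le⟩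
  have : Fact (1 ≤ ENNReal.ofReal (p / (p - 1))) := ⟨ENNReal.one_le_ofReal.2 hc.symm.lt.le⟩
  have hp0 : 0 < p := by linarith
  set t := (2 * p - 2) / p with ht
  have ht0 : 0 < t := div_pos (by linarith) hp0
  have ht1 : t < 1 := by rw [ht, div_lt_one hp0]; linarith
  -- This equation determines $\theta$: $1/p=1-\theta/2$, that is $\theta=2-2/p=(2p-2)/p$.
  have hpt : (ENNReal.ofReal p).toReal⁻¹ = 1 - t + t * 2⁻¹ := by
    rw [ENNReal.toReal_ofReal hp0.le, ht]
    field_simp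
    ring
  have h1 : ∀ f : TwistedCc lam σ,
      (seminormSharp lam σ p hp).toSeminorm f ≤ (seminormI lam σ).toSeminorm f :=
    fun f => TwistedCc.sharpNorm_le_normI f
  have h2 : ∀ f : TwistedCc lam σ,
      (seminormReduced lam σ).toSeminorm f ≤ (seminormSharp lam σ p hp).toSeminorm f :=
    fun f => TwistedCc.reducedNorm_two_le_sharpNorm ENNReal.ofReal_ne_top ENNReal.ofReal_ne_top f
  have h3 : ∀ f : TwistedCc lam σ,
      (seminormReduced lam σ).toSeminorm f ≤ (seminormI lam σ).toSeminorm f :=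
    fun f => (h2 f).trans (h1 f)
  let Φ := StarAlgSeminorm.Completion.mapHom h1
  let π := StarAlgSeminorm.Completion.mapHom h2
  have hΦ : ∀ f : TwistedCc lam σ,
      Φ (StarAlgSeminorm.Completion.ofAlg _ f) = StarAlgSeminorm.Completion.ofAlg _ f :=
    StarAlgSeminorm.Completion.mapHom_ofAlg h1
  have hπ : ∀ f : TwistedCc lam σ,
      π (StarAlgSeminorm.Completion.ofAlg _ f) = StarAlgSeminorm.Completion.ofAlg _ f :=
    StarAlgSeminorm.Completion.mapHom_ofAlg h2
  have hΦc : Continuous Φ := StarAlgSeminorm.Completion.continuous_mapHom h1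
  have hπc : Continuous π := StarAlgSeminorm.Completion.continuous_mapHom h2
  have hπi : Function.Injective π := mapHom_injective h2 fun f M hM h =>
    TwistedCc.sharpNorm_le_of_approx ENNReal.ofReal_ne_top ENNReal.ofReal_ne_top hM h
  have hcomp : ∀ x, π (Φ x) = StarAlgSeminorm.Completion.mapHom h3 x := by
    intro x
    refine StarAlgSeminorm.Completion.ind x (isClosed_eq (hπc.comp hΦc)
      (StarAlgSeminorm.Completion.continuous_mapHom h3)) fun f => ?_
    rw [hΦ, hπ, StarAlgSeminorm.Completion.mapHom_ofAlg]
  -- It is enough that the composite to $C^*_r$ be injective, so the $I$-norm is compared directly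
  -- with $\|\cdot\|_{r,2}$ and not with $\|\cdot\|_{\sharp,p}$.
  have hΦi : Function.Injective Φ := by
    have h4 : Function.Injective (StarAlgSeminorm.Completion.mapHom h3) :=
      mapHom_injective h3 fun f M hM h => TwistedCc.normI_le_of_approx hM h
    intro x y hxy
    exact h4 (by rw [← hcomp, ← hcomp, hxy])
  have hC := isReducedStarAlgebra_reducedCStarAlgebra lam σ
  have hB := hC.of_injective π hπi
  have hnest : IsNestedTriple Φ π :=
    ⟨⟨hB.of_injective Φ hΦi, hB, hΦc, hΦi, StarAlgSeminorm.Completion.denseRange_mapHom h1⟩,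
      ⟨hB, hC, hπc, hπi, StarAlgSeminorm.Completion.denseRange_mapHom h2⟩⟩
  -- Both sides are continuous on $L^1(\mathcal G,\sigma)$, as the exponents $1-t$ and $t$ are
  -- nonnegative, so the inequality needs checking only on $C_c(\mathcal G,\sigma)$.
  have hnorm : ∀ x, ‖Φ x‖ ≤ ‖x‖ ^ (1 - t) * ‖(π.comp Φ) x‖ ^ t := by
    intro x
    refine StarAlgSeminorm.Completion.ind x (isClosed_le hΦc.norm
      ((continuous_norm.rpow_const fun _ => .inr (by linarith)).mul
        ((hπc.comp hΦc).norm.rpow_const fun _ => .inr ht0.le))) fun f => ?_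
    rw [NonUnitalStarAlgHom.comp_apply, hΦ, hπ, StarAlgSeminorm.Completion.norm_ofAlg,
      StarAlgSeminorm.Completion.norm_ofAlg, StarAlgSeminorm.Completion.norm_ofAlg]
    exact TwistedCc.sharpNorm_le_interp ENNReal.ofReal_ne_top ENNReal.ofReal_ne_top ht0.le ht1.le
      hpt f
  have hspec : ∀ f : L1Algebra lam σ,
      specRadius (Φ f) ≤ specRadius f ^ (1 - t) * specRadius (π (Φ f)) ^ t :=
    specRadius_le_interp Φ (π.comp Φ) ht0.le ht1.le hnorm
  exact ⟨Φ, π, hΦ, hπ, hnest, ⟨hnest, by simp, t, ht0, ht1, fun a _ _ => hspec a⟩, hspec⟩
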